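/- A matching-based contract instance consists of a finite bipartite graph $G=(V\cup U,A)$ with a reward $f_{v,u}\ge 0$ and a cost $c_{v,u}\ge 0$ for every edge $(v,u)\in A$. For $S\subseteq A$ let $f(S)$ be the maximum of $\sum_{(v,u)\in M} f_{v,u}$ over all matchings $M\subseteq S$, and let $c(S)=\sum_{(v,u)\in S}c_{v,u}$. Under a contract $\alpha\in[0,1]$ the agent chooses a set $S_\alpha\subseteq A$ that maximizes $\alpha f(S)-c(S)$ over all $S\subseteq A$; ties are broken in favor of larger $f(S)$, and any remaining ties by a consistent rule (one whose choice depends only on the collection of tied sets). The critical values are $\alpha=0$ together with all $\alpha\in[0,1]$ at which $S_\alpha$ changes, i.e. near which $\beta\mapsto S_\beta$ is not constant on $[0,1]$. An optimal contract is an $\alpha\in[0,1]$ that maximizes the principal's utility $(1-\alpha)f(S_\alpha)$ over $[0,1]$. Theorem. Consider matching-based instances with one-sided costs, i.e. such that for some numbers $(c_u)_{u\in U}$ we have $c_{v,u}=c_u$ for every edge $(v,u)\in A$. (1) The number of critical values is $O(n^2)$, where $n=|V|+|U|\ge 1$ is the number of vertices: there is a universal constant $C$ such that every such instance, with real rewards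 and costs, has at most $Cn^2$ critical values, whatever the consistent tie-breaking rule. (2) There is an algorithm that, given such an instance with rational rewards and costs, computes an optimal contract in time polynomial in the length of the binary encoding of the instance (the graph, given by its adjacency matrix, and the numerators and denominators of the rewards and costs). Time is measured on a random access machine with integer arithmetic and logarithmic (bit) cost. The computed contract is rational, and optimal for every consistent tie-breaking rule. -/

import Mathlib

open Topology

noncomputable section

/-! ## Matching-based contract instances -/

/-- A matching-based instance: a bipartite graph with sides `V` and `U`, whose edges are the agent's
actions; every edge has a nonnegative reward and a nonnegative cost. -/
structure MatchingInstance (V U K : Type*) [Zero K] [LE K] where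
  edges : Finset (V × U)
  reward : V × U → K
  cost : V × U → K
  reward_nonneg : ∀ e ∈ edges, 0 ≤ reward e
  cost_nonneg : ∀ e ∈ edges, 0 ≤ cost e

/-- A set of edges of a bipartite graph is a matching if no two of its edges share an endpoint. -/
def IsBipartiteMatching {V U : Type*} (M : Finset (V × U)) : Prop :=
  ∀ e ∈ M, ∀ e' ∈ M, (e.1 = e'.1 ∨ e.2 = e'.2) → e = e'

/-- A tie-breaking rule: it selects one member of every nonempty collection of sets of actions.
It sees only the collection of tied sets, not the contract, so it is consistent. -/
structure TieBreaking (E : Type*) where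
  select : Finset (Finset E) → Finset E
  select_mem : ∀ D : Finset (Finset E), D.Nonempty → select D ∈ D

namespace MatchingInstance

variable {V U : Type*}

/-- The cost of an edge depends only on its endpoint in `U`. -/
def OneSidedCosts {K : Type*} [Zero K] [LE K] (I : MatchingInstance V U K) : Prop :=
  ∃ c : U → K, ∀ e ∈ I.edges, I.cost e = c e.2

/-- The real instance given by rational data. -/
def toReal (I : MatchingInstance V U ℚ) : MatchingInstance V U ℝ where
  edges := I.edges
  reward e := (I.reward e : ℝ)
  cost e := (I.cost e : ℝ)
  reward_nonneg e he := by exact_mod_cast I.reward_nonneg e he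
  cost_nonneg e he := by exact_mod_cast I.cost_nonneg e he

open Classical in
/-- The reward `f(S)` of a set of edges: the maximum weight of a matching contained in `S`. -/
def setReward (I : MatchingInstance V U ℝ) (S : Finset (V × U)) : ℝ :=
  (S.powerset.filter IsBipartiteMatching).sup'
    ⟨∅, by simp [IsBipartiteMatching]⟩ (fun M => ∑ e ∈ M, I.reward e)

/-- The additive cost `c(S)` of a set of edges. -/
def setCost (I : MatchingInstance V U ℝ) (S : Finset (V × U)) : ℝ :=
  ∑ e ∈ S, I.cost e

/-- The agent's utility `α f(S) - c(S)`. -/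
def agentUtility (I : MatchingInstance V U ℝ) (α : ℝ) (S : Finset (V × U)) : ℝ :=
  α * I.setReward S - I.setCost S

open Classical in
/-- The sets of actions that maximize the agent's utility under the contract `α`. -/
def demand (I : MatchingInstance V U ℝ) (α : ℝ) : Finset (Finset (V × U)) :=
  I.edges.powerset.filter
    (fun S => ∀ T ∈ I.edges.powerset, I.agentUtility α T ≤ I.agentUtility α S)

open Classical in
/-- The members of the demand that are best for the principal, i.e. those of highest reward. -/
def favoredDemand (I : MatchingInstance V U ℝ) (α : ℝ) : Finset (Finset (V × U)) :=
  (I.demand α).filter (fun S => ∀ T ∈ I.demand α, I.setReward T ≤ I.setReward S)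

/-- The agent's best response `S_α`: ties are broken in favor of the principal, and the remaining
ties by the consistent rule `τ`. -/
def bestResponse (I : MatchingInstance V U ℝ) (τ : TieBreaking (V × U)) (α : ℝ) :
    Finset (V × U) :=
  τ.select (I.favoredDemand α)

/-- The critical values: the contracts `α ∈ [0, 1]` at which the best response changes (it is not
constant on any neighborhood of `α` in `[0, 1]`); by convention `0` is one of them. -/
def criticalValues (I : MatchingInstance V U ℝ) (τ : TieBreaking (V × U)) : Set ℝ :=
  {α | α ∈ Set.Icc (0 : ℝ) 1 ∧
    (α = 0 ∨ ¬ ∀ᶠ β in 𝓝[Set.Icc (0 : ℝ) 1] α, I.bestResponse τ β = I.bestResponse τ α)}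

/-- The principal's utility `(1 - α) f(S_α)` under the contract `α`. -/
def principalUtility (I : MatchingInstance V U ℝ) (τ : TieBreaking (V × U)) (α : ℝ) : ℝ :=
  (1 - α) * I.setReward (I.bestResponse τ α)

/-- `α` is an optimal contract: it maximizes the principal's utility over `[0, 1]`. -/
def IsOptimalContract (I : MatchingInstance V U ℝ) (τ : TieBreaking (V × U)) (α : ℝ) : Prop :=
  α ∈ Set.Icc (0 : ℝ) 1 ∧
    ∀ β ∈ Set.Icc (0 : ℝ) 1, I.principalUtility τ β ≤ I.principalUtility τ α

/-- The instance as a list of integers: the two numbers of vertices and then, row by row, five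
entries for every pair `(v, u)`: whether it is an edge, and if so, numerator and denominator of its
reward and of its cost. -/
def encode {p q : ℕ} (I : MatchingInstance (Fin p) (Fin q) ℚ) : List ℤ :=
  (p : ℤ) :: (q : ℤ) :: (List.finRange p).flatMap fun v => (List.finRange q).flatMap fun u =>
    if (v, u) ∈ I.edges then
      [1, (I.reward (v, u)).num, ((I.reward (v, u)).den : ℤ),
        (I.cost (v, u)).num, ((I.cost (v, u)).den : ℤ)]
    else [0, 0, 0, 0, 0]

end MatchingInstance

/-! ## A random access machine with logarithmic cost

Programs are finite texts over finitely many integer arrays, with indirect addressing. Time is bit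
cost: every operation is charged the binary length of the integers that it handles (addresses
included), so that polynomial time is polynomial time on a Turing machine. -/

namespace RAM

/-- The length of an integer in binary, with its sign. -/
def bitLength (z : ℤ) : ℕ := z.natAbs.size + 1

/-- The length in binary of a list of integers. -/
def inputLength (w : List ℤ) : ℕ := (w.map bitLength).sum

/-- A memory: the contents of array `a` at index `i` is `σ a i`. -/
abbrev Memory := ℕ → ℤ → ℤ

/-- Expressions: integer constants, array access with a computed index, arithmetic. -/
inductive Expr where
  | const (z : ℤ)
  | get (a : ℕ) (i : Expr)
  | add (e₁ e₂ : Expr)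
  | sub (e₁ e₂ : Expr)
  | mul (e₁ e₂ : Expr)
  | div (e₁ e₂ : Expr)

namespace Expr

def val (σ : Memory) : Expr → ℤ
  | const z => z
  | get a i => σ a (i.val σ)
  | add e₁ e₂ => e₁.val σ + e₂.val σ
  | sub e₁ e₂ => e₁.val σ - e₂.val σ
  | mul e₁ e₂ => e₁.val σ * e₂.val σ
  | div e₁ e₂ => e₁.val σ / e₂.val σ

/-- The time to evaluate an expression: the total binary length of all values that occur, i.e. of
the values of all its subexpressions (so of all operands, indices and results). -/
def time (σ : Memory) : Expr → ℕ
  | const z => bitLength z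
  | get a i => i.time σ + bitLength (σ a (i.val σ))
  | add e₁ e₂ => e₁.time σ + e₂.time σ + bitLength (e₁.val σ + e₂.val σ)
  | sub e₁ e₂ => e₁.time σ + e₂.time σ + bitLength (e₁.val σ - e₂.val σ)
  | mul e₁ e₂ => e₁.time σ + e₂.time σ + bitLength (e₁.val σ * e₂.val σ)
  | div e₁ e₂ => e₁.time σ + e₂.time σ + bitLength (e₁.val σ / e₂.val σ)

end Expr

/-- Programs: doing nothing, writing the value of `e` to array `a` at index `i`, composition,
branching on `0 < e`, and repetition as long as `0 < e`. -/
inductive Prog where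
  | nop
  | put (a : ℕ) (i e : Expr)
  | seq (P Q : Prog)
  | ifPos (e : Expr) (P Q : Prog)
  | whilePos (e : Expr) (P : Prog)

def Memory.write (σ : Memory) (a : ℕ) (i z : ℤ) : Memory :=
  Function.update σ a (Function.update (σ a) i z)

/-- `Exec P σ σ' t`: program `P`, started with memory `σ`, halts with memory `σ'` after time `t`. -/
inductive Exec : Prog → Memory → Memory → ℕ → Prop
  | nop (σ : Memory) : Exec Prog.nop σ σ 1
  | put (σ : Memory) (a : ℕ) (i e : Expr) :
      Exec (Prog.put a i e) σ (σ.write a (i.val σ) (e.val σ)) (i.time σ + e.time σ + 1)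
  | seq {P Q : Prog} {σ σ' σ'' : Memory} {s t : ℕ} (hP : Exec P σ σ' s) (hQ : Exec Q σ' σ'' t) :
      Exec (Prog.seq P Q) σ σ'' (s + t)
  | ifPos_true {e : Expr} {P Q : Prog} {σ σ' : Memory} {t : ℕ} (he : 0 < e.val σ)
      (hP : Exec P σ σ' t) : Exec (Prog.ifPos e P Q) σ σ' (e.time σ + t + 1)
  | ifPos_false {e : Expr} {P Q : Prog} {σ σ' : Memory} {t : ℕ} (he : ¬ 0 < e.val σ)
      (hQ : Exec Q σ σ' t) : Exec (Prog.ifPos e P Q) σ σ' (e.time σ + t + 1)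
  | whilePos_true {e : Expr} {P : Prog} {σ σ' σ'' : Memory} {s t : ℕ} (he : 0 < e.val σ)
      (hP : Exec P σ σ' s) (hloop : Exec (Prog.whilePos e P) σ' σ'' t) :
      Exec (Prog.whilePos e P) σ σ'' (e.time σ + s + t + 1)
  | whilePos_false {e : Expr} {P : Prog} {σ : Memory} (he : ¬ 0 < e.val σ) :
      Exec (Prog.whilePos e P) σ σ (e.time σ + 1)

/-- The initial memory: the input stands in array `0`, from index `0` on; all else is `0`. -/
def initial (w : List ℤ) : Memory := fun a i =>
  if a = 0 ∧ 0 ≤ i then w.getD i.toNat 0 else 0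

/-- On input `w`, the program halts within time `t` and outputs the rational number `x`, as a
numerator and a positive denominator (not necessarily in lowest terms) at indices `0` and `1` of
array `1`. -/
def OutputsWithin (P : Prog) (w : List ℤ) (x : ℚ) (t : ℕ) : Prop :=
  ∃ (σ : Memory) (s : ℕ), Exec P (initial w) σ s ∧ s ≤ t ∧
    0 < σ 1 1 ∧ x = (σ 1 0 : ℚ) / (σ 1 1 : ℚ)

end RAM

end

/-! ## Matchings and exchanges -/

theorem IsBipartiteMatching.mono {V U : Type*} {M N : Finset (V × U)} (hM : IsBipartiteMatching M)
    (h : N ⊆ M) : IsBipartiteMatching N :=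
  fun e he e' he' => hM e (h he) e' (h he')

theorem isBipartiteMatching_empty {V U : Type*} : IsBipartiteMatching (∅ : Finset (V × U)) := by
  simp [IsBipartiteMatching]

open Classical in
/-- The edges `A` of the matching `M` can be exchanged for the edges `A'` of the matching `M'`:
both sets obtained by the exchange are again matchings. -/
structure IsExchange {V U : Type*} (M M' A A' : Finset (V × U)) : Prop where
  subset_left : A ⊆ M
  subset_right : A' ⊆ M'
  matching_left : IsBipartiteMatching (M \ A ∪ A')
  matching_right : IsBipartiteMatching (M' \ A' ∪ A)
  disjoint_left : Disjoint (M \ A) A'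
  disjoint_right : Disjoint (M' \ A') A

namespace IsExchange

variable {V U : Type*} {M M' A A' B B' : Finset (V × U)}

open Classical in
theorem sum_left (h : IsExchange M M' A A') (w : V × U → ℝ) :
    ∑ e ∈ M \ A ∪ A', w e = ∑ e ∈ M, w e - ∑ e ∈ A, w e + ∑ e ∈ A', w e := by
  rw [Finset.sum_union h.disjoint_left, Finset.sum_sdiff_eq_sub h.subset_left]

open Classical in
theorem sum_right (h : IsExchange M M' A A') (w : V × U → ℝ) :
    ∑ e ∈ M' \ A' ∪ A, w e = ∑ e ∈ M', w e - ∑ e ∈ A', w e + ∑ e ∈ A, w e := by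
  rw [Finset.sum_union h.disjoint_right, Finset.sum_sdiff_eq_sub h.subset_right]

open Classical in
/-- An exchange between what remains after a first exchange is an exchange between the original
matchings. -/
theorem of_sdiff (hM : IsBipartiteMatching M) (hM' : IsBipartiteMatching M')
    (h : IsExchange M M' A A') (k : IsExchange (M \ A) (M' \ A') B B') : IsExchange M M' B B' := by
  obtain ⟨h1, h2, h3, h4, h5, h6⟩ := h
  obtain ⟨k1, k2, k3, k4, k5, k6⟩ := k
  simp only [Finset.disjoint_left, Finset.subset_iff, Finset.mem_sdiff, IsBipartiteMatching,
    Finset.mem_union] at *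
  refine ⟨fun e he => (k1 he).1, fun e he => (k2 he).1, ?_, ?_, ?_, ?_⟩ <;>
    simp only [Finset.disjoint_left, IsBipartiteMatching, Finset.mem_sdiff, Finset.mem_union]
  · intro e he e' he' hh
    by_cases hA : e ∈ A <;> by_cases hA' : e' ∈ A
    · exact hM e (h1 hA) e' (h1 hA') hh
    · rcases he' with he' | he'
      · exact hM e (h1 hA) e' he'.1 hh
      · exact h4 e (Or.inr hA) e' (Or.inl (k2 he')) hh
    · rcases he with he | he
      · exact hM e he.1 e' (h1 hA') hh
      · exact h4 e (Or.inl (k2 he)) e' (Or.inr hA') hh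
    · refine k3 e ?_ e' ?_ hh
      · tauto
      · tauto
  · intro e he e' he' hh
    by_cases hA : e ∈ A' <;> by_cases hA' : e' ∈ A'
    · exact hM' e (h2 hA) e' (h2 hA') hh
    · rcases he' with he' | he'
      · exact hM' e (h2 hA) e' he'.1 hh
      · exact h3 e (Or.inr hA) e' (Or.inl (k1 he')) hh
    · rcases he with he | he
      · exact hM' e he.1 e' (h2 hA') hh
      · exact h3 e (Or.inl (k1 he)) e' (Or.inr hA') hh
    · refine k4 e ?_ e' ?_ hh
      · tauto
      · tauto
  · rintro e ⟨he, heB⟩ heB'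
    by_cases hA : e ∈ A
    · exact h6 (k2 heB') hA
    · exact k5 ⟨⟨he, hA⟩, heB⟩ heB'
  · rintro e ⟨he, heB⟩ heB'
    by_cases hA : e ∈ A'
    · exact h5 (k1 heB') hA
    · exact k6 ⟨⟨he, hA⟩, heB⟩ heB'

end IsExchange

section Exchange

variable {V U : Type*}

open Classical in
/-- A vertex `u` covered by `M` and not by `M'` can be exchanged for at most one other vertex. -/
theorem exists_isExchange (n : ℕ) : ∀ {M M' : Finset (V × U)}, M.card ≤ n →
    IsBipartiteMatching M → IsBipartiteMatching M' → ∀ {e : V × U}, e ∈ M →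
    (∀ e' ∈ M', e'.2 ≠ e.2) →
    ∃ A A', IsExchange M M' A A' ∧ e ∈ A ∧ ((∀ φ : U → ℝ,
      ∑ x ∈ A', φ x.2 = ∑ x ∈ A, φ x.2 - φ e.2) ∨ ∃ u, ∀ φ : U → ℝ,
      ∑ x ∈ A', φ x.2 = ∑ x ∈ A, φ x.2 - φ e.2 + φ u) := by
  induction n with
  | zero => intro M M' h _ _ e he; simp_all
  | succ n ih =>
    intro M M' hcard hM hM' e he hu
    have heM' : e ∉ M' := fun h => hu e h rfl
    by_cases h1 : ∃ e' ∈ M', e'.1 = e.1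
    swap
    · push Not at h1
      refine ⟨{e}, ∅, ⟨by simpa using he, by simp, ?_, ?_, by simp, by simpa using heM'⟩,
        by simp, Or.inl fun φ => by simp⟩
      · exact hM.mono (by simp)
      · intro a ha b hb hh
        simp only [Finset.sdiff_empty, Finset.mem_union, Finset.mem_singleton] at ha hb
        rcases ha with ha | rfl <;> rcases hb with hb | rfl
        · exact hM' a ha b hb hh
        · rcases hh with hh | hh
          · exact absurd hh (h1 a ha)
          · exact absurd hh (hu a ha)
        · rcases hh with hh | hh
          · exact absurd hh.symm (h1 b hb)
          · exact absurd hh.symm (hu b hb)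
        · rfl
    obtain ⟨e', he', hv⟩ := h1
    have hee' : e' ≠ e := fun h => heM' (h ▸ he')
    have he'M : e' ∉ M := fun h => hee' (hM e' h e he (Or.inl hv))
    by_cases h2 : ∃ d ∈ M, d.2 = e'.2
    swap
    · push Not at h2
      refine ⟨{e}, {e'}, ⟨by simpa using he, by simpa using he', ?_, ?_, ?_, ?_⟩,
        by simp, Or.inr ⟨e'.2, fun φ => by simp⟩⟩
      · intro a ha b hb hh
        simp only [Finset.mem_union, Finset.mem_sdiff, Finset.mem_singleton] at ha hb
        rcases ha with ha | rfl <;> rcases hb with hb | rfl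
        · exact hM a ha.1 b hb.1 hh
        · rcases hh with hh | hh
          · exact absurd (hM a ha.1 e he (Or.inl (hh.trans hv))) ha.2
          · exact absurd hh (h2 a ha.1)
        · rcases hh with hh | hh
          · exact absurd (hM b hb.1 e he (Or.inl (hh.symm.trans hv))) hb.2
          · exact absurd hh.symm (h2 b hb.1)
        · rfl
      · intro a ha b hb hh
        simp only [Finset.mem_union, Finset.mem_sdiff, Finset.mem_singleton] at ha hb
        rcases ha with ha | rfl <;> rcases hb with hb | rfl
        · exact hM' a ha.1 b hb.1 hh
        · rcases hh with hh | hh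
          · exact absurd (hM' a ha.1 e' he' (Or.inl (hh.trans hv.symm))) ha.2
          · exact absurd hh (hu a ha.1)
        · rcases hh with hh | hh
          · exact absurd (hM' b hb.1 e' he' (Or.inl (hh.symm.trans hv.symm))) hb.2
          · exact absurd hh.symm (hu b hb.1)
        · rfl
      · simp [he'M]
      · simp [heM']
    obtain ⟨d, hd, hdu⟩ := h2
    have hde : d ≠ e := fun h => hu e' he' (by rw [← hdu, h])
    have hM1 : IsBipartiteMatching (M.erase e) := hM.mono (Finset.erase_subset _ _)
    have hM1' : IsBipartiteMatching (M'.erase e') := hM'.mono (Finset.erase_subset _ _)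
    obtain ⟨B, B', hB, hdB, hφ⟩ := ih (M := M.erase e) (M' := M'.erase e')
      (by rw [Finset.card_erase_of_mem he]; omega) hM1 hM1' (e := d)
      (Finset.mem_erase.2 ⟨hde, hd⟩) (by
        intro x hx hxd
        rw [Finset.mem_erase] at hx
        exact hx.1 (hM' x hx.2 e' he' (Or.inr (hxd.trans hdu))))
    obtain ⟨b1, b2, b3, b4, b5, b6⟩ := hB
    have heB : e ∉ B := fun h => by simpa using b1 h
    have heB' : e' ∉ B' := fun h => by simpa using b2 h
    have hBM : ∀ x ∈ B, x ∈ M ∧ x ≠ e := fun x hx => by have := b1 hx; simp_all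
    have hBM' : ∀ x ∈ B', x ∈ M' ∧ x ≠ e' := fun x hx => by have := b2 hx; simp_all
    refine ⟨insert e B, insert e' B', ⟨?_, ?_, ?_, ?_, ?_, ?_⟩, by simp, ?_⟩
    · intro x hx
      rcases Finset.mem_insert.1 hx with rfl | hx
      exacts [he, (hBM x hx).1]
    · intro x hx
      rcases Finset.mem_insert.1 hx with rfl | hx
      exacts [he', (hBM' x hx).1]
    · have key : ∀ a, (a ∈ M ∧ a ≠ e ∧ a ∉ B ∨ a ∈ B') → ¬ (a.1 = e'.1 ∨ a.2 = e'.2) := by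
        rintro a (⟨ha, hae, haB⟩ | ha) (hh | hh)
        · exact hae (hM a ha e he (Or.inl (hh.trans hv)))
        · exact haB (hM a ha d hd (Or.inr (hh.trans hdu.symm)) ▸ hdB)
        · exact (hBM' a ha).2 (hM' a (hBM' a ha).1 e' he' (Or.inl hh))
        · exact (hBM' a ha).2 (hM' a (hBM' a ha).1 e' he' (Or.inr hh))
      intro a ha b hb hh
      simp only [Finset.mem_union, Finset.mem_sdiff, Finset.mem_insert, not_or] at ha hb
      have ha' : a = e' ∨ (a ∈ M ∧ a ≠ e ∧ a ∉ B ∨ a ∈ B') := by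
        rcases ha with h | h | h
        exacts [Or.inr (Or.inl h), Or.inl h, Or.inr (Or.inr h)]
      have hb' : b = e' ∨ (b ∈ M ∧ b ≠ e ∧ b ∉ B ∨ b ∈ B') := by
        rcases hb with h | h | h
        exacts [Or.inr (Or.inl h), Or.inl h, Or.inr (Or.inr h)]
      rcases ha' with rfl | ha' <;> rcases hb' with rfl | hb'
      · rfl
      · exact absurd (hh.imp Eq.symm Eq.symm) (key b hb')
      · exact absurd hh (key a ha')
      · refine b3 a ?_ b ?_ hh <;> simp only [Finset.mem_union, Finset.mem_sdiff, Finset.mem_erase]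
        exacts [ha'.imp_left fun h => ⟨⟨h.2.1, h.1⟩, h.2.2⟩, hb'.imp_left fun h => ⟨⟨h.2.1, h.1⟩, h.2.2⟩]
    · have key : ∀ a, (a ∈ M' ∧ a ≠ e' ∧ a ∉ B' ∨ a ∈ B) → ¬ (a.1 = e.1 ∨ a.2 = e.2) := by
        rintro a (⟨ha, hae, haB⟩ | ha) (hh | hh)
        · exact hae (hM' a ha e' he' (Or.inl (hh.trans hv.symm)))
        · exact hu a ha hh
        · exact (hBM a ha).2 (hM a (hBM a ha).1 e he (Or.inl hh))
        · exact (hBM a ha).2 (hM a (hBM a ha).1 e he (Or.inr hh))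
      intro a ha b hb hh
      simp only [Finset.mem_union, Finset.mem_sdiff, Finset.mem_insert, not_or] at ha hb
      have ha' : a = e ∨ (a ∈ M' ∧ a ≠ e' ∧ a ∉ B' ∨ a ∈ B) := by
        rcases ha with h | h | h
        exacts [Or.inr (Or.inl h), Or.inl h, Or.inr (Or.inr h)]
      have hb' : b = e ∨ (b ∈ M' ∧ b ≠ e' ∧ b ∉ B' ∨ b ∈ B) := by
        rcases hb with h | h | h
        exacts [Or.inr (Or.inl h), Or.inl h, Or.inr (Or.inr h)]
      rcases ha' with rfl | ha' <;> rcases hb' with rfl | hb'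
      · rfl
      · exact absurd (hh.imp Eq.symm Eq.symm) (key b hb')
      · exact absurd hh (key a ha')
      · refine b4 a ?_ b ?_ hh <;> simp only [Finset.mem_union, Finset.mem_sdiff, Finset.mem_erase]
        exacts [ha'.imp_left fun h => ⟨⟨h.2.1, h.1⟩, h.2.2⟩, hb'.imp_left fun h => ⟨⟨h.2.1, h.1⟩, h.2.2⟩]
    · rw [Finset.disjoint_left] at b5 ⊢
      intro a ha ha'
      simp only [Finset.mem_sdiff, Finset.mem_insert, not_or] at ha ha'
      rcases ha' with rfl | ha'
      · exact he'M ha.1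
      · exact b5 (by simp [ha]) ha'
    · rw [Finset.disjoint_left] at b6 ⊢
      intro a ha ha'
      simp only [Finset.mem_sdiff, Finset.mem_insert, not_or] at ha ha'
      rcases ha' with rfl | ha'
      · exact heM' ha.1
      · exact b6 (by simp [ha]) ha'
    · simp only [Finset.sum_insert heB, Finset.sum_insert heB']
      refine hφ.imp (fun h φ => ?_) (fun ⟨u, h⟩ => ⟨u, fun φ => ?_⟩)
      · rw [h φ, hdu]; ring
      · rw [h φ, hdu]; ring

open Classical in
/-- If no exchange lowers the cost, then no potential that is monotone in the cost is lower on `M'`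
than on `M`. -/
theorem sum_potential_le {c φ : U → ℝ} (hc : ∀ u, 0 ≤ c u) (hφ : ∀ u, 0 ≤ φ u)
    (hφ0 : ∀ u, c u = 0 → φ u = 0) (hmono : ∀ u u', c u ≤ c u' → φ u ≤ φ u') (n : ℕ) :
    ∀ {M M' : Finset (V × U)}, M.card ≤ n → IsBipartiteMatching M → IsBipartiteMatching M' →
    (∀ A A', IsExchange M M' A A' → ∑ e ∈ A, c e.2 ≤ ∑ e ∈ A', c e.2) →
    ∑ e ∈ M, φ e.2 ≤ ∑ e ∈ M', φ e.2 := by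
  induction n with
  | zero =>
    intro M M' h _ _ _
    have : M = ∅ := by simpa using h
    subst this
    simpa using Finset.sum_nonneg fun e _ => hφ e.2
  | succ n ih =>
    intro M M' hcard hM hM' hH
    by_cases h : ∃ e ∈ M, ∀ e' ∈ M', e'.2 ≠ e.2
    · obtain ⟨e, he, hu⟩ := h
      obtain ⟨A, A', hA, heA, hsum⟩ := exists_isExchange M.card le_rfl hM hM' he hu
      have h1 : ∑ x ∈ M \ A, φ x.2 ≤ ∑ x ∈ M' \ A', φ x.2 := by
        refine ih ?_ (hM.mono Finset.sdiff_subset) (hM'.mono Finset.sdiff_subset)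
          fun B B' hB => hH B B' (hA.of_sdiff hM hM' hB)
        have : (M \ A).card < M.card :=
          Finset.card_lt_card (Finset.ssubset_iff_of_subset Finset.sdiff_subset |>.2
            ⟨e, he, by simp [heA]⟩)
        omega
      have h2 : ∑ x ∈ A, φ x.2 ≤ ∑ x ∈ A', φ x.2 := by
        have hcA := hH A A' hA
        rcases hsum with hs | ⟨u, hs⟩
        · rw [hs c] at hcA
          rw [hs φ, hφ0 e.2 (le_antisymm (by linarith) (hc _))]
          simp
        · rw [hs c] at hcA
          rw [hs φ]
          linarith [hmono e.2 u (by linarith)]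
      rw [Finset.sum_sdiff_eq_sub hA.subset_left, Finset.sum_sdiff_eq_sub hA.subset_right] at h1
      linarith
    · push Not at h
      have inj : ∀ N : Finset (V × U), IsBipartiteMatching N →
          Set.InjOn Prod.snd (N : Set (V × U)) :=
        fun N hN a ha b hb hab => hN a ha b hb (Or.inr hab)
      rw [← Finset.sum_image (f := φ) (inj M hM), ← Finset.sum_image (f := φ) (inj M' hM')]
      refine Finset.sum_le_sum_of_subset_of_nonneg ?_ fun u _ _ => hφ u
      intro u hu
      obtain ⟨e, he, rfl⟩ := Finset.mem_image.1 hu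
      obtain ⟨e', he', h'⟩ := h e he
      exact Finset.mem_image.2 ⟨e', he', h'⟩

open Classical in
/-- The rank of a vertex among the vertices of positive cost. -/
noncomputable def costRank [Fintype U] (c : U → ℝ) (u : U) : ℕ :=
  (Finset.univ.filter fun u' => 0 < c u' ∧ c u' ≤ c u).card

/-- The potential of a set of edges: the sum of the ranks of its endpoints in `U`. -/
noncomputable def rankSum [Fintype U] (c : U → ℝ) (M : Finset (V × U)) : ℕ :=
  ∑ e ∈ M, costRank c e.2

theorem rankSum_le [Fintype U] (c : U → ℝ) {M : Finset (V × U)} (hM : IsBipartiteMatching M) :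
    rankSum c M ≤ Fintype.card U ^ 2 := by
  classical
  have h1 : M.card ≤ Fintype.card U :=
    Finset.card_le_card_of_injOn Prod.snd (fun _ _ => Finset.mem_univ _)
      fun a ha b hb hab => hM a ha b hb (Or.inr hab)
  calc rankSum c M ≤ ∑ _e ∈ M, Fintype.card U :=
        Finset.sum_le_sum fun e _ => Finset.card_le_univ _
    _ = M.card * Fintype.card U := by simp
    _ ≤ Fintype.card U ^ 2 := by rw [pow_two]; exact Nat.mul_le_mul_right _ h1

/-- If no exchange lowers the cost and the cost increases, then the potential increases. -/
theorem rankSum_lt_rankSum [Fintype U] {c : U → ℝ} (hc : ∀ u, 0 ≤ c u)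
    {M M' : Finset (V × U)} (hM : IsBipartiteMatching M) (hM' : IsBipartiteMatching M')
    (hH : ∀ A A', IsExchange M M' A A' → ∑ e ∈ A, c e.2 ≤ ∑ e ∈ A', c e.2)
    (hlt : ∑ e ∈ M, c e.2 < ∑ e ∈ M', c e.2) : rankSum c M < rankSum c M' := by
  classical
  set m : ℝ := 1 + ∑ u, c u with hm
  have hm1 : ∀ u, c u ≤ m := fun u => by
    have := Finset.single_le_sum (f := c) (fun i _ => hc i) (Finset.mem_univ u)
    linarith
  have hm0 : 0 < m := by have := Finset.sum_nonneg fun u (_ : u ∈ Finset.univ) => hc u; linarith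
  have hstep : ∀ u u', c u < c u' → (costRank c u : ℝ) + 1 ≤ costRank c u' := by
    intro u u' h
    have : costRank c u < costRank c u' := by
      refine Finset.card_lt_card (Finset.ssubset_iff_of_subset ?_ |>.2 ⟨u', ?_, ?_⟩)
      · intro x hx
        simp only [Finset.mem_filter, Finset.mem_univ, true_and] at hx ⊢
        exact ⟨hx.1, hx.2.trans h.le⟩
      · simp only [Finset.mem_filter, Finset.mem_univ, true_and, le_refl, and_true]
        exact (hc u).trans_lt h
      · simp [h]
    exact_mod_cast this
  have hrank0 : ∀ u, c u = 0 → costRank c u = 0 := by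
    intro u h
    simp only [costRank, h, Finset.card_eq_zero, Finset.filter_eq_empty_iff]
    intro x _ hx
    linarith [hx.1, hx.2]
  have hrank1 : ∀ u, 0 < c u → (1 : ℝ) ≤ costRank c u := by
    intro u h
    have : 0 < costRank c u := Finset.card_pos.2 ⟨u, by simp [h]⟩
    exact_mod_cast this
  have hdiv : ∀ u, c u / m ≤ 1 := fun u => (div_le_one hm0).2 (hm1 u)
  have key := sum_potential_le (V := V) (φ := fun u => (costRank c u : ℝ) - c u / m) hc
    (by
      intro u
      rcases (hc u).eq_or_lt with h | h
      · simp [← h]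
      · linarith [hrank1 u h, hdiv u])
    (by intro u h; simp [h, hrank0 u h])
    (by
      intro u u' h
      rcases h.eq_or_lt with h | h
      · simp [costRank, h]
      · have h1 := hstep u u' h
        have h2 := hdiv u'
        have h3 : 0 ≤ c u / m := div_nonneg (hc u) hm0.le
        linarith) M.card le_rfl hM hM' hH
  simp only [Finset.sum_sub_distrib, ← Finset.sum_div] at key
  have h4 := (div_lt_div_iff_of_pos_right hm0).2 hlt
  have : (rankSum c M : ℝ) < rankSum c M' := by
    simp only [rankSum, Nat.cast_sum]
    linarith
  exact_mod_cast this

end Exchange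

/-! ## Favored matchings -/

namespace MatchingInstance

variable {V U : Type*} {I : MatchingInstance V U ℝ} {α β : ℝ} {M N S : Finset (V × U)}

/-- A matching of the instance that maximizes the agent's utility under the contract `α` and, among
those, the reward. -/
structure IsFavored (I : MatchingInstance V U ℝ) (α : ℝ) (M : Finset (V × U)) : Prop where
  subset : M ⊆ I.edges
  matching : IsBipartiteMatching M
  utility_le : ∀ N ⊆ I.edges, IsBipartiteMatching N →
    α * ∑ e ∈ N, I.reward e - I.setCost N ≤ α * ∑ e ∈ M, I.reward e - I.setCost M
  reward_le : ∀ N ⊆ I.edges, IsBipartiteMatching N →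
    α * ∑ e ∈ N, I.reward e - I.setCost N = α * ∑ e ∈ M, I.reward e - I.setCost M →
    ∑ e ∈ N, I.reward e ≤ ∑ e ∈ M, I.reward e

theorem exists_isFavored (I : MatchingInstance V U ℝ) (α : ℝ) : ∃ M, I.IsFavored α M := by
  classical
  set F := I.edges.powerset.filter IsBipartiteMatching with hF
  have hmem : ∀ N, N ∈ F ↔ N ⊆ I.edges ∧ IsBipartiteMatching N := by simp [hF]
  obtain ⟨M₀, hM₀, hmax⟩ := F.exists_max_image
    (fun N => α * ∑ e ∈ N, I.reward e - I.setCost N) ⟨∅, by simp [hmem, isBipartiteMatching_empty]⟩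
  obtain ⟨M, hM, hmax'⟩ := (F.filter fun N => α * ∑ e ∈ N, I.reward e - I.setCost N =
      α * ∑ e ∈ M₀, I.reward e - I.setCost M₀).exists_max_image
    (fun N => ∑ e ∈ N, I.reward e) ⟨M₀, by simp [hM₀]⟩
  rw [Finset.mem_filter] at hM
  refine ⟨M, ((hmem _).1 hM.1).1, ((hmem _).1 hM.1).2, fun N h1 h2 => ?_, fun N h1 h2 h3 => ?_⟩
  · rw [hM.2]; exact hmax N ((hmem _).2 ⟨h1, h2⟩)
  · exact hmax' N (Finset.mem_filter.2 ⟨(hmem _).2 ⟨h1, h2⟩, h3.trans hM.2⟩)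

theorem exists_matching_setReward (I : MatchingInstance V U ℝ) (S : Finset (V × U)) :
    ∃ M ⊆ S, IsBipartiteMatching M ∧ I.setReward S = ∑ e ∈ M, I.reward e := by
  classical
  obtain ⟨M, hM, h⟩ := Finset.exists_mem_eq_sup' (s := S.powerset.filter IsBipartiteMatching)
    ⟨∅, by simp [IsBipartiteMatching]⟩ (fun M => ∑ e ∈ M, I.reward e)
  rw [Finset.mem_filter, Finset.mem_powerset] at hM
  exact ⟨M, hM.1, hM.2, h⟩

theorem sum_reward_le_setReward (I : MatchingInstance V U ℝ) (hM : M ⊆ S)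
    (h : IsBipartiteMatching M) : ∑ e ∈ M, I.reward e ≤ I.setReward S := by
  classical
  exact Finset.le_sup' (fun M => ∑ e ∈ M, I.reward e)
    (Finset.mem_filter.2 ⟨Finset.mem_powerset.2 hM, h⟩)

theorem setReward_of_matching (hM : M ⊆ I.edges) (h : IsBipartiteMatching M) :
    I.setReward M = ∑ e ∈ M, I.reward e := by
  refine le_antisymm ?_ (I.sum_reward_le_setReward subset_rfl h)
  obtain ⟨N, hN, -, h'⟩ := I.exists_matching_setReward M
  rw [h']
  exact Finset.sum_le_sum_of_subset_of_nonneg hN fun e he _ => I.reward_nonneg e (hM he)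

theorem setCost_mono (hS : S ⊆ I.edges) (h : M ⊆ S) : I.setCost M ≤ I.setCost S :=
  Finset.sum_le_sum_of_subset_of_nonneg h fun e he _ => I.cost_nonneg e (hS he)

theorem IsFavored.agentUtility_le (hM : I.IsFavored α M) (hS : S ⊆ I.edges) :
    I.agentUtility α S ≤ α * ∑ e ∈ M, I.reward e - I.setCost M := by
  obtain ⟨N, hN, hN', h⟩ := I.exists_matching_setReward S
  have h1 := hM.utility_le N (hN.trans hS) hN'
  have h2 := setCost_mono hS hN
  rw [agentUtility, h]
  linarith

theorem IsFavored.mem_demand_iff (hM : I.IsFavored α M) : S ∈ I.demand α ↔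
    S ⊆ I.edges ∧ I.agentUtility α S = α * ∑ e ∈ M, I.reward e - I.setCost M := by
  have hMu : I.agentUtility α M = α * ∑ e ∈ M, I.reward e - I.setCost M := by
    rw [agentUtility, setReward_of_matching hM.subset hM.matching]
  simp only [demand, Finset.mem_filter, Finset.mem_powerset]
  refine and_congr_right fun hS => ⟨fun h => ?_, fun h T hT => ?_⟩
  · exact le_antisymm (hM.agentUtility_le hS) (hMu ▸ h M hM.subset)
  · rw [h]; exact hM.agentUtility_le hT

theorem IsFavored.mem_favoredDemand_iff (hM : I.IsFavored α M) : S ∈ I.favoredDemand α ↔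
    S ⊆ I.edges ∧ I.setReward S = ∑ e ∈ M, I.reward e ∧ I.setCost S = I.setCost M := by
  have hMr := setReward_of_matching hM.subset hM.matching
  have hle : ∀ T ∈ I.demand α, I.setReward T ≤ ∑ e ∈ M, I.reward e := by
    intro T hT
    rw [hM.mem_demand_iff] at hT
    obtain ⟨N, hN, hN', h⟩ := I.exists_matching_setReward T
    rw [h]
    have h1 := hM.utility_le N (hN.trans hT.1) hN'
    have h2 := setCost_mono hT.1 hN
    have h3 := hT.2
    rw [agentUtility, h] at h3
    exact hM.reward_le N (hN.trans hT.1) hN' (by linarith)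
  simp only [favoredDemand, Finset.mem_filter]
  constructor
  · rintro ⟨hS, h⟩
    have h1 : I.setReward S = ∑ e ∈ M, I.reward e := le_antisymm (hle S hS)
      (hMr ▸ h M (hM.mem_demand_iff.2 ⟨hM.subset, by rw [agentUtility, hMr]⟩))
    rw [hM.mem_demand_iff, agentUtility, h1] at hS
    exact ⟨hS.1, h1, by linarith [hS.2]⟩
  · rintro ⟨hS, h1, h2⟩
    exact ⟨hM.mem_demand_iff.2 ⟨hS, by rw [agentUtility, h1, h2]⟩, fun T hT => h1 ▸ hle T hT⟩

theorem IsFavored.setReward_bestResponse (hM : I.IsFavored α M) (τ : TieBreaking (V × U)) :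
    I.setReward (I.bestResponse τ α) = ∑ e ∈ M, I.reward e := by
  have : I.bestResponse τ α ∈ I.favoredDemand α := τ.select_mem _
    ⟨M, hM.mem_favoredDemand_iff.2 ⟨hM.subset, setReward_of_matching hM.subset hM.matching, rfl⟩⟩
  exact (hM.mem_favoredDemand_iff.1 this).2.1

theorem IsFavored.principalUtility_eq (hM : I.IsFavored α M) (τ : TieBreaking (V × U)) :
    I.principalUtility τ α = (1 - α) * ∑ e ∈ M, I.reward e := by
  rw [principalUtility, hM.setReward_bestResponse]

theorem IsFavored.bestResponse_congr (hM : I.IsFavored α M) (hN : I.IsFavored β N)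
    (h1 : ∑ e ∈ M, I.reward e = ∑ e ∈ N, I.reward e) (h2 : I.setCost M = I.setCost N)
    (τ : TieBreaking (V × U)) : I.bestResponse τ α = I.bestResponse τ β := by
  rw [bestResponse, bestResponse]
  congr 1
  ext S
  rw [hM.mem_favoredDemand_iff, hN.mem_favoredDemand_iff, h1, h2]

theorem IsFavored.reward_mono (hM : I.IsFavored α M) (hN : I.IsFavored β N) (h : α ≤ β) :
    ∑ e ∈ M, I.reward e ≤ ∑ e ∈ N, I.reward e := by
  rcases h.eq_or_lt with rfl | h
  · exact hN.reward_le M hM.subset hM.matching (le_antisymm (hN.utility_le M hM.subset hM.matching)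
      (hM.utility_le N hN.subset hN.matching))
  · have h1 := hM.utility_le N hN.subset hN.matching
    have h2 := hN.utility_le M hM.subset hM.matching
    by_contra h3
    nlinarith

theorem IsFavored.setCost_eq (hM : I.IsFavored α M) (hN : I.IsFavored β N)
    (h : ∑ e ∈ M, I.reward e = ∑ e ∈ N, I.reward e) : I.setCost M = I.setCost N := by
  have h1 := hM.utility_le N hN.subset hN.matching
  have h2 := hN.utility_le M hM.subset hM.matching
  rw [h] at h1 h2
  linarith

/-- A favored matching stays favored until some other line takes over. -/
theorem IsFavored.eventually (hM : I.IsFavored α M) : ∀ᶠ γ in 𝓝[≥] α, I.IsFavored γ M := by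
  have hN : ∀ N ∈ I.edges.powerset, IsBipartiteMatching N → ∀ᶠ γ in 𝓝[≥] α,
      γ * ∑ e ∈ N, I.reward e - I.setCost N ≤ γ * ∑ e ∈ M, I.reward e - I.setCost M ∧
      (γ * ∑ e ∈ N, I.reward e - I.setCost N = γ * ∑ e ∈ M, I.reward e - I.setCost M →
        ∑ e ∈ N, I.reward e ≤ ∑ e ∈ M, I.reward e) := by
    intro N hN hN'
    rw [Finset.mem_powerset] at hN
    rcases (hM.utility_le N hN hN').lt_or_eq with h | h
    · have hc : ∀ᶠ γ in 𝓝 α,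
          γ * ∑ e ∈ N, I.reward e - I.setCost N < γ * ∑ e ∈ M, I.reward e - I.setCost M :=
        ContinuousAt.eventually_lt (by fun_prop) (by fun_prop) h
      filter_upwards [nhdsWithin_le_nhds hc] with γ hγ
      exact ⟨hγ.le, fun h => absurd h hγ.ne⟩
    · have hr := hM.reward_le N hN hN' h
      filter_upwards [self_mem_nhdsWithin] with γ hγ
      refine ⟨?_, fun _ => hr⟩
      have : α ≤ γ := hγ
      nlinarith
  have hall : ∀ᶠ γ in 𝓝[≥] α, ∀ N ∈ I.edges.powerset, IsBipartiteMatching N →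
      γ * ∑ e ∈ N, I.reward e - I.setCost N ≤ γ * ∑ e ∈ M, I.reward e - I.setCost M ∧
      (γ * ∑ e ∈ N, I.reward e - I.setCost N = γ * ∑ e ∈ M, I.reward e - I.setCost M →
        ∑ e ∈ N, I.reward e ≤ ∑ e ∈ M, I.reward e) := by
    rw [Filter.eventually_all_finset]
    intro N hN1
    by_cases hN' : IsBipartiteMatching N
    · simpa [hN'] using hN N hN1 hN'
    · simp [hN']
  filter_upwards [hall] with γ hγ
  exact ⟨hM.subset, hM.matching, fun N h1 h2 => (hγ N (Finset.mem_powerset.2 h1) h2).1,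
    fun N h1 h2 => (hγ N (Finset.mem_powerset.2 h1) h2).2⟩

theorem IsFavored.sum_le_sum_of_isExchange (hM : I.IsFavored α M) (hN : I.IsFavored β N)
    (hα : 0 ≤ α) (h : α < β) {A A' : Finset (V × U)} (hA : IsExchange M N A A') :
    ∑ e ∈ A, I.cost e ≤ ∑ e ∈ A', I.cost e := by
  classical
  have h1 := hM.utility_le (M \ A ∪ A') (Finset.union_subset
    (Finset.sdiff_subset.trans hM.subset) (hA.subset_right.trans hN.subset)) hA.matching_left
  have h2 := hN.utility_le (N \ A' ∪ A) (Finset.union_subset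
    (Finset.sdiff_subset.trans hN.subset) (hA.subset_left.trans hM.subset)) hA.matching_right
  simp only [setCost] at h1 h2
  rw [hA.sum_left, hA.sum_left] at h1
  rw [hA.sum_right, hA.sum_right] at h2
  have h3 : 0 ≤ ∑ e ∈ A', I.reward e - ∑ e ∈ A, I.reward e := by
    by_contra h3
    nlinarith
  nlinarith

theorem OneSidedCosts.exists_nonneg (h : I.OneSidedCosts) :
    ∃ c : U → ℝ, (∀ u, 0 ≤ c u) ∧ ∀ e ∈ I.edges, I.cost e = c e.2 := by
  obtain ⟨c, hc⟩ := h
  refine ⟨fun u => max (c u) 0, fun u => le_max_right _ _, fun e he => ?_⟩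
  have := I.cost_nonneg e he
  rw [hc e he] at this ⊢
  exact (max_eq_left this).symm

theorem IsFavored.rankSum_lt [Fintype U] {c : U → ℝ} (hc : ∀ u, 0 ≤ c u)
    (hcost : ∀ e ∈ I.edges, I.cost e = c e.2) (hM : I.IsFavored α M) (hN : I.IsFavored β N)
    (hα : 0 < α) (h : ∑ e ∈ M, I.reward e < ∑ e ∈ N, I.reward e) :
    rankSum c M < rankSum c N := by
  have hαβ : α < β := by
    by_contra h'
    exact absurd (hN.reward_mono hM (not_lt.1 h')) (not_le.2 h)
  have hcM : ∀ S ⊆ I.edges, ∑ e ∈ S, c e.2 = ∑ e ∈ S, I.cost e := fun S hS =>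
    Finset.sum_congr rfl fun e he => (hcost e (hS he)).symm
  refine rankSum_lt_rankSum hc hM.matching hN.matching (fun A A' hA => ?_) ?_
  · rw [hcM A (hA.subset_left.trans hM.subset), hcM A' (hA.subset_right.trans hN.subset)]
    exact hM.sum_le_sum_of_isExchange hN hα.le hαβ hA
  · rw [hcM _ hM.subset, hcM _ hN.subset]
    have := hM.utility_le N hN.subset hN.matching
    simp only [setCost] at this
    nlinarith

/-- With one-sided costs, the favored matchings have only quadratically many rewards. -/
theorem OneSidedCosts.exists_rewards [Fintype U] (h : I.OneSidedCosts) :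
    ∃ R : Finset ℝ, R.card ≤ Fintype.card U ^ 2 + 2 ∧
      ∀ α, 0 ≤ α → ∀ M, I.IsFavored α M → ∑ e ∈ M, I.reward e ∈ R := by
  classical
  obtain ⟨c, hc, hcost⟩ := h.exists_nonneg
  choose M hM using I.exists_isFavored
  set r : ℝ → ℝ := fun α => ∑ e ∈ M α, I.reward e with hr
  set F : Finset ℕ := (Finset.range (Fintype.card U ^ 2 + 1)).filter
    fun k => ∃ α > 0, rankSum c (M α) = k with hF
  have hsel : ∀ k, ∃ x : ℝ, ∀ α > 0, rankSum c (M α) = k → r α = x := by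
    intro k
    by_cases hk : ∃ α > 0, rankSum c (M α) = k
    · obtain ⟨α, hα, hk⟩ := hk
      refine ⟨r α, fun β hβ hk' => ?_⟩
      rcases lt_trichotomy (r β) (r α) with h | h | h
      · have := (hM β).rankSum_lt hc hcost (hM α) hβ h; omega
      · exact h
      · have := (hM α).rankSum_lt hc hcost (hM β) hα h; omega
    · exact ⟨0, fun α hα h => absurd ⟨α, hα, h⟩ hk⟩
  choose x hx using hsel
  refine ⟨insert (r 0) ((Finset.range (Fintype.card U ^ 2 + 1)).image x), ?_, ?_⟩
  · refine (Finset.card_insert_le _ _).trans ?_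
    have := Finset.card_image_le (s := Finset.range (Fintype.card U ^ 2 + 1)) (f := x)
    rw [Finset.card_range] at this
    omega
  · intro α hα N hN
    have hNr : ∑ e ∈ N, I.reward e = r α :=
      le_antisymm (hN.reward_mono (hM α) le_rfl) ((hM α).reward_mono hN le_rfl)
    rw [hNr]
    rcases hα.eq_or_lt with rfl | hα
    · exact Finset.mem_insert_self _ _
    · refine Finset.mem_insert_of_mem (Finset.mem_image.2 ⟨rankSum c (M α), ?_, ?_⟩)
      · have := rankSum_le c (hM α).matching
        rw [Finset.mem_range]; omega
      · exact (hx _ α hα rfl).symm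

/-- With one-sided costs, there are only quadratically many critical values. -/
theorem OneSidedCosts.criticalValues_finite [Fintype U] (h : I.OneSidedCosts)
    (τ : TieBreaking (V × U)) : (I.criticalValues τ).Finite ∧
      (I.criticalValues τ).ncard ≤ Fintype.card U ^ 2 + 2 := by
  obtain ⟨R, hcard, hR⟩ := h.exists_rewards
  choose M hM using I.exists_isFavored
  set r : ℝ → ℝ := fun α => ∑ e ∈ M α, I.reward e with hr
  have hlt : ∀ α ∈ I.criticalValues τ, ∀ β ∈ I.criticalValues τ, α < β → r α ≠ r β := by
    intro α hα β hβ hαβ heq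
    rcases hβ.2 with h0 | h0
    · have := hα.1.1; linarith
    · apply h0
      have h1 : ∀ᶠ γ in 𝓝[≥] β, I.bestResponse τ γ = I.bestResponse τ β := by
        filter_upwards [(hM β).eventually] with γ hγ
        exact hγ.bestResponse_congr (hM β) rfl rfl τ
      have h2 : ∀ᶠ γ in 𝓝[≤] β, I.bestResponse τ γ = I.bestResponse τ β := by
        filter_upwards [nhdsWithin_le_nhds (lt_mem_nhds hαβ), self_mem_nhdsWithin] with γ hγ hγ'
        have e1 : r γ = r β := le_antisymm ((hM γ).reward_mono (hM β) hγ')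
          (heq ▸ (hM α).reward_mono (hM γ) (le_of_lt hγ))
        exact (hM γ).bestResponse_congr (hM β) e1 ((hM γ).setCost_eq (hM β) e1) τ
      have h3 : ∀ᶠ γ in 𝓝 β, I.bestResponse τ γ = I.bestResponse τ β := by
        rw [← nhdsLE_sup_nhdsGE]
        exact Filter.eventually_sup.2 ⟨h2, h1⟩
      exact nhdsWithin_le_nhds h3
  have hinj : Set.InjOn r (I.criticalValues τ) := by
    intro α hα β hβ h
    rcases lt_trichotomy α β with h' | h' | h'
    · exact absurd h (hlt α hα β hβ h')
    · exact h'
    · exact absurd h.symm (hlt β hβ α hα h')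
  have hmaps : Set.MapsTo r (I.criticalValues τ) R := fun α hα => hR α hα.1.1 _ (hM α)
  have hfin : (I.criticalValues τ).Finite := Set.Finite.of_injOn hmaps hinj R.finite_toSet
  refine ⟨hfin, ?_⟩
  have := Set.ncard_le_ncard_of_injOn r hmaps hinj R.finite_toSet
  rw [Set.ncard_coe_finset] at this
  exact this.trans hcard

end MatchingInstance

/-! ## Loop programs

Programs whose only repetitions are bounded loops: they have a total semantics, and their running
time is polynomial for syntactic reasons. -/

namespace RAM

theorem bitLength_pos (z : ℤ) : 1 ≤ bitLength z := Nat.le_add_left _ _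

theorem bitLength_le_iff {z : ℤ} {n : ℕ} : bitLength z ≤ n + 1 ↔ z.natAbs < 2 ^ n := by
  rw [bitLength, Nat.add_le_add_iff_right, Nat.size_le]

theorem natAbs_lt_two_pow (z : ℤ) : z.natAbs < 2 ^ (bitLength z - 1) := by
  rw [bitLength, Nat.add_sub_cancel]; exact Nat.lt_size_self _

theorem bitLength_mono {y z : ℤ} (h : y.natAbs ≤ z.natAbs) : bitLength y ≤ bitLength z :=
  Nat.add_le_add_right (Nat.size_le_size h) 1

theorem bitLength_of_natAbs_le_add {x y z : ℤ} (h : z.natAbs ≤ x.natAbs + y.natAbs) :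
    bitLength z ≤ max (bitLength x) (bitLength y) + 1 := by
  have hx := natAbs_lt_two_pow x
  have hy := natAbs_lt_two_pow y
  set m := max (bitLength x) (bitLength y) with hm
  have h1 : 2 ^ (bitLength x - 1) ≤ 2 ^ (m - 1) := Nat.pow_le_pow_right (by norm_num) (by omega)
  have h2 : 2 ^ (bitLength y - 1) ≤ 2 ^ (m - 1) := Nat.pow_le_pow_right (by norm_num) (by omega)
  have h3 : 1 ≤ m := (bitLength_pos x).trans (le_max_left _ _)
  obtain ⟨k, hk⟩ := Nat.exists_eq_add_of_le' h3
  rw [hk] at h1 h2 ⊢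
  rw [bitLength_le_iff, pow_succ]
  simp only [Nat.add_sub_cancel] at h1 h2
  omega

theorem bitLength_add_le (x y : ℤ) : bitLength (x + y) ≤ max (bitLength x) (bitLength y) + 1 :=
  bitLength_of_natAbs_le_add (Int.natAbs_add_le x y)

theorem bitLength_sub_le (x y : ℤ) : bitLength (x - y) ≤ max (bitLength x) (bitLength y) + 1 :=
  bitLength_of_natAbs_le_add (Int.natAbs_sub_le x y)

theorem bitLength_mul_le (x y : ℤ) : bitLength (x * y) ≤ bitLength x + bitLength y := by
  have hx := natAbs_lt_two_pow x
  have hy := natAbs_lt_two_pow y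
  have h1 := bitLength_pos x
  have h2 := bitLength_pos y
  have : bitLength (x * y) ≤ (bitLength x - 1 + (bitLength y - 1)) + 1 := by
    rw [bitLength_le_iff, Int.natAbs_mul, pow_add]
    exact Nat.mul_lt_mul'' hx hy
  omega

theorem bitLength_div_le (x y : ℤ) : bitLength (x / y) ≤ bitLength x :=
  bitLength_mono (Int.natAbs_ediv_le_natAbs x y)

namespace Expr

/-- The length of an expression; constants count with their binary length. -/
def size : Expr → ℕ
  | const z => bitLength z
  | get _ i => 1 + i.size
  | add e₁ e₂ => 1 + e₁.size + e₂.size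
  | sub e₁ e₂ => 1 + e₁.size + e₂.size
  | mul e₁ e₂ => 1 + e₁.size + e₂.size
  | div e₁ e₂ => 1 + e₁.size + e₂.size

theorem size_pos (e : Expr) : 1 ≤ e.size := by
  cases e <;> simp only [size] <;> first | exact bitLength_pos _ | omega

theorem bitLength_val_le {σ : Memory} {B : ℕ} (hB : 1 ≤ B) (h : ∀ a i, bitLength (σ a i) ≤ B)
    (e : Expr) : bitLength (e.val σ) ≤ e.size * B := by
  induction e with
  | const z => exact Nat.le_mul_of_pos_right _ hB
  | get a i _ => exact (h _ _).trans (Nat.le_mul_of_pos_left _ (by simp [size]))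
  | add e₁ e₂ ih₁ ih₂ =>
    have := bitLength_add_le (e₁.val σ) (e₂.val σ)
    simp only [val, size, add_mul, one_mul]; omega
  | sub e₁ e₂ ih₁ ih₂ =>
    have := bitLength_sub_le (e₁.val σ) (e₂.val σ)
    simp only [val, size, add_mul, one_mul]; omega
  | mul e₁ e₂ ih₁ ih₂ =>
    have := bitLength_mul_le (e₁.val σ) (e₂.val σ)
    simp only [val, size, add_mul, one_mul]; omega
  | div e₁ e₂ ih₁ ih₂ =>
    have := bitLength_div_le (e₁.val σ) (e₂.val σ)
    simp only [val, size, add_mul, one_mul]; omega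

theorem time_le {σ : Memory} {B : ℕ} (hB : 1 ≤ B) (h : ∀ a i, bitLength (σ a i) ≤ B)
    (e : Expr) : e.time σ ≤ e.size ^ 2 * B := by
  have bin : ∀ s₁ s₂ t₁ t₂ b : ℕ, t₁ ≤ s₁ ^ 2 * B → t₂ ≤ s₂ ^ 2 * B → b ≤ (1 + s₁ + s₂) * B →
      t₁ + t₂ + b ≤ (1 + s₁ + s₂) ^ 2 * B := by
    intro s₁ s₂ t₁ t₂ b h₁ h₂ h₃
    nlinarith [Nat.zero_le (s₁ * B), Nat.zero_le (s₂ * B), Nat.zero_le (s₁ * s₂ * B)]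
  induction e with
  | const z =>
    simp only [time, size]
    have := bitLength_pos z
    nlinarith [Nat.mul_le_mul (Nat.mul_le_mul this le_rfl : 1 * bitLength z ≤ _) hB]
  | get a i ih =>
    have := h a (i.val σ)
    simp only [time, size]
    nlinarith [Nat.zero_le (i.size * B)]
  | add e₁ e₂ ih₁ ih₂ => exact bin _ _ _ _ _ ih₁ ih₂ (bitLength_val_le hB h (add e₁ e₂))
  | sub e₁ e₂ ih₁ ih₂ => exact bin _ _ _ _ _ ih₁ ih₂ (bitLength_val_le hB h (sub e₁ e₂))
  | mul e₁ e₂ ih₁ ih₂ => exact bin _ _ _ _ _ ih₁ ih₂ (bitLength_val_le hB h (mul e₁ e₂))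
  | div e₁ e₂ ih₁ ih₂ => exact bin _ _ _ _ _ ih₁ ih₂ (bitLength_val_le hB h (div e₁ e₂))

/-- The expression depends only on arrays of tier `0`. -/
def isInput (tier : ℕ → ℕ) : Expr → Bool
  | const _ => true
  | get a i => decide (tier a = 0) && i.isInput tier
  | add e₁ e₂ => e₁.isInput tier && e₂.isInput tier
  | sub e₁ e₂ => e₁.isInput tier && e₂.isInput tier
  | mul e₁ e₂ => e₁.isInput tier && e₂.isInput tier
  | div e₁ e₂ => e₁.isInput tier && e₂.isInput tier

/-- The value is computed from entries of arrays of tier below `t`. -/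
def isBelow (tier : ℕ → ℕ) (t : ℕ) : Expr → Bool
  | const _ => true
  | get a _ => decide (tier a < t)
  | add e₁ e₂ => e₁.isBelow tier t && e₂.isBelow tier t
  | sub e₁ e₂ => e₁.isBelow tier t && e₂.isBelow tier t
  | mul e₁ e₂ => e₁.isBelow tier t && e₂.isBelow tier t
  | div e₁ _ => e₁.isBelow tier t

/-- The value is additive in the entries of arrays of tier `t`, with coefficients computed from
entries of arrays of tier below `t`. -/
def isAdditive (tier : ℕ → ℕ) (t : ℕ) : Expr → Bool
  | const _ => true
  | get a _ => decide (tier a ≤ t)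
  | add e₁ e₂ => e₁.isAdditive tier t && e₂.isAdditive tier t
  | sub e₁ e₂ => e₁.isAdditive tier t && e₂.isAdditive tier t
  | mul e₁ e₂ => e₁.isBelow tier t && e₂.isAdditive tier t
  | div e₁ _ => e₁.isAdditive tier t

instance : Add Expr := ⟨add⟩
instance : Sub Expr := ⟨sub⟩
instance : Mul Expr := ⟨mul⟩
instance : Div Expr := ⟨div⟩
instance (n : ℕ) : OfNat Expr n := ⟨const n⟩

variable {tier : ℕ → ℕ} {σ τ : Memory}

@[simp] theorem val_add (e f : Expr) : (e + f).val σ = e.val σ + f.val σ := rfl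

@[simp] theorem val_sub (e f : Expr) : (e - f).val σ = e.val σ - f.val σ := rfl

@[simp] theorem val_mul (e f : Expr) : (e * f).val σ = e.val σ * f.val σ := rfl

@[simp] theorem val_div (e f : Expr) : (e / f).val σ = e.val σ / f.val σ := rfl

@[simp] theorem val_zero : (0 : Expr).val σ = 0 := rfl

@[simp] theorem val_one : (1 : Expr).val σ = 1 := rfl

@[simp] theorem val_const (z : ℤ) : (const z).val σ = z := rfl

@[simp] theorem val_get (a : ℕ) (i : Expr) : (get a i).val σ = σ a (i.val σ) := rfl

theorem val_congr_of_isInput (h : ∀ a, tier a = 0 → σ a = τ a) (e : Expr)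
    (he : e.isInput tier = true) : e.val σ = e.val τ := by
  induction e with
  | const z => rfl
  | get a i ih =>
    simp only [isInput, Bool.and_eq_true, decide_eq_true_eq] at he
    simp only [val, h a he.1, ih he.2]
  | add e₁ e₂ ih₁ ih₂ | sub e₁ e₂ ih₁ ih₂ | mul e₁ e₂ ih₁ ih₂ | div e₁ e₂ ih₁ ih₂ =>
    simp only [isInput, Bool.and_eq_true] at he
    simp only [val, ih₁ he.1, ih₂ he.2]

theorem bitLength_val_le_of_isBelow {t b : ℕ} (hb : 1 ≤ b)
    (h : ∀ a, tier a < t → ∀ i, bitLength (σ a i) ≤ b) (e : Expr)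
    (he : e.isBelow tier t = true) : bitLength (e.val σ) ≤ e.size * b := by
  induction e with
  | const z => exact Nat.le_mul_of_pos_right _ hb
  | get a i _ =>
    simp only [isBelow, decide_eq_true_eq] at he
    exact (h _ he _).trans (Nat.le_mul_of_pos_left _ (by simp [size]))
  | add e₁ e₂ ih₁ ih₂ =>
    simp only [isBelow, Bool.and_eq_true] at he
    have := bitLength_add_le (e₁.val σ) (e₂.val σ)
    have := ih₁ he.1
    have := ih₂ he.2
    simp only [val, size, add_mul, one_mul]; omega
  | sub e₁ e₂ ih₁ ih₂ =>
    simp only [isBelow, Bool.and_eq_true] at he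
    have := bitLength_sub_le (e₁.val σ) (e₂.val σ)
    have := ih₁ he.1
    have := ih₂ he.2
    simp only [val, size, add_mul, one_mul]; omega
  | mul e₁ e₂ ih₁ ih₂ =>
    simp only [isBelow, Bool.and_eq_true] at he
    have := bitLength_mul_le (e₁.val σ) (e₂.val σ)
    have := ih₁ he.1
    have := ih₂ he.2
    simp only [val, size, add_mul, one_mul]; omega
  | div e₁ e₂ ih₁ ih₂ =>
    have := bitLength_div_le (e₁.val σ) (e₂.val σ)
    have := ih₁ he
    simp only [val, size, add_mul, one_mul]; omega

theorem bitLength_val_le_of_isAdditive {t b m : ℕ} (hb : 1 ≤ b)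
    (hlow : ∀ a, tier a < t → ∀ i, bitLength (σ a i) ≤ b)
    (h : ∀ a, tier a ≤ t → ∀ i, bitLength (σ a i) ≤ m) (e : Expr)
    (he : e.isAdditive tier t = true) : bitLength (e.val σ) ≤ m + e.size * b := by
  induction e with
  | const z => exact (Nat.le_mul_of_pos_right _ hb).trans (Nat.le_add_left _ _)
  | get a i _ =>
    simp only [isAdditive, decide_eq_true_eq] at he
    exact (h _ he _).trans (Nat.le_add_right _ _)
  | add e₁ e₂ ih₁ ih₂ =>
    simp only [isAdditive, Bool.and_eq_true] at he
    have := bitLength_add_le (e₁.val σ) (e₂.val σ)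
    have := ih₁ he.1
    have := ih₂ he.2
    simp only [val, size, add_mul, one_mul]; omega
  | sub e₁ e₂ ih₁ ih₂ =>
    simp only [isAdditive, Bool.and_eq_true] at he
    have := bitLength_sub_le (e₁.val σ) (e₂.val σ)
    have := ih₁ he.1
    have := ih₂ he.2
    simp only [val, size, add_mul, one_mul]; omega
  | mul e₁ e₂ ih₁ ih₂ =>
    simp only [isAdditive, Bool.and_eq_true] at he
    have := bitLength_mul_le (e₁.val σ) (e₂.val σ)
    have := bitLength_val_le_of_isBelow hb hlow e₁ he.1
    have := ih₂ he.2
    simp only [val, size, add_mul, one_mul]; omega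
  | div e₁ e₂ ih₁ ih₂ =>
    have := bitLength_div_le (e₁.val σ) (e₂.val σ)
    have := ih₁ he
    simp only [val, size, add_mul, one_mul]; omega

end Expr

namespace Memory

@[simp] theorem write_of_ne (σ : Memory) {a b : ℕ} (h : b ≠ a) (i z : ℤ) :
    σ.write a i z b = σ b :=
  Function.update_of_ne h _ _

@[simp] theorem write_same (σ : Memory) (a : ℕ) (i z : ℤ) :
    σ.write a i z a = Function.update (σ a) i z := by
  simp [write]

theorem write_apply_self (σ : Memory) (a : ℕ) (i z : ℤ) : σ.write a i z a i = z := by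
  simp

end Memory

/-- The value of the scalar variable at index `0` of the array `a`. -/
abbrev var (a : ℕ) : Expr := .get a 0

/-- Loop programs. The loop with counter array `a`, bound `b` and body `P` runs `P` with the values
`0, 1, …` at index `0` of the array `a`, as often as the value of `b` at the start says. -/
inductive LoopProg where
  | nop
  | put (a : ℕ) (i e : Expr)
  | seq (P Q : LoopProg)
  | ite (e : Expr) (P Q : LoopProg)
  | loop (a : ℕ) (b : Expr) (P : LoopProg)

namespace LoopProg

/-- The assignment of the value of `e` to the scalar variable `a`. -/
abbrev set (a : ℕ) (e : Expr) : LoopProg := put a 0 e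

infixr:60 " ;; " => seq

/-- The memory after the program. -/
def sem : LoopProg → Memory → Memory
  | nop, σ => σ
  | put a i e, σ => σ.write a (i.val σ) (e.val σ)
  | seq P Q, σ => Q.sem (P.sem σ)
  | ite e P Q, σ => if 0 < e.val σ then P.sem σ else Q.sem σ
  | loop a b P, σ =>
      (fun τ => (P.sem τ).write a 0 (P.sem τ a 0 + 1))^[(b.val σ).toNat] (σ.write a 0 0)

def compile : LoopProg → Prog
  | nop => .nop
  | put a i e => .put a i e
  | seq P Q => .seq P.compile Q.compile
  | ite e P Q => .ifPos e P.compile Q.compile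
  | loop a b P => .seq (.put a (.const 0) (.const 0))
      (.whilePos (.sub b (.get a (.const 0)))
        (.seq P.compile (.put a (.const 0) (.add (.get a (.const 0)) (.const 1)))))

/-- Whether the program writes to the array `c`. -/
def writes (c : ℕ) : LoopProg → Bool
  | nop => false
  | put a _ _ => decide (a = c)
  | seq P Q => P.writes c || Q.writes c
  | ite _ P Q => P.writes c || Q.writes c
  | loop a _ P => decide (a = c) || P.writes c

/-- The program respects the tiers of the arrays: tier `0` is never written, multiplication uses
lower tiers, loop bounds come from tier `0`, and bodies of loops do not write to the counter. -/
def isTiered (tier : ℕ → ℕ) : LoopProg → Bool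
  | nop => true
  | put a _ e => decide (1 ≤ tier a) && e.isAdditive tier (tier a)
  | seq P Q => P.isTiered tier && Q.isTiered tier
  | ite _ P Q => P.isTiered tier && Q.isTiered tier
  | loop a b P => decide (1 ≤ tier a) && b.isInput tier && !P.writes a && P.isTiered tier

/-- All loops of the program, run on the memory `σ`, have at most `X` rounds. -/
def BoundsLE (σ : Memory) (X : ℕ) : LoopProg → Prop
  | nop => True
  | put _ _ _ => True
  | seq P Q => P.BoundsLE σ X ∧ Q.BoundsLE σ X
  | ite _ P Q => P.BoundsLE σ X ∧ Q.BoundsLE σ X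
  | loop _ b P => b.val σ ≤ X ∧ P.BoundsLE σ X

/-- A bound for the number of steps, in terms of a bound for the number of rounds of each loop. -/
noncomputable def steps : LoopProg → Polynomial ℕ
  | nop => 1
  | put _ _ _ => 1
  | seq P Q => P.steps + Q.steps
  | ite _ P Q => 1 + P.steps + Q.steps
  | loop _ _ P => Polynomial.X * (P.steps + 2) + 2

def size : LoopProg → ℕ
  | nop => 1
  | put _ i e => i.size + e.size
  | seq P Q => P.size + Q.size
  | ite e P Q => e.size + P.size + Q.size
  | loop _ b P => b.size + P.size + 5

variable {tier : ℕ → ℕ} {σ τ : Memory}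

@[simp] theorem sem_nop : nop.sem σ = σ := rfl

@[simp] theorem sem_put (a : ℕ) (i e : Expr) :
    (put a i e).sem σ = σ.write a (i.val σ) (e.val σ) := rfl

@[simp] theorem sem_seq (P Q : LoopProg) : (P ;; Q).sem σ = Q.sem (P.sem σ) := rfl

theorem sem_ite (e : Expr) (P Q : LoopProg) (a : ℕ) :
    (ite e P Q).sem σ a = if 0 < e.val σ then P.sem σ a else Q.sem σ a := by
  rw [sem]; split_ifs <;> rfl

@[simp] theorem sem_ite_apply (e : Expr) (P Q : LoopProg) (a : ℕ) (i : ℤ) :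
    (ite e P Q).sem σ a i = if 0 < e.val σ then P.sem σ a i else Q.sem σ a i := by
  rw [sem]; split_ifs <;> rfl

theorem sem_ite_of_pos {e : Expr} (P Q : LoopProg) (h : 0 < e.val σ) :
    (ite e P Q).sem σ = P.sem σ := if_pos h

theorem sem_ite_of_not_pos {e : Expr} (P Q : LoopProg) (h : ¬ 0 < e.val σ) :
    (ite e P Q).sem σ = Q.sem σ := if_neg h

theorem sem_frame {c : ℕ} (P : LoopProg) (h : P.writes c = false) (σ : Memory) :
    P.sem σ c = σ c := by
  induction P generalizing σ with
  | nop => rfl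
  | put a i e =>
    simp only [writes, decide_eq_false_iff_not] at h
    exact Memory.write_of_ne _ (Ne.symm h) _ _
  | seq P Q ihP ihQ =>
    simp only [writes, Bool.or_eq_false_iff] at h
    rw [sem, ihQ h.2, ihP h.1]
  | ite e P Q ihP ihQ =>
    simp only [writes, Bool.or_eq_false_iff] at h
    rw [sem]
    split_ifs
    exacts [ihP h.1 σ, ihQ h.2 σ]
  | loop a b P ih =>
    simp only [writes, Bool.or_eq_false_iff, decide_eq_false_iff_not] at h
    have key : ∀ n τ, ((fun τ => (P.sem τ).write a 0 (P.sem τ a 0 + 1))^[n] τ) c = τ c := by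
      intro n
      induction n with
      | zero => intro τ; rfl
      | succ n ihn =>
        intro τ
        rw [Function.iterate_succ_apply, ihn, Memory.write_of_ne _ (Ne.symm h.1), ih h.2]
    rw [sem, key, Memory.write_of_ne _ (Ne.symm h.1)]

theorem writes_eq_false_of_tier (P : LoopProg) (h : P.isTiered tier = true) {c : ℕ}
    (hc : tier c = 0) : P.writes c = false := by
  induction P with
  | nop => rfl
  | put a i e =>
    simp only [isTiered, Bool.and_eq_true, decide_eq_true_eq] at h
    simp only [writes, decide_eq_false_iff_not]
    rintro rfl
    omega
  | seq P Q ihP ihQ =>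
    simp only [isTiered, Bool.and_eq_true] at h
    simp [writes, ihP h.1, ihQ h.2]
  | ite e P Q ihP ihQ =>
    simp only [isTiered, Bool.and_eq_true] at h
    simp [writes, ihP h.1, ihQ h.2]
  | loop a b P ih =>
    simp only [isTiered, Bool.and_eq_true, decide_eq_true_eq] at h
    simp only [writes, ih h.2, Bool.or_false, decide_eq_false_iff_not]
    rintro rfl
    omega

/-- The invariant rule for loops; what the loop does not write stays as it was. -/
theorem sem_loop {a : ℕ} {b : Expr} {P : LoopProg} {σ : Memory} (hP : P.writes a = false)
    (Inv : ℕ → Memory → Prop) {n : ℕ} (hn : b.val σ = n) (h0 : Inv 0 (σ.write a 0 0))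
    (hs : ∀ k < n, ∀ τ : Memory, τ a 0 = k → (∀ c, (loop a b P).writes c = false → τ c = σ c) →
      Inv k τ → Inv (k + 1) ((P.sem τ).write a 0 (k + 1))) :
    Inv n ((loop a b P).sem σ) := by
  rw [sem, hn, Int.toNat_natCast]
  set f := fun τ => (P.sem τ).write a 0 (P.sem τ a 0 + 1) with hf
  have key : ∀ k ≤ n, Inv k (f^[k] (σ.write a 0 0)) ∧ (f^[k] (σ.write a 0 0)) a 0 = k ∧
      ∀ c, (loop a b P).writes c = false → f^[k] (σ.write a 0 0) c = σ c := by
    intro k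
    induction k with
    | zero =>
      refine fun _ => ⟨h0, Memory.write_apply_self _ _ _ _, fun c hc => ?_⟩
      simp only [writes, Bool.or_eq_false_iff, decide_eq_false_iff_not] at hc
      exact Memory.write_of_ne _ (Ne.symm hc.1) _ _
    | succ k ih =>
      intro hk
      obtain ⟨h1, h2, h3⟩ := ih (by omega)
      rw [Function.iterate_succ_apply']
      generalize f^[k] (σ.write a 0 0) = τ at *
      have h4 : f τ = (P.sem τ).write a 0 ((k : ℤ) + 1) := by
        simp only [hf, P.sem_frame hP, h2]
      rw [h4]
      refine ⟨hs k (by omega) τ h2 h3 h1, ?_, fun c hc => ?_⟩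
      · rw [Memory.write_apply_self]; push_cast; ring
      · rw [← h3 c hc]
        simp only [writes, Bool.or_eq_false_iff, decide_eq_false_iff_not] at hc
        rw [Memory.write_of_ne _ (Ne.symm hc.1), P.sem_frame hc.2]
  exact (key n le_rfl).1

/-- A loop whose body sets one entry of the array `A` in each round. -/
theorem sem_loop_map {a A n : ℕ} {b : Expr} {P : LoopProg} {σ : Memory} (hA : A ≠ a)
    (hP : P.writes a = false) (hn : b.val σ = n) (g : ℤ → ℤ)
    (hs : ∀ k : ℕ, k < n → ∀ τ : Memory, τ a 0 = k →
      (∀ c, (loop a b P).writes c = false → τ c = σ c) → τ A k = σ A k →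
      P.sem τ A = Function.update (τ A) k (g k)) (j : ℤ) :
    (loop a b P).sem σ A j = if 0 ≤ j ∧ j < n then g j else σ A j := by
  refine sem_loop (σ := σ) hP
    (fun k τ => ∀ j : ℤ, τ A j = if 0 ≤ j ∧ j < k then g j else σ A j) hn ?_ ?_ j
  · intro j
    rw [Memory.write_of_ne _ hA, if_neg (by omega)]
  · intro k hk τ hτ hfr hI j
    rw [Memory.write_of_ne _ hA, hs k hk τ hτ hfr (by rw [hI, if_neg (by omega)])]
    by_cases hj : j = k
    · subst hj
      rw [Function.update_self, if_pos (by push_cast; omega)]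
    · rw [Function.update_of_ne hj, hI]
      push_cast
      congr 1
      simp only [eq_iff_iff]
      omega

/-- The memory has room for `s` more steps: each step may lengthen the entries of an array by `κ`
times the bound for the next lower tier. -/
def Room (tier : ℕ → ℕ) (κ : ℕ) (B : ℕ → ℕ) (σ : Memory) (s : ℕ) : Prop :=
  ∀ a i, bitLength (σ a i) + (if tier a = 0 then 0 else s * (κ * B (tier a - 1))) ≤ B (tier a)

section Time

variable {κ S Z : ℕ} {B : ℕ → ℕ}

theorem Room.mono {s s' : ℕ} (h : Room tier κ B σ s') (hs : s ≤ s') : Room tier κ B σ s := by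
  intro a i
  refine le_trans (Nat.add_le_add_left ?_ _) (h a i)
  split_ifs
  exacts [le_rfl, Nat.mul_le_mul_right _ hs]

theorem Room.bitLength_le {s : ℕ} (h : Room tier κ B σ s) (a : ℕ) (i : ℤ) :
    bitLength (σ a i) ≤ B (tier a) := (Nat.le_add_right _ _).trans (h a i)

theorem Room.write {s : ℕ} (hB1 : ∀ t, 1 ≤ B t) (hmono : Monotone B)
    (hB : ∀ t, (1 + S * κ) * B t ≤ B (t + 1)) (hs : s + 1 ≤ S) {a : ℕ} {e : Expr}
    (ha : 1 ≤ tier a) (he : e.isAdditive tier (tier a) = true) (hsize : e.size ≤ κ)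
    (h : Room tier κ B σ (s + 1)) (i : ℤ) : Room tier κ B (σ.write a i (e.val σ)) s := by
  intro c j
  by_cases hcj : c = a ∧ j = i
  · obtain ⟨rfl, rfl⟩ := hcj
    rw [Memory.write_apply_self, if_neg (by omega)]
    obtain ⟨t, ht⟩ := Nat.exists_eq_add_of_le' ha
    rw [ht] at he ⊢
    have hk : (s + 1) * (κ * B t) + B t ≤ B (t + 1) := by
      refine le_trans ?_ (hB t)
      calc (s + 1) * (κ * B t) + B t ≤ S * (κ * B t) + B t :=
            Nat.add_le_add_right (Nat.mul_le_mul_right _ hs) _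
        _ = (1 + S * κ) * B t := by ring
    have := Expr.bitLength_val_le_of_isAdditive (σ := σ) (t := t + 1) (b := B t)
      (m := B (t + 1) - (s + 1) * (κ * B t)) (hB1 t)
      (fun a ha i => (h.bitLength_le a i).trans (hmono (by omega)))
      (fun a ha i => by
        by_cases hat : tier a = t + 1
        · have := h a i
          rw [if_neg (by omega), hat] at this
          simp only [Nat.add_sub_cancel] at this
          omega
        · have h1 := h.bitLength_le a i
          have h2 := hmono (show tier a ≤ t by omega)
          omega) e he
    have h4 : e.size * B t ≤ κ * B t := Nat.mul_le_mul_right _ hsize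
    simp only [Nat.add_sub_cancel]
    have h5 : (s + 1) * (κ * B t) = s * (κ * B t) + κ * B t := by ring
    omega
  · have : σ.write a i (e.val σ) c j = σ c j := by
      by_cases hc : c = a
      · subst hc
        rw [Memory.write_same, Function.update_of_ne (by tauto)]
      · rw [Memory.write_of_ne _ hc]
    rw [this]
    exact h.mono (Nat.le_succ s) c j

theorem size_pos (P : LoopProg) : 1 ≤ P.size := by
  cases P <;> simp only [size] <;> first | omega | skip
  · have := Expr.size_pos ‹Expr›; omega
  · rename_i P Q; have := size_pos P; omega
  · have := Expr.size_pos ‹Expr›; omega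

/-- A tiered program runs as its semantics says, and its time is bounded by its number of steps
times the time for one step. -/
theorem exec_compile (hB1 : ∀ t, 1 ≤ B t) (hmono : Monotone B)
    (hB : ∀ t, (1 + S * κ) * B t ≤ B (t + 1)) (hZ : ∀ a, B (tier a) ≤ Z) (P : LoopProg)
    (hP : P.isTiered tier = true) {X : ℕ} {σ₀ : Memory} (hX : P.BoundsLE σ₀ X)
    (hκ : P.size ≤ κ) (σ : Memory) (hσ : ∀ a, tier a = 0 → σ a = σ₀ a) (s : ℕ)
    (hs : s + P.steps.eval X ≤ S) (hroom : Room tier κ B σ (s + P.steps.eval X)) :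
    Room tier κ B (P.sem σ) s ∧
      ∃ t, Exec P.compile σ (P.sem σ) t ∧ t ≤ P.steps.eval X * (3 * κ ^ 2 * Z) := by
  have hZ1 : 1 ≤ Z := (hB1 _).trans (hZ 0)
  have htime : ∀ {σ : Memory} {s : ℕ}, Room tier κ B σ s → ∀ e : Expr, e.size ≤ κ →
      e.time σ ≤ κ ^ 2 * Z := by
    intro σ s h e he
    refine (e.time_le hZ1 fun a i => (h.bitLength_le a i).trans (hZ a)).trans ?_
    exact Nat.mul_le_mul_right _ (Nat.pow_le_pow_left he 2)
  have hY : κ ^ 2 * Z + κ ^ 2 * Z + 1 ≤ 3 * κ ^ 2 * Z := by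
    have : 1 ≤ κ := P.size_pos.trans hκ
    have : 1 ≤ κ ^ 2 * Z := Nat.mul_pos (pow_pos this 2) hZ1
    linarith
  set Y := 3 * κ ^ 2 * Z with hYdef
  clear_value Y
  induction P generalizing σ s with
  | nop =>
    simp only [steps, Polynomial.eval_one] at hroom ⊢
    exact ⟨hroom.mono (by omega), 1, Exec.nop σ, by omega⟩
  | put a i e =>
    simp only [steps, Polynomial.eval_one] at hroom hs ⊢
    simp only [isTiered, Bool.and_eq_true, decide_eq_true_eq] at hP
    simp only [size] at hκ
    refine ⟨hroom.write hB1 hmono hB hs hP.1 hP.2 (by omega) _, _, Exec.put σ a i e, ?_⟩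
    have h1 := htime hroom i (by omega)
    have h2 := htime hroom e (by omega)
    omega
  | seq P Q ihP ihQ =>
    simp only [steps, Polynomial.eval_add] at hroom hs ⊢
    simp only [isTiered, Bool.and_eq_true] at hP
    simp only [size] at hκ
    obtain ⟨r1, t1, e1, b1⟩ := ihP hP.1 hX.1 (by omega) σ hσ (s + Q.steps.eval X) (by omega)
      (hroom.mono (by omega))
    obtain ⟨r2, t2, e2, b2⟩ := ihQ hP.2 hX.2 (by omega) (P.sem σ)
      (fun a ha => (P.sem_frame (P.writes_eq_false_of_tier hP.1 ha) σ).trans (hσ a ha)) s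
      (by omega) r1
    exact ⟨r2, t1 + t2, Exec.seq e1 e2, by rw [add_mul]; omega⟩
  | ite e P Q ihP ihQ =>
    simp only [steps, Polynomial.eval_add, Polynomial.eval_one] at hroom hs ⊢
    simp only [isTiered, Bool.and_eq_true] at hP
    simp only [size] at hκ
    have h1 := htime hroom e (by omega)
    rw [sem]
    split_ifs with he
    · obtain ⟨r1, t1, e1, b1⟩ := ihP hP.1 hX.1 (by omega) σ hσ s (by omega)
        (hroom.mono (by omega))
      exact ⟨r1, _, Exec.ifPos_true he e1, by rw [add_mul, add_mul, one_mul]; omega⟩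
    · obtain ⟨r1, t1, e1, b1⟩ := ihQ hP.2 hX.2 (by omega) σ hσ s (by omega)
        (hroom.mono (by omega))
      exact ⟨r1, _, Exec.ifPos_false he e1, by rw [add_mul, add_mul, one_mul]; omega⟩
  | loop a b P ih =>
    simp only [steps, Polynomial.eval_add, Polynomial.eval_mul, Polynomial.eval_X,
      Polynomial.eval_ofNat] at hroom hs ⊢
    simp only [isTiered, Bool.and_eq_true, decide_eq_true_eq, Bool.not_eq_true'] at hP
    obtain ⟨⟨⟨ha, hb⟩, hw⟩, hP⟩ := hP
    simp only [size] at hκ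
    have hPsize := P.size_pos
    have hbsize := b.size_pos
    set p := P.steps.eval X with hp
    set f : Memory → Memory := fun τ => (P.sem τ).write a 0 (P.sem τ a 0 + 1) with hf
    have sz0 : (Expr.const 0).size = 1 := by simp [Expr.size, bitLength]
    have sz1 : (Expr.const 1).size = 2 := by simp [Expr.size, bitLength]
    set inc : Expr := .add (.get a (.const 0)) (.const 1) with hinc
    have hincs : inc.size ≤ κ := by
      simp only [hinc, Expr.size, bitLength]; simp; omega
    have hinca : inc.isAdditive tier (tier a) = true := by simp [hinc, Expr.isAdditive]
    have hbv : ∀ τ : Memory, (∀ a, tier a = 0 → τ a = σ₀ a) → b.val τ = b.val σ₀ := fun τ hτ =>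
      b.val_congr_of_isInput hτ hb
    have key : ∀ n : ℕ, n ≤ (b.val σ).toNat → ∀ (τ : Memory) (s : ℕ),
        (∀ a, tier a = 0 → τ a = σ₀ a) → τ a 0 = (b.val σ).toNat - (n : ℤ) → s + (n * (p + 2) + 1) ≤ S →
        Room tier κ B τ (s + (n * (p + 2) + 1)) →
        Room tier κ B (f^[n] τ) s ∧
        ∃ t, Exec (.whilePos (.sub b (.get a (.const 0)))
          (.seq P.compile (.put a (.const 0) inc))) τ (f^[n] τ) t ∧ t ≤ (n * (p + 2) + 1) * Y := by
      intro n
      induction n with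
      | zero =>
        intro _ τ s hτ hτa hsS hr
        have hcond := htime hr (.sub b (.get a (.const 0)))
          (by simp only [Expr.size, bitLength]; simp; omega)
        refine ⟨hr.mono (by omega), _, Exec.whilePos_false ?_, by omega⟩
        simp only [Expr.val, hτa, hbv τ hτ, hbv σ hσ]
        omega
      | succ n ihn =>
        intro hn τ s hτ hτa hsS hr
        have hcond := htime hr (.sub b (.get a (.const 0)))
          (by simp only [Expr.size, bitLength]; simp; omega)
        have hsplit : (n + 1) * (p + 2) + 1 = (n * (p + 2) + 1) + 1 + p + 1 := by ring
        rw [hsplit] at hsS hr ⊢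
        obtain ⟨r1, t1, e1, b1⟩ := ih hP hX.2 (by omega) τ hτ (s + (n * (p + 2) + 1) + 1)
          (by omega) (hr.mono (by omega))
        have r2 := r1.write hB1 hmono hB (by omega) ha hinca hincs 0
        have hPτ : ∀ a, tier a = 0 → P.sem τ a = σ₀ a := fun c hc =>
          (P.sem_frame (P.writes_eq_false_of_tier hP hc) τ).trans (hτ c hc)
        obtain ⟨r3, t3, e3, b3⟩ := ihn (by omega) (f τ) s
          (fun c hc => by
            rw [hf]
            simp only
            rw [Memory.write_of_ne _ (by rintro rfl; omega)]
            exact hPτ c hc)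
          (by
            simp only [hf, Memory.write_apply_self, P.sem_frame hw, hτa]
            push_cast; ring)
          (by omega) r2
        rw [Function.iterate_succ_apply]
        have hput := Exec.put (P.sem τ) a (.const 0) inc
        have hpt1 := htime r1 (.const 0) (by omega)
        have hpt2 := htime r1 inc hincs
        refine ⟨r3, _, Exec.whilePos_true ?_ (Exec.seq e1 hput) e3, ?_⟩
        · simp only [Expr.val, hτa, hbv τ hτ, hbv σ hσ]
          rw [hbv σ hσ] at hn
          omega
        · simp only [add_mul, one_mul] at b3 ⊢
          omega
    have hXb : (b.val σ).toNat ≤ X := by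
      have := hX.1
      rw [hbv σ hσ]
      omega
    have hmul : (b.val σ).toNat * (p + 2) ≤ X * (p + 2) := Nat.mul_le_mul_right _ hXb
    have w := hroom.mono (s := s + ((b.val σ).toNat * (p + 2) + 1) + 1) (by omega)
    have r1 := w.write hB1 hmono hB (by omega) ha (e := .const 0) rfl (by omega) 0
    obtain ⟨r2, t2, e2, b2⟩ := key _ le_rfl (σ.write a 0 0) s
      (fun c hc => by
        rw [Memory.write_of_ne _ (by rintro rfl; omega)]
        exact hσ c hc)
      (by simp [Memory.write_apply_self]) (by omega) r1
    have hpt := htime hroom (.const 0) (by omega)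
    refine ⟨r2, _, Exec.seq (Exec.put σ a (.const 0) (.const 0)) e2, ?_⟩
    have h6 : ((b.val σ).toNat * (p + 2) + 1) * Y ≤ (X * (p + 2) + 1) * Y :=
      Nat.mul_le_mul_right _ (by omega)
    have h7 : (X * (p + 2) + 2) * Y = (X * (p + 2) + 1) * Y + Y := by ring
    omega

end Time

theorem bitLength_initial_le (w : List ℤ) (hw : 1 ≤ inputLength w) (a : ℕ) (i : ℤ) :
    bitLength (initial w a i) ≤ inputLength w := by
  have h0 : bitLength 0 ≤ inputLength w := by simpa [bitLength] using hw
  rw [initial]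
  split_ifs with h
  · by_cases hi : i.toNat < w.length
    · rw [List.getD_eq_getElem _ _ hi]
      exact List.le_sum_of_mem (List.mem_map_of_mem (List.getElem_mem hi))
    · rw [List.getD_eq_default _ _ (by omega)]
      exact h0
  · exact h0

/-- A tiered program whose loops have polynomially many rounds runs in polynomial time. -/
theorem exists_polynomial_time (P : LoopProg) (hP : P.isTiered tier = true) {T : ℕ}
    (hT : ∀ a, tier a ≤ T) (d : Polynomial ℕ) : ∃ b : Polynomial ℕ, ∀ w : List ℤ,
      1 ≤ inputLength w → P.BoundsLE (initial w) (d.eval (inputLength w)) →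
        ∃ t, Exec P.compile (initial w) (P.sem (initial w)) t ∧ t ≤ b.eval (inputLength w) := by
  refine ⟨P.steps.comp d * (3 * Polynomial.C P.size ^ 2 *
    (Polynomial.X * (1 + P.steps.comp d * Polynomial.C P.size) ^ T)), fun w hw hX => ?_⟩
  set L := inputLength w with hL
  set S := P.steps.eval (d.eval L) with hS
  set B : ℕ → ℕ := fun t => L * (1 + S * P.size) ^ t with hB
  have hmono : Monotone B := fun s t hst =>
    Nat.mul_le_mul_left _ (Nat.pow_le_pow_right (by omega) hst)
  have hB1 : ∀ t, 1 ≤ B t := fun t => Nat.mul_pos hw (pow_pos (by omega) t)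
  obtain ⟨-, t, ht, hle⟩ := exec_compile (κ := P.size) (S := S) (Z := B T) hB1 hmono
    (fun t => by simp only [hB, pow_succ]; exact le_of_eq (by ring)) (fun a => hmono (hT a)) P hP hX
    le_rfl (initial w) (fun _ _ => rfl) 0 (by omega) (by
      intro a i
      have h1 := bitLength_initial_le w hw a i
      split_ifs with h
      · exact h1.trans (by simp [hB, h, hL])
      · obtain ⟨k, hk⟩ := Nat.exists_eq_add_of_le' (Nat.pos_of_ne_zero h)
        rw [hk, Nat.add_sub_cancel]
        have h2 : B (k + 1) = B k + S * (P.size * B k) := by simp only [hB, pow_succ]; ring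
        have h3 : L ≤ B k := Nat.le_mul_of_pos_right _ (pow_pos (by omega) k)
        rw [h2, Nat.zero_add, ← hS]
        omega)
  refine ⟨t, ht, hle.trans (le_of_eq ?_)⟩
  simp [Polynomial.eval_comp, hB, hS]

end LoopProg

end RAM

/-! ## Weighted bipartite matching by growing alternating trees

Rows `0 ≤ r < p` are matched one by one to columns `0 ≤ j < m`; `y` and `z` are dual prices, `mr`
maps a matched row to its column, and `mc` maps a column to its row plus one, or to `0` if the
column is free. -/

namespace Hungarian

/-- The rows below `i` are matched along tight edges, and the prices are feasible for the rows
below `k`; free columns other than `e` have price zero. -/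
structure Matched (m i k e : ℤ) (wt : ℤ → ℤ → ℤ) (y z mr mc : ℤ → ℤ) : Prop where
  row : ∀ r, 0 ≤ r → r < i →
    0 ≤ mr r ∧ mr r < m ∧ mc (mr r) = r + 1 ∧ y r + z (mr r) = wt r (mr r)
  col : ∀ j, 0 ≤ j → j < m → mc j ≠ 0 → 0 < mc j ∧ mc j ≤ i ∧ mr (mc j - 1) = j
  feasible : ∀ r j, 0 ≤ r → r < k → 0 ≤ j → j < m → wt r j ≤ y r + z j
  price_nonneg : ∀ j, 0 ≤ j → j < m → 0 ≤ z j
  price_free : ∀ j, 0 ≤ j → j < m → mc j = 0 → j ≠ e → z j = 0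

/-- The alternating tree with root row `i` after `t` columns have been added: `rt` and `ct` mark its
rows and columns, columns with the time of their addition, and `par` is the parent of a column. -/
structure Tree (p m i t : ℤ) (wt : ℤ → ℤ → ℤ) (y z mr mc rt ct par : ℤ → ℤ) : Prop where
  root : 0 < rt i
  row : ∀ r, 0 ≤ r → r < i → (0 < rt r ↔ 0 < ct (mr r))
  row_gt : ∀ r, i < r → r < p → ¬ 0 < rt r
  stamp_le : ∀ j, 0 ≤ j → j < m → 0 < ct j → ct j ≤ t
  matched : ∀ j, 0 ≤ j → j < m → 0 < ct j → mc j ≠ 0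
  parent : ∀ j, 0 ≤ j → j < m → 0 < ct j → 0 ≤ par j ∧ par j ≤ i ∧ 0 < rt (par j) ∧
    y (par j) + z j = wt (par j) j ∧ (par j ≠ i → ct (mr (par j)) < ct j)
  stamp : ∀ s, 0 < s → s ≤ t → ∃ j, 0 ≤ j ∧ j < m ∧ ct j = s

/-- The tree while the matching is changed along the path from the column `c` to the root. -/
structure Path (m i c s : ℤ) (wt : ℤ → ℤ → ℤ) (y z mr mc ct par : ℤ → ℤ) : Prop where
  cur_nonneg : 0 ≤ c
  cur_lt : c < m
  cur_free : mc c = 0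
  stamp_pos : 0 < ct c
  stamp_le : ct c ≤ s
  parent : ∀ j, 0 ≤ j → j < m → 0 < ct j → ct j ≤ ct c → 0 ≤ par j ∧ par j ≤ i ∧
    y (par j) + z j = wt (par j) j ∧ (par j ≠ i → 0 < ct (mr (par j)) ∧ ct (mr (par j)) < ct j)

variable {p m i t k e : ℤ} {wt : ℤ → ℤ → ℤ} {y z mr mc rt ct par : ℤ → ℤ}

/-- There are more columns than matched rows, so some column is free. -/
theorem Matched.exists_free (h : Matched m i k e wt y z mr mc) (hi : 0 ≤ i) (him : i < m) :
    ∃ j, 0 ≤ j ∧ j < m ∧ mc j = 0 := by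
  by_contra hcon
  push Not at hcon
  have := Finset.card_le_card_of_injOn (s := Finset.Ico 0 m) (t := Finset.Ico 0 i)
    (fun j => mc j - 1) (fun j hj => by
      simp only [Finset.coe_Ico, Set.mem_Ico] at hj ⊢
      have := h.col j hj.1 hj.2 (hcon j hj.1 hj.2)
      omega) (fun j hj j' hj' hjj => by
      simp only [Finset.coe_Ico, Set.mem_Ico] at hj hj' hjj
      have h1 := (h.col j hj.1 hj.2 (hcon j hj.1 hj.2)).2.2
      have h2 := (h.col j' hj'.1 hj'.2 (hcon j' hj'.1 hj'.2)).2.2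
      rw [← h1, ← h2, hjj])
  simp only [Int.card_Ico] at this
  omega

theorem Tree.le (h : Matched m i k e wt y z mr mc) (hT : Tree p m i t wt y z mr mc rt ct par)
    (hi : 0 ≤ i) (ht : 0 ≤ t) : t ≤ i := by
  choose! f hf0 hfm hf using hT.stamp
  have hne : ∀ s, 0 < s → s ≤ t → mc (f s) ≠ 0 := fun s h0 hs =>
    hT.matched _ (hf0 s h0 hs) (hfm s h0 hs) (by rw [hf s h0 hs]; exact h0)
  have := Finset.card_le_card_of_injOn (s := Finset.Ioc 0 t) (t := Finset.Ico 0 i)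
    (fun s => mc (f s) - 1) (fun s hs => by
      simp only [Finset.coe_Ioc, Set.mem_Ioc, Finset.coe_Ico, Set.mem_Ico] at hs ⊢
      have := h.col (f s) (hf0 s hs.1 hs.2) (hfm s hs.1 hs.2) (hne s hs.1 hs.2)
      omega) (fun s hs s' hs' hss => by
      simp only [Finset.coe_Ioc, Set.mem_Ioc] at hs hs' hss
      have h1 := (h.col (f s) (hf0 s hs.1 hs.2) (hfm s hs.1 hs.2) (hne s hs.1 hs.2)).2.2
      have h2 := (h.col (f s') (hf0 s' hs'.1 hs'.2) (hfm s' hs'.1 hs'.2) (hne s' hs'.1 hs'.2)).2.2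
      rw [hss] at h1
      rw [← hf s hs.1 hs.2, ← hf s' hs'.1 hs'.2, h1.symm.trans h2])
  simp only [Int.card_Ico, Int.card_Ioc] at this
  omega

theorem Matched.init (h : Matched m i i e wt y z mr mc) {v : ℤ}
    (hv : ∀ j, 0 ≤ j → j < m → wt i j ≤ v) :
    Matched m i (i + 1) e wt (Function.update y i v) z mr mc where
  row r h0 h1 := by
    rw [Function.update_of_ne (by omega)]
    exact h.row r h0 h1
  col := h.col
  feasible r j h0 h1 h2 h3 := by
    by_cases hr : r = i
    · subst hr
      rw [Function.update_self]
      have := hv j h2 h3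
      have := h.price_nonneg j h2 h3
      omega
    · rw [Function.update_of_ne hr]
      exact h.feasible r j h0 (by omega) h2 h3
  price_nonneg := h.price_nonneg
  price_free := h.price_free

theorem Tree.init (h : Matched m i k e wt y z mr mc)
    (hrt : ∀ r, 0 ≤ r → r < p → r ≠ i → rt r = 0) (hrti : rt i = 1) (hi : 0 ≤ i) (hip : i < p)
    (hct : ∀ j, 0 ≤ j → j < m → ct j = 0) : Tree p m i 0 wt y z mr mc rt ct par where
  root := by omega
  row r h0 h1 := by
    have h2 := h.row r h0 h1
    have h3 := hrt r h0 (by omega) (by omega)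
    have h4 := hct (mr r) h2.1 h2.2.1
    omega
  row_gt r h0 h1 := by
    have := hrt r (by omega) h1 (by omega)
    omega
  stamp_le j h0 h1 h2 := by have := hct j h0 h1; omega
  matched j h0 h1 h2 := by have := hct j h0 h1; omega
  parent j h0 h1 h2 := by have := hct j h0 h1; omega
  stamp s h0 h1 := by omega

/-- Changing the prices by the minimum slack `d` between tree rows and other columns. -/
theorem Matched.shift (h : Matched m i (i + 1) e wt y z mr mc)
    (hT : Tree p m i t wt y z mr mc rt ct par) {d : ℤ} {y' z' : ℤ → ℤ} (hd : 0 ≤ d) (hip : i < p)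
    (hmin : ∀ r j, 0 ≤ r → r < p → 0 < rt r → 0 ≤ j → j < m → ¬ 0 < ct j → d ≤ y r + z j - wt r j)
    (hy : ∀ r, 0 ≤ r → r < p → y' r = if 0 < rt r then y r - d else y r)
    (hz : ∀ j, 0 ≤ j → j < m → z' j = if 0 < ct j then z j + d else z j) :
    Matched m i (i + 1) e wt y' z' mr mc where
  row r h0 h1 := by
    obtain ⟨a1, a2, a3, a4⟩ := h.row r h0 h1
    have hh := hT.row r h0 h1
    refine ⟨a1, a2, a3, ?_⟩
    rw [hy r h0 (by omega), hz _ a1 a2]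
    split_ifs <;> omega
  col := h.col
  feasible r j h0 h1 h2 h3 := by
    have a1 := h.feasible r j h0 h1 h2 h3
    have a2 := hmin r j h0 (by omega)
    rw [hy r h0 (by omega), hz j h2 h3]
    split_ifs with b1 b2 b2
    · omega
    · have := a2 b1 h2 h3 b2
      omega
    · omega
    · omega
  price_nonneg j h0 h1 := by
    have := h.price_nonneg j h0 h1
    rw [hz j h0 h1]
    split_ifs <;> omega
  price_free j h0 h1 h2 h3 := by
    have := h.price_free j h0 h1 h2 h3
    rw [hz j h0 h1, if_neg (fun hc => hT.matched j h0 h1 hc h2), this]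

/-- The result of a price change followed by the addition of the column `b` with parent `a`. -/
structure Added (p m t d a b : ℤ) (wt : ℤ → ℤ → ℤ) (y z rt ct par y' z' ct' par' : ℤ → ℤ) :
    Prop where
  row_nonneg : 0 ≤ a
  row_lt : a < p
  row_mem : 0 < rt a
  col_nonneg : 0 ≤ b
  col_lt : b < m
  col_notMem : ¬ 0 < ct b
  slack : d = y a + z b - wt a b
  left : ∀ r, 0 ≤ r → r < p → y' r = if 0 < rt r then y r - d else y r
  right : ∀ j, 0 ≤ j → j < m → z' j = if 0 < ct j then z j + d else z j
  stamp : ct' = Function.update ct b (t + 1)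
  parent : par' = Function.update par b a

variable {d a b : ℤ} {y' z' rt' ct' par' : ℤ → ℤ}

theorem Added.parent_spec (hA : Added p m t d a b wt y z rt ct par y' z' ct' par')
    (h : Matched m i (i + 1) e wt y z mr mc) (hT : Tree p m i t wt y z mr mc rt ct par)
    (hip : i < p) :
    ∀ j, 0 ≤ j → j < m → 0 < ct' j → 0 ≤ par' j ∧ par' j ≤ i ∧ 0 < rt (par' j) ∧
      y' (par' j) + z' j = wt (par' j) j ∧
      (par' j ≠ i → 0 < ct' (mr (par' j)) ∧ ct' (mr (par' j)) < ct' j) := by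
  obtain ⟨ha0, hap, hart, hb0, hbm, hbct, hd, hy, hz, hct, hpar⟩ := hA
  have hai : a ≤ i := by
    by_contra hcon
    exact hT.row_gt a (by omega) hap hart
  intro j h0 h1 h2
  by_cases hj : j = b
  · subst hj
    rw [hpar, Function.update_self]
    refine ⟨ha0, hai, hart, ?_, fun hne => ?_⟩
    · rw [hy a ha0 hap, hz j h0 h1, if_pos hart, if_neg hbct]
      omega
    · obtain ⟨b1, b2, -⟩ := h.row a ha0 (by omega)
      have b3 := (hT.row a ha0 (by omega)).1 hart
      have hne' : mr a ≠ j := by rintro hh; rw [hh] at b3; exact hbct b3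
      rw [hct, Function.update_of_ne hne', Function.update_self]
      exact ⟨b3, by have := hT.stamp_le _ b1 b2 b3; omega⟩
  · rw [hct, Function.update_of_ne hj] at h2
    obtain ⟨c1, c2, c3, c4, c5⟩ := hT.parent j h0 h1 h2
    rw [hpar, Function.update_of_ne hj]
    refine ⟨c1, c2, c3, ?_, fun hne => ?_⟩
    · rw [hy _ c1 (by omega), hz j h0 h1, if_pos c3, if_pos h2]
      omega
    · have b3 := (hT.row (par j) c1 (by omega)).1 c3
      have hne' : mr (par j) ≠ b := by rintro hh; rw [hh] at b3; exact hbct b3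
      rw [hct, Function.update_of_ne hne', Function.update_of_ne hj]
      exact ⟨b3, c5 hne⟩

/-- Adding a matched column and its row to the tree. -/
theorem Added.tree (hA : Added p m t d a b wt y z rt ct par y' z' ct' par')
    (h : Matched m i (i + 1) e wt y z mr mc) (hT : Tree p m i t wt y z mr mc rt ct par)
    (hip : i < p) (ht : 0 ≤ t) (hb : mc b ≠ 0) (hrt : rt' = Function.update rt (mc b - 1) 1) :
    Tree p m i (t + 1) wt y' z' mr mc rt' ct' par' := by
  have hP := hA.parent_spec h hT hip
  obtain ⟨ha0, hap, hart, hb0, hbm, hbct, hd, hy, hz, hct, hpar⟩ := hA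
  obtain ⟨m1, m2, m3⟩ := h.col b hb0 hbm hb
  have hmono : ∀ r, 0 < rt r → 0 < rt' r := by
    intro r hr
    rw [hrt, Function.update_apply]
    split_ifs <;> omega
  refine ⟨hmono _ hT.root, ?_, ?_, ?_, ?_, ?_, ?_⟩
  · intro r h0 h1
    obtain ⟨b1, b2, b3, -⟩ := h.row r h0 h1
    have b4 := hT.row r h0 h1
    by_cases hr : mr r = b
    · have : r = mc b - 1 := by rw [← hr, b3]; ring
      rw [hrt, hct, hr, this, Function.update_self, Function.update_self]
      omega
    · have : r ≠ mc b - 1 := by rintro rfl; exact hr m3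
      rw [hrt, hct, Function.update_of_ne this, Function.update_of_ne hr, b4]
  · intro r h0 h1
    rw [hrt, Function.update_of_ne (by omega)]
    exact hT.row_gt r h0 h1
  · intro j h0 h1 h2
    rw [hct, Function.update_apply] at h2 ⊢
    split_ifs at h2 ⊢ with hj
    · exact le_rfl
    · have := hT.stamp_le j h0 h1 h2; omega
  · intro j h0 h1 h2
    by_cases hj : j = b
    · rw [hj]; exact hb
    · rw [hct, Function.update_of_ne hj] at h2
      exact hT.matched j h0 h1 h2
  · intro j h0 h1 h2
    obtain ⟨c1, c2, c3, c4, c5⟩ := hP j h0 h1 h2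
    exact ⟨c1, c2, hmono _ c3, c4, fun hne => (c5 hne).2⟩
  · intro s h0 h1
    by_cases hs : s = t + 1
    · exact ⟨b, hb0, hbm, by rw [hct, Function.update_self, hs]⟩
    · obtain ⟨j, j0, j1, j2⟩ := hT.stamp s h0 (by omega)
      refine ⟨j, j0, j1, ?_⟩
      rw [hct, Function.update_of_ne (by rintro rfl; omega), j2]

/-- Adding a free column to the tree gives an augmenting path. -/
theorem Added.path (hA : Added p m t d a b wt y z rt ct par y' z' ct' par')
    (h : Matched m i (i + 1) e wt y z mr mc) (hT : Tree p m i t wt y z mr mc rt ct par)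
    (hip : i < p) (ht : 0 ≤ t) (hb : mc b = 0) :
    Path m i b (t + 1) wt y' z' mr mc ct' par' := by
  have hP := hA.parent_spec h hT hip
  obtain ⟨ha0, hap, hart, hb0, hbm, hbct, hd, hy, hz, hct, hpar⟩ := hA
  refine ⟨hb0, hbm, hb, ?_, ?_, ?_⟩
  · rw [hct, Function.update_self]; omega
  · rw [hct, Function.update_self]
  · intro j h0 h1 h2 _
    obtain ⟨c1, c2, c3, c4, c5⟩ := hP j h0 h1 h2
    exact ⟨c1, c2, c4, c5⟩

/-- One step along the path: the parent of `c` is matched to `c` and frees its former column. -/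
theorem Path.step {c s : ℤ} (hM : Matched m i (i + 1) c wt y z mr mc)
    (h : Path m i c s wt y z mr mc ct par) {mr' mc' : ℤ → ℤ} (hne : par c ≠ i)
    (hmr : mr' = Function.update mr (par c) c)
    (hmc : mc' = Function.update (Function.update mc c (par c + 1)) (mr (par c)) 0) :
    Matched m i (i + 1) (mr (par c)) wt y z mr' mc' ∧
      Path m i (mr (par c)) (s - 1) wt y z mr' mc' ct par := by
  obtain ⟨c1, c2, c3, c4, c5, hpar⟩ := h
  obtain ⟨d1, d2, d3, d4⟩ := hpar c c1 c2 c4 le_rfl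
  obtain ⟨d4, d5⟩ := d4 hne
  obtain ⟨f1, f2, f3, f4⟩ := hM.row (par c) d1 (by omega)
  have hoc : mr (par c) ≠ c := by intro hh; rw [hh] at d5; omega
  have hinj : ∀ r, 0 ≤ r → r < i → mr r = mr (par c) → r = par c := by
    intro r h0 h1 h2
    have := (hM.row r h0 h1).2.2.1
    rw [h2, f3] at this
    omega
  refine ⟨⟨?_, ?_, hM.feasible, hM.price_nonneg, ?_⟩, ⟨f1, f2, ?_, d4, by omega, ?_⟩⟩
  · intro r h0 h1
    by_cases hr : r = par c
    · subst hr
      rw [hmr, Function.update_self, hmc, Function.update_of_ne hoc.symm, Function.update_self]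
      exact ⟨c1, c2, rfl, d3⟩
    · obtain ⟨g1, g2, g3, g4⟩ := hM.row r h0 h1
      rw [hmr, Function.update_of_ne hr, hmc,
        Function.update_of_ne (fun hh => hr (hinj r h0 h1 hh)),
        Function.update_of_ne (by intro hh; rw [hh, c3] at g3; omega)]
      exact ⟨g1, g2, g3, g4⟩
  · intro j h0 h1 h2
    by_cases hj : j = mr (par c)
    · rw [hmc, hj, Function.update_self] at h2; exact absurd rfl h2
    rw [hmc, Function.update_of_ne hj] at h2 ⊢
    by_cases hjc : j = c
    · subst hjc
      rw [Function.update_self]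
      refine ⟨by omega, by omega, ?_⟩
      rw [hmr, add_sub_cancel_right, Function.update_self]
    · rw [Function.update_of_ne hjc] at h2 ⊢
      obtain ⟨g1, g2, g3⟩ := hM.col j h0 h1 h2
      refine ⟨g1, g2, ?_⟩
      rw [hmr, Function.update_of_ne (by intro hh; rw [hh] at g3; exact hj g3.symm), g3]
  · intro j h0 h1 h2 h3
    rw [hmc, Function.update_of_ne h3] at h2
    by_cases hjc : j = c
    · rw [hjc, Function.update_self] at h2; omega
    · rw [Function.update_of_ne hjc] at h2
      exact hM.price_free j h0 h1 h2 hjc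
  · rw [hmc, Function.update_self]
  · intro j h0 h1 h2 h3
    obtain ⟨g1, g2, g3, g4⟩ := hpar j h0 h1 h2 (by omega)
    refine ⟨g1, g2, g3, fun hji => ?_⟩
    obtain ⟨g5, g6⟩ := g4 hji
    have : par j ≠ par c := by intro hh; rw [hh] at g6; omega
    rw [hmr, Function.update_of_ne this]
    exact ⟨g5, g6⟩

/-- The last step along the path: the root is matched. -/
theorem Path.last {c s : ℤ} (hM : Matched m i (i + 1) c wt y z mr mc)
    (h : Path m i c s wt y z mr mc ct par) {mr' mc' : ℤ → ℤ} (heq : par c = i)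
    (hmr : mr' = Function.update mr i c) (hmc : mc' = Function.update mc c (i + 1)) :
    Matched m (i + 1) (i + 1) (-1) wt y z mr' mc' := by
  obtain ⟨c1, c2, c3, c4, c5, hpar⟩ := h
  obtain ⟨d1, d2, d3, -⟩ := hpar c c1 c2 c4 le_rfl
  rw [heq] at d3
  refine ⟨?_, ?_, hM.feasible, hM.price_nonneg, ?_⟩
  · intro r h0 h1
    by_cases hr : r = i
    · subst hr
      rw [hmr, Function.update_self, hmc, Function.update_self]
      exact ⟨c1, c2, rfl, d3⟩
    · obtain ⟨g1, g2, g3, g4⟩ := hM.row r h0 (by omega)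
      rw [hmr, Function.update_of_ne hr, hmc,
        Function.update_of_ne (by intro hh; rw [hh, c3] at g3; omega)]
      exact ⟨g1, g2, g3, g4⟩
  · intro j h0 h1 h2
    by_cases hjc : j = c
    · subst hjc
      rw [hmc, Function.update_self]
      exact ⟨by omega, by omega, by rw [hmr, add_sub_cancel_right, Function.update_self]⟩
    · rw [hmc, Function.update_of_ne hjc] at h2 ⊢
      obtain ⟨g1, g2, g3⟩ := hM.col j h0 h1 h2
      exact ⟨g1, by omega, by rw [hmr, Function.update_of_ne (by omega), g3]⟩
  · intro j h0 h1 h2 _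
    by_cases hjc : j = c
    · rw [hmc, hjc, Function.update_self] at h2; omega
    · rw [hmc, Function.update_of_ne hjc] at h2
      exact hM.price_free j h0 h1 h2 hjc

end Hungarian

namespace RAM

notation "arrW" => (11 : ℕ)
notation "arrY" => (12 : ℕ)
notation "arrZ" => (13 : ℕ)
notation "arrMateRow" => (14 : ℕ)
notation "arrMateCol" => (15 : ℕ)
notation "arrTreeRow" => (16 : ℕ)
notation "arrTreeCol" => (17 : ℕ)
notation "arrParent" => (18 : ℕ)
notation "varDone" => (19 : ℕ)
notation "varSlack" => (20 : ℕ)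
notation "varMinRow" => (21 : ℕ)
notation "varMinCol" => (22 : ℕ)
notation "varFound" => (23 : ℕ)
notation "varCol" => (24 : ℕ)
notation "varRow" => (25 : ℕ)
notation "varNext" => (26 : ℕ)
notation "varTmp" => (27 : ℕ)
notation "cntRoot" => (30 : ℕ)
notation "cntStage" => (31 : ℕ)
notation "cntRow" => (32 : ℕ)
notation "cntCol" => (33 : ℕ)

namespace LoopProg

open RAM.Expr Hungarian

/-- The number of rows. -/
abbrev numRows : Expr := .get 0 0

/-- The number of columns without the dummy columns. -/
abbrev numCols : Expr := .get 0 1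

/-- The number of columns, with one dummy column for each row. -/
abbrev allCols : Expr := numRows + numCols

/-- The weight of a pair: dummy columns have weight zero. -/
def paddedWeight (q : ℤ) (w : ℤ → ℤ) (r j : ℤ) : ℤ := if j < q then w (r * q + j) else 0

/-- Compare the slack of the current pair with the minimum so far. -/
def compareSlack : LoopProg :=
  set varTmp (.get arrY (var cntRow) + .get arrZ (var cntCol)) ;;
  ite (numCols - var cntCol)
    (set varTmp (var varTmp - .get arrW (var cntRow * numCols + var cntCol))) nop ;;
  ite (var varFound * (var varTmp - var varSlack + 1)) nop
    (set varSlack (var varTmp) ;; set varMinRow (var cntRow) ;; set varMinCol (var cntCol) ;;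
      set varFound 1)

/-- Find the minimum slack between tree rows and other columns. -/
def minSlack : LoopProg :=
  set varFound 0 ;;
  loop cntRow numRows (ite (.get arrTreeRow (var cntRow))
    (loop cntCol allCols (ite (.get arrTreeCol (var cntCol)) nop compareSlack)) nop)

/-- Change the prices by the minimum slack. -/
def shiftPrices : LoopProg :=
  loop cntRow numRows (ite (.get arrTreeRow (var cntRow))
    (put arrY (var cntRow) (.get arrY (var cntRow) - var varSlack)) nop) ;;
  loop cntCol allCols (ite (.get arrTreeCol (var cntCol))
    (put arrZ (var cntCol) (.get arrZ (var cntCol) + var varSlack)) nop)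

/-- Change the matching along the path from the free column `varMinCol` to the root. -/
def augment : LoopProg :=
  set varCol (var varMinCol) ;; set varFound 1 ;;
  loop cntCol allCols (ite (var varFound)
    (set varRow (.get arrParent (var varCol)) ;;
      set varNext (.get arrMateRow (var varRow)) ;;
      put arrMateRow (var varRow) (var varCol) ;;
      put arrMateCol (var varCol) (var varRow + 1) ;;
      ite ((var varRow - var cntRoot) * (var varRow - var cntRoot))
        (put arrMateCol (var varNext) 0 ;; set varCol (var varNext)) (set varFound 0)) nop)

/-- Add one column to the tree, and augment the matching if the column is free. -/
def growTree : LoopProg :=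
  minSlack ;; shiftPrices ;;
  put arrTreeCol (var varMinCol) (var cntStage + 1) ;;
  put arrParent (var varMinCol) (var varMinRow) ;;
  ite (.get arrMateCol (var varMinCol))
    (put arrTreeRow (.get arrMateCol (var varMinCol) - 1) 1)
    (set varDone 1 ;; augment)

/-- Start a tree at the row `cntRoot`, with a price that is high enough. -/
def initTree : LoopProg :=
  loop cntRow numRows (put arrTreeRow (var cntRow) 0) ;;
  loop cntCol allCols (put arrTreeCol (var cntCol) 0) ;;
  put arrTreeRow (var cntRoot) 1 ;;
  put arrY (var cntRoot) 0 ;;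
  loop cntCol numCols (ite (.get arrW (var cntRoot * numCols + var cntCol) -
      .get arrY (var cntRoot))
    (put arrY (var cntRoot) (.get arrW (var cntRoot * numCols + var cntCol))) nop) ;;
  set varDone 0

/-- Match the row `cntRoot`. -/
def matchRow : LoopProg :=
  initTree ;; loop cntStage allCols (ite (1 - var varDone) growTree nop)

/-- Compute a matching of maximum weight, with optimal prices. -/
def maxWeightMatching : LoopProg :=
  loop cntCol allCols (put arrZ (var cntCol) 0 ;; put arrMateCol (var cntCol) 0) ;;
  loop cntRoot numRows matchRow

variable {p q : ℕ} {σ : Memory}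

theorem compareSlack_spec (hq : σ 0 1 = q) (hf : σ varFound 0 = 0 ∨ σ varFound 0 = 1) (s : ℤ)
    (hs : s = σ arrY (σ cntRow 0) + σ arrZ (σ cntCol 0) -
      paddedWeight q (σ arrW) (σ cntRow 0) (σ cntCol 0)) :
    compareSlack.sem σ varFound 0 = 1 ∧
    ((σ varFound 0 = 1 ∧ σ varSlack 0 ≤ s ∧ compareSlack.sem σ varSlack 0 = σ varSlack 0 ∧
      compareSlack.sem σ varMinRow 0 = σ varMinRow 0 ∧
      compareSlack.sem σ varMinCol 0 = σ varMinCol 0) ∨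
    ((σ varFound 0 = 1 → s ≤ σ varSlack 0) ∧ compareSlack.sem σ varSlack 0 = s ∧
      compareSlack.sem σ varMinRow 0 = σ cntRow 0 ∧
      compareSlack.sem σ varMinCol 0 = σ cntCol 0)) := by
  by_cases h1 : σ cntCol 0 < q <;> rcases hf with h2 | h2 <;>
    simp [compareSlack, paddedWeight, hq, h1, h2] at hs ⊢ <;> omega

/-- The pair in `τ` has minimum slack among the pairs of tree rows and other columns in `D`. -/
structure MinSlackOn (p q : ℕ) (σ : Memory) (D : ℤ → ℤ → Prop) (τ : Memory) : Prop where
  found : τ varFound 0 = 0 ∨ τ varFound 0 = 1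
  pair : τ varFound 0 = 1 → 0 ≤ τ varMinRow 0 ∧ τ varMinRow 0 < p ∧
    0 < σ arrTreeRow (τ varMinRow 0) ∧ 0 ≤ τ varMinCol 0 ∧ τ varMinCol 0 < p + q ∧
    ¬ 0 < σ arrTreeCol (τ varMinCol 0) ∧ τ varSlack 0 = σ arrY (τ varMinRow 0) +
      σ arrZ (τ varMinCol 0) - paddedWeight q (σ arrW) (τ varMinRow 0) (τ varMinCol 0)
  min : ∀ r j : ℤ, 0 ≤ r → r < p → 0 < σ arrTreeRow r → 0 ≤ j → j < p + q → ¬ 0 < σ arrTreeCol j →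
    D r j → τ varFound 0 = 1 ∧
      τ varSlack 0 ≤ σ arrY r + σ arrZ j - paddedWeight q (σ arrW) r j

theorem MinSlackOn.congr {D D' : ℤ → ℤ → Prop} {τ τ' : Memory} (h : MinSlackOn p q σ D τ)
    (hD : ∀ r j : ℤ, 0 ≤ r → r < p → 0 < σ arrTreeRow r → 0 ≤ j → j < p + q → ¬ 0 < σ arrTreeCol j →
      D' r j → D r j)
    (h1 : τ' varFound = τ varFound) (h2 : τ' varSlack = τ varSlack)
    (h3 : τ' varMinRow = τ varMinRow) (h4 : τ' varMinCol = τ varMinCol) :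
    MinSlackOn p q σ D' τ' := by
  refine ⟨?_, ?_, ?_⟩
  · rw [h1]; exact h.found
  · rw [h1, h2, h3, h4]; exact h.pair
  · rw [h1, h2]; exact fun r j a b c d e f g => h.min r j a b c d e f (hD r j a b c d e f g)

theorem minSlack_spec (hp : σ 0 0 = p) (hq : σ 0 1 = q) :
    MinSlackOn p q σ (fun _ _ => True) (minSlack.sem σ) := by
  rw [minSlack, sem_seq]
  set σ₁ := (set varFound 0).sem σ with hσ₁
  have e1 : ∀ c, c ≠ varFound → σ₁ c = σ c := fun c hc => Memory.write_of_ne _ hc _ _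
  have key := sem_loop (σ := σ₁) (a := cntRow) (b := numRows) (n := p)
    (P := ite (.get arrTreeRow (var cntRow))
      (loop cntCol allCols (ite (.get arrTreeCol (var cntCol)) nop compareSlack)) nop) rfl
    (fun k τ => MinSlackOn p q σ (fun r _ => r < k) τ) (by simp [e1, hp])
    (by
      have hf : σ₁ varFound 0 = 0 := by simp [hσ₁]
      exact ⟨by simp [hf], by simp [hf], fun r j _ _ _ _ _ _ h => by simp at h; omega⟩)
    (by
      intro k hk τ hτ hfr hI
      have e2 : ∀ c, c ≠ varFound → (loop cntRow numRows (ite (.get arrTreeRow (var cntRow))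
        (loop cntCol allCols (ite (.get arrTreeCol (var cntCol)) nop compareSlack)) nop)).writes c
          = false → τ c = σ c := fun c h1 h2 => (hfr c h2).trans (e1 c h1)
      by_cases hrow : 0 < σ arrTreeRow k
      swap
      · rw [sem_ite_of_not_pos _ _ (by simpa [hτ, e2 arrTreeRow (by decide) rfl] using hrow)]
        refine hI.congr (fun r j h0 h1 h2 h3 h4 h5 h6 => ?_) rfl rfl rfl rfl
        have : r ≠ k := by rintro rfl; exact hrow h2
        push_cast at h6
        omega
      rw [sem_ite_of_pos _ _ (by simpa [hτ, e2 arrTreeRow (by decide) rfl] using hrow)]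
      have inner := sem_loop (σ := τ) (a := cntCol) (b := allCols) (n := p + q)
        (P := ite (.get arrTreeCol (var cntCol)) nop compareSlack) rfl
        (fun l τ' => MinSlackOn p q σ (fun r j => r < k ∨ r = k ∧ j < l) τ')
        (by simp [e2 0 (by decide) rfl, hp, hq])
        (hI.congr (fun r j h0 h1 h2 h3 h4 h5 h6 => by push_cast at h6; omega) rfl rfl rfl rfl)
        (by
          intro l hl τ' hτ' hfr' hI'
          have e3 : ∀ c, c ≠ varFound → (loop cntRow numRows (ite (.get arrTreeRow (var cntRow))
            (loop cntCol allCols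
              (ite (.get arrTreeCol (var cntCol)) nop compareSlack)) nop)).writes c = false →
              (loop cntCol allCols (ite (.get arrTreeCol (var cntCol)) nop compareSlack)).writes c
                = false → τ' c = σ c := fun c h1 h2 h3 => (hfr' c h3).trans (e2 c h1 h2)
          have hcr : τ' cntRow 0 = k := by rw [hfr' cntRow rfl, hτ]
          by_cases hcol : 0 < σ arrTreeCol l
          · rw [sem_ite_of_pos _ _ (by simpa [hτ', e3 arrTreeCol (by decide) rfl rfl] using hcol)]
            refine hI'.congr (fun r j h0 h1 h2 h3 h4 h5 h6 => ?_) rfl rfl rfl rfl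
            have : j ≠ l := by rintro rfl; exact h5 hcol
            push_cast at h6
            omega
          rw [sem_ite_of_not_pos _ _
            (by simpa [hτ', e3 arrTreeCol (by decide) rfl rfl] using hcol)]
          have hs := compareSlack_spec (q := q) (σ := τ')
            (by rw [e3 0 (by decide) rfl rfl, hq]) hI'.found _ rfl
          rw [hcr, hτ', e3 arrY (by decide) rfl rfl, e3 arrZ (by decide) rfl rfl,
            e3 arrW (by decide) rfl rfl] at hs
          refine MinSlackOn.congr (τ := compareSlack.sem τ')
            (D := fun r j => r < k ∨ r = k ∧ j < (l + 1 : ℕ)) ?_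
            (fun r j h0 h1 h2 h3 h4 h5 h6 => h6) rfl rfl rfl rfl
          generalize compareSlack.sem τ' = τ'' at hs
          obtain ⟨h1, hs⟩ := hs
          refine ⟨Or.inr h1, fun _ => ?_, fun r j h0 h2 h3 h4 h5 h6 h7 => ⟨h1, ?_⟩⟩
          · rcases hs with ⟨g1, g2, g3, g4, g5⟩ | ⟨g1, g2, g3, g4⟩
            · rw [g3, g4, g5]; exact hI'.pair g1
            · rw [g2, g3, g4]
              exact ⟨by omega, by omega, hrow, by omega, by omega, hcol, rfl⟩
          · have hold : r < (k : ℤ) ∨ r = (k : ℤ) ∧ j < (l : ℤ) → τ'' varSlack 0 ≤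
                σ arrY r + σ arrZ j - paddedWeight q (σ arrW) r j := fun hh => by
              obtain ⟨m1, m2⟩ := hI'.min r j h0 h2 h3 h4 h5 h6 hh
              rcases hs with ⟨g1, g2, g3, -⟩ | ⟨g1, g2, -⟩
              · rw [g3]; exact m2
              · rw [g2]; exact (g1 m1).trans m2
            by_cases hnew : r = k ∧ j = l
            · obtain ⟨rfl, rfl⟩ := hnew
              rcases hs with ⟨g1, g2, g3, -⟩ | ⟨g1, g2, -⟩
              · rw [g3]; exact g2
              · rw [g2]
            · exact hold (by push_cast at h7; omega))
      refine inner.congr (fun r j h0 h1 h2 h3 h4 h5 h6 => ?_) rfl rfl rfl rfl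
      push_cast at h6 ⊢
      omega)
  exact key.congr (fun r j h0 h1 _ _ _ _ _ => h1) rfl rfl rfl rfl

theorem shiftPrices_spec (hp : σ 0 0 = p) (hq : σ 0 1 = q) :
    (∀ r : ℤ, 0 ≤ r → r < p → shiftPrices.sem σ arrY r =
      if 0 < σ arrTreeRow r then σ arrY r - σ varSlack 0 else σ arrY r) ∧
    (∀ j : ℤ, 0 ≤ j → j < p + q → shiftPrices.sem σ arrZ j =
      if 0 < σ arrTreeCol j then σ arrZ j + σ varSlack 0 else σ arrZ j) := by
  rw [shiftPrices, sem_seq]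
  set P := loop cntRow numRows (ite (.get arrTreeRow (var cntRow))
    (put arrY (var cntRow) (.get arrY (var cntRow) - var varSlack)) nop) with hP
  have hfrP : ∀ c, P.writes c = false → P.sem σ c = σ c := fun c hc => P.sem_frame hc σ
  constructor
  · intro r h0 h1
    rw [sem_frame _ rfl, hP, sem_loop_map (n := p) (by decide) rfl (by simp [hp])
      (fun r => if 0 < σ arrTreeRow r then σ arrY r - σ varSlack 0 else σ arrY r),
      if_pos ⟨h0, h1⟩]
    intro k _ τ hτ hfr hk
    have e1 := hfr arrTreeRow rfl
    have e2 := hfr varSlack rfl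
    by_cases h : 0 < σ arrTreeRow k
    · simp [sem_ite, hτ, e1, e2, h, hk]
    · simp [sem_ite, hτ, e1, h, ← hk]
  · intro j h0 h1
    rw [sem_loop_map (n := p + q) (by decide) rfl (by simp [hfrP 0 rfl, hp, hq])
      (fun j => if 0 < σ arrTreeCol j then σ arrZ j + σ varSlack 0 else σ arrZ j),
      if_pos ⟨h0, by push_cast; omega⟩]
    intro k _ τ hτ hfr hk
    have e1 := (hfr arrTreeCol rfl).trans (hfrP arrTreeCol rfl)
    have e2 := (hfr varSlack rfl).trans (hfrP varSlack rfl)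
    rw [hfrP arrZ rfl] at hk
    by_cases h : 0 < σ arrTreeCol k
    · simp [sem_ite, hτ, e1, e2, h, hk]
    · simp [sem_ite, hτ, e1, h, ← hk]

theorem augment_spec (hp : σ 0 0 = p) (hq : σ 0 1 = q) {wt : ℤ → ℤ → ℤ} {t : ℤ}
    (ht : t + 1 ≤ p + q)
    (hM : Matched (p + q) (σ cntRoot 0) (σ cntRoot 0 + 1) (σ varMinCol 0) wt (σ arrY) (σ arrZ)
      (σ arrMateRow) (σ arrMateCol))
    (hPath : Path (p + q) (σ cntRoot 0) (σ varMinCol 0) (t + 1) wt (σ arrY) (σ arrZ)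
      (σ arrMateRow) (σ arrMateCol) (σ arrTreeCol) (σ arrParent)) :
    Matched (p + q) (σ cntRoot 0 + 1) (σ cntRoot 0 + 1) (-1) wt (σ arrY) (σ arrZ)
      (augment.sem σ arrMateRow) (augment.sem σ arrMateCol) := by
  rw [augment, sem_seq, sem_seq]
  set i := σ cntRoot 0 with hi
  set σ₁ := (set varFound 1).sem ((set varCol (var varMinCol)).sem σ) with hσ₁
  have e1 : ∀ c, c ≠ varFound → c ≠ varCol → σ₁ c = σ c := fun c hc hc' => by
    simp [hσ₁, hc, hc']
  have key := sem_loop (σ := σ₁) (a := cntCol) (b := allCols) (n := p + q)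
    (P := ite (var varFound)
    (set varRow (.get arrParent (var varCol)) ;;
      set varNext (.get arrMateRow (var varRow)) ;;
      put arrMateRow (var varRow) (var varCol) ;;
      put arrMateCol (var varCol) (var varRow + 1) ;;
      ite ((var varRow - var cntRoot) * (var varRow - var cntRoot))
        (put arrMateCol (var varNext) 0 ;; set varCol (var varNext)) (set varFound 0)) nop) rfl
    (fun k τ =>
      (τ varFound 0 = 0 ∧ Matched (p + q) (i + 1) (i + 1) (-1) wt (σ arrY) (σ arrZ)
        (τ arrMateRow) (τ arrMateCol)) ∨
      (τ varFound 0 = 1 ∧ Matched (p + q) i (i + 1) (τ varCol 0) wt (σ arrY) (σ arrZ)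
        (τ arrMateRow) (τ arrMateCol) ∧ Path (p + q) i (τ varCol 0) (t + 1 - k) wt (σ arrY)
        (σ arrZ) (τ arrMateRow) (τ arrMateCol) (σ arrTreeCol) (σ arrParent)))
    (by simp [e1, hp, hq])
    (by
      right
      simpa [hσ₁] using ⟨hM, hPath⟩)
    (by
      intro k hk τ hτ hfr hI
      have ep : τ arrParent = σ arrParent := (hfr _ rfl).trans (e1 _ (by decide) (by decide))
      have er : τ cntRoot 0 = i := by rw [hfr _ rfl, e1 _ (by decide) (by decide)]
      rcases hI with ⟨hf, hI⟩ | ⟨hf, hI1, hI2⟩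
      · left
        rw [sem_ite_of_not_pos _ _ (by simp [hf])]
        exact ⟨by simpa using hf, by simpa using hI⟩
      · rw [sem_ite_of_pos _ _ (by simp [hf])]
        by_cases hpar : σ arrParent (τ varCol 0) = i
        · left
          have := hI2.last hI1 hpar rfl rfl
          refine ⟨by simp [ep, er, hpar], ?_⟩
          simpa [sem_ite, ep, er, hpar] using this
        · right
          have hpos : 0 < (σ arrParent (τ varCol 0) - i) * (σ arrParent (τ varCol 0) - i) :=
            mul_self_pos.2 (sub_ne_zero.2 hpar)
          have := hI2.step hI1 hpar rfl rfl
          refine ⟨by simp [ep, er, hpos, hf], ?_⟩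
          have e : t + 1 - ((k + 1 : ℕ) : ℤ) = t + 1 - k - 1 := by push_cast; ring
          rw [e]
          simpa [sem_ite, ep, er, hpos] using this)
  rcases key with ⟨-, h⟩ | ⟨-, -, h⟩
  · exact h
  · have h1 := h.stamp_pos
    have h2 := h.stamp_le
    push_cast at h2
    omega

/-- The state of the search for the root row `i` after `t` columns have been added. -/
def Searching (p q : ℕ) (i t : ℤ) (wt : ℤ → ℤ → ℤ) (σ : Memory) : Prop :=
  (0 < σ varDone 0 ∧ Matched (p + q) (i + 1) (i + 1) (-1) wt (σ arrY) (σ arrZ) (σ arrMateRow)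
    (σ arrMateCol)) ∨
  (σ varDone 0 = 0 ∧ Matched (p + q) i (i + 1) (-1) wt (σ arrY) (σ arrZ) (σ arrMateRow)
    (σ arrMateCol) ∧ Tree p (p + q) i t wt (σ arrY) (σ arrZ) (σ arrMateRow) (σ arrMateCol)
    (σ arrTreeRow) (σ arrTreeCol) (σ arrParent))

theorem growTree_spec (hp : σ 0 0 = p) (hq : σ 0 1 = q) {t : ℕ} (ht : t < p + q)
    (hst : σ cntStage 0 = t) {i : ℤ} (hi : σ cntRoot 0 = i) (hi0 : 0 ≤ i) (hip : i < p)
    (hdone : σ varDone 0 = 0)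
    (hM : Matched (p + q) i (i + 1) (-1) (paddedWeight q (σ arrW)) (σ arrY) (σ arrZ)
      (σ arrMateRow) (σ arrMateCol))
    (hT : Tree p (p + q) i t (paddedWeight q (σ arrW)) (σ arrY) (σ arrZ) (σ arrMateRow)
      (σ arrMateCol) (σ arrTreeRow) (σ arrTreeCol) (σ arrParent)) :
    Searching p q i (t + 1) (paddedWeight q (σ arrW)) (growTree.sem σ) := by
  have hmin := minSlack_spec (p := p) (q := q) hp hq
  have f1 : ∀ c, minSlack.writes c = false → minSlack.sem σ c = σ c := fun c h => sem_frame _ h σ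
  set σ₁ := minSlack.sem σ with hσ₁
  obtain ⟨j₀, hj₀, hj₀m, hj₀f⟩ := hM.exists_free hi0 (by omega)
  obtain ⟨hfound, -⟩ := hmin.min i j₀ hi0 hip hT.root hj₀ hj₀m
    (fun h => hT.matched j₀ hj₀ hj₀m h hj₀f) trivial
  obtain ⟨a0, ap, art, b0, bm, bct, hslack⟩ := hmin.pair hfound
  have hle : ∀ r j : ℤ, 0 ≤ r → r < p → 0 < σ arrTreeRow r → 0 ≤ j → j < p + q →
      ¬ 0 < σ arrTreeCol j →
      σ₁ varSlack 0 ≤ σ arrY r + σ arrZ j - paddedWeight q (σ arrW) r j :=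
    fun r j g1 g2 g3 g4 g5 g6 => (hmin.min r j g1 g2 g3 g4 g5 g6 trivial).2
  have hd : 0 ≤ σ₁ varSlack 0 := by
    have hai : σ₁ varMinRow 0 ≤ i := by
      by_contra hcon
      exact hT.row_gt _ (by omega) ap art
    have := hM.feasible _ _ a0 (show σ₁ varMinRow 0 < i + 1 by omega) b0 bm
    omega
  obtain ⟨hY, hZ⟩ := shiftPrices_spec (p := p) (q := q) (σ := σ₁) (by rw [f1 _ rfl, hp])
    (by rw [f1 _ rfl, hq])
  have f2 : ∀ c, shiftPrices.writes c = false → shiftPrices.sem σ₁ c = σ₁ c :=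
    fun c h => sem_frame _ h σ₁
  set σ₂ := shiftPrices.sem σ₁ with hσ₂
  rw [f1 arrTreeRow rfl, f1 arrY rfl] at hY
  rw [f1 arrTreeCol rfl, f1 arrZ rfl] at hZ
  have hM' : Matched (p + q) i (i + 1) (-1) (paddedWeight q (σ arrW)) (σ₂ arrY) (σ₂ arrZ)
      (σ arrMateRow) (σ arrMateCol) := hM.shift hT hd hip hle hY hZ
  have hA : Added p (p + q) t (σ₁ varSlack 0) (σ₁ varMinRow 0) (σ₁ varMinCol 0)
      (paddedWeight q (σ arrW)) (σ arrY) (σ arrZ) (σ arrTreeRow) (σ arrTreeCol) (σ arrParent)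
      (σ₂ arrY) (σ₂ arrZ) _ _ :=
    ⟨a0, ap, art, b0, bm, bct, hslack, hY, hZ, rfl, rfl⟩
  have g : ∀ c, minSlack.writes c = false → shiftPrices.writes c = false → σ₂ c = σ c :=
    fun c h1 h2 => (f2 c h2).trans (f1 c h1)
  have hgrow : growTree.sem σ = (ite (.get arrMateCol (var varMinCol))
      (put arrTreeRow (.get arrMateCol (var varMinCol) - 1) 1) (set varDone 1 ;; augment)).sem
      ((put arrParent (var varMinCol) (var varMinRow)).sem
        ((put arrTreeCol (var varMinCol) (var cntStage + 1)).sem σ₂)) := rfl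
  rw [hgrow]
  set σ₃ := (put arrParent (var varMinCol) (var varMinRow)).sem
        ((put arrTreeCol (var varMinCol) (var cntStage + 1)).sem σ₂) with hσ₃
  have g3 : ∀ c, c ≠ arrParent → c ≠ arrTreeCol → σ₃ c = σ₂ c := fun c h1 h2 => by
    simp [hσ₃, h1, h2]
  have hpar : σ₃ arrParent = Function.update (σ arrParent) (σ₁ varMinCol 0) (σ₁ varMinRow 0) := by
    simp [hσ₃, f2 varMinCol rfl, f2 varMinRow rfl, g arrParent rfl rfl]
  have hct : σ₃ arrTreeCol = Function.update (σ arrTreeCol) (σ₁ varMinCol 0) (t + 1) := by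
    simp [hσ₃, f2 varMinCol rfl, g cntStage rfl rfl, g arrTreeCol rfl rfl, hst]
  have hmc : σ₃ arrMateCol = σ arrMateCol := by
    rw [g3 _ (by decide) (by decide), g _ rfl rfl]
  have hcol : σ₃ varMinCol = σ₁ varMinCol := by
    rw [g3 _ (by decide) (by decide), f2 _ rfl]
  by_cases hb : 0 < σ arrMateCol (σ₁ varMinCol 0)
  · rw [sem_ite_of_pos _ _ (by simpa [hmc, hcol] using hb)]
    right
    have := hA.tree hM hT hip (by omega) (by omega) rfl
    refine ⟨?_, ?_, ?_⟩
    · simp [g3, g varDone rfl rfl, hdone]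
    · simpa [g3, g arrMateCol rfl rfl, g arrMateRow rfl rfl] using hM'
    · simpa [g3, g arrMateCol rfl rfl, f2 varMinCol rfl, hpar, hct, g arrMateRow rfl rfl,
        g arrTreeRow rfl rfl] using this
  · have hb0 : σ arrMateCol (σ₁ varMinCol 0) = 0 := by
      by_contra hne
      exact hb (hM.col _ b0 bm hne).1
    rw [sem_ite_of_not_pos _ _ (by simpa [hmc, hcol] using hb), sem_seq]
    left
    have hP := hA.path hM hT hip (by omega) hb0
    set σ₄ := (set varDone 1).sem σ₃ with hσ₄
    have g4 : ∀ c, c ≠ varDone → σ₄ c = σ₃ c := fun c hc => by simp [hσ₄, hc]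
    have g5 : ∀ c, augment.writes c = false → augment.sem σ₄ c = σ₄ c := fun c h => sem_frame _ h σ₄
    have hroot : σ₄ cntRoot 0 = i := by
      rw [g4 _ (by decide), g3 _ (by decide) (by decide), g _ rfl rfl, hi]
    have := augment_spec (p := p) (q := q) (σ := σ₄) (wt := paddedWeight q (σ arrW)) (t := t)
      (by rw [g4 _ (by decide), g3 _ (by decide) (by decide), g _ rfl rfl, hp])
      (by rw [g4 _ (by decide), g3 _ (by decide) (by decide), g _ rfl rfl, hq]) (by omega)
      (by
        rw [hroot, g4 _ (by decide), g4 _ (by decide), g4 _ (by decide), g4 _ (by decide),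
          g4 _ (by decide), hcol, hmc, g3 _ (by decide) (by decide), g3 _ (by decide) (by decide),
          g3 _ (by decide) (by decide), g arrMateRow rfl rfl]
        exact ⟨hM'.row, hM'.col, hM'.feasible, hM'.price_nonneg, fun j h0 h1 h2 h3 =>
          hM'.price_free j h0 h1 h2 (by omega)⟩)
      (by
        rw [hroot, g4 _ (by decide), g4 _ (by decide), g4 _ (by decide), g4 _ (by decide),
          g4 _ (by decide), g4 _ (by decide), g4 _ (by decide), hcol, hmc, hpar, hct,
          g3 _ (by decide) (by decide), g3 _ (by decide) (by decide),
          g3 _ (by decide) (by decide), g arrMateRow rfl rfl]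
        exact hP)
    rw [hroot] at this
    refine ⟨?_, ?_⟩
    · rw [g5 _ rfl]; simp [hσ₄]
    · rw [g5 arrY rfl, g5 arrZ rfl]
      exact this

theorem initTree_spec (hp : σ 0 0 = p) (hq : σ 0 1 = q) {i : ℤ} (hi : σ cntRoot 0 = i)
    (hi0 : 0 ≤ i) (hip : i < p)
    (hM : Matched (p + q) i i (-1) (paddedWeight q (σ arrW)) (σ arrY) (σ arrZ)
      (σ arrMateRow) (σ arrMateCol)) :
    Searching p q i 0 (paddedWeight q (σ arrW)) (initTree.sem σ) := by
  have hinit : initTree.sem σ = (set varDone 0).sem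
    ((loop cntCol numCols (ite (.get arrW (var cntRoot * numCols + var cntCol) -
      .get arrY (var cntRoot)) (put arrY (var cntRoot)
        (.get arrW (var cntRoot * numCols + var cntCol))) nop)).sem
    ((put arrY (var cntRoot) 0).sem ((put arrTreeRow (var cntRoot) 1).sem
    ((loop cntCol allCols (put arrTreeCol (var cntCol) 0)).sem
    ((loop cntRow numRows (put arrTreeRow (var cntRow) 0)).sem σ))))) := rfl
  rw [hinit]
  set σ₁ := (loop cntRow numRows (put arrTreeRow (var cntRow) 0)).sem σ with hσ₁
  have f1 : ∀ c, (loop cntRow numRows (put arrTreeRow (var cntRow) 0)).writes c = false →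
    σ₁ c = σ c := fun c h => sem_frame _ h σ
  set σ₂ := (loop cntCol allCols (put arrTreeCol (var cntCol) 0)).sem σ₁ with hσ₂
  have f2 : ∀ c, (loop cntCol allCols (put arrTreeCol (var cntCol) 0)).writes c = false →
    σ₂ c = σ₁ c := fun c h => sem_frame _ h σ₁
  have hrt : ∀ r : ℤ, 0 ≤ r → r < p → σ₂ arrTreeRow r = 0 := by
    intro r h0 h1
    rw [f2 _ rfl, hσ₁, sem_loop_map (n := p) (by decide) rfl (by simp [hp]) (fun _ => 0),
      if_pos ⟨h0, h1⟩]
    intro k _ τ hτ _ _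
    simp [hτ]
  have hct : ∀ j : ℤ, 0 ≤ j → j < p + q → σ₂ arrTreeCol j = 0 := by
    intro j h0 h1
    rw [hσ₂, sem_loop_map (n := p + q) (by decide) rfl (by simp [f1, hp, hq, writes])
      (fun _ => 0), if_pos ⟨h0, by push_cast; omega⟩]
    intro k _ τ hτ _ _
    simp [hτ]
  have g2 : ∀ c, c ≠ cntRow → c ≠ arrTreeRow → c ≠ cntCol → c ≠ arrTreeCol → σ₂ c = σ c := by
    intro c h1 h2 h3 h4
    rw [f2 c (by simp [writes, h3.symm, h4.symm]), f1 c (by simp [writes, h1.symm, h2.symm])]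
  set σ₃ := (put arrY (var cntRoot) 0).sem ((put arrTreeRow (var cntRoot) 1).sem σ₂) with hσ₃
  have g3 : ∀ c, c ≠ arrTreeRow → c ≠ arrY → σ₃ c = σ₂ c := fun c h1 h2 => by
    simp [hσ₃, h1, h2]
  have hrt3 : σ₃ arrTreeRow = Function.update (σ₂ arrTreeRow) i 1 := by
    simp [hσ₃, g2, hi]
  have hy3 : σ₃ arrY = Function.update (σ arrY) i 0 := by
    simp [hσ₃, g2, hi]
  have key := sem_loop (σ := σ₃) (a := cntCol) (b := numCols) (n := q)
    (P := ite (.get arrW (var cntRoot * numCols + var cntCol) -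
      .get arrY (var cntRoot)) (put arrY (var cntRoot)
        (.get arrW (var cntRoot * numCols + var cntCol))) nop) rfl
    (fun k τ => ∃ v, τ arrY = Function.update (σ arrY) i v ∧ 0 ≤ v ∧
      ∀ j : ℤ, 0 ≤ j → j < k → σ arrW (i * q + j) ≤ v) (by simp [g3, g2, hq])
    ⟨0, by simpa using hy3, le_rfl, fun j h0 h1 => by push_cast at h1; omega⟩
    (by
      rintro k hk τ hτ hfr ⟨v, h1, h2, h3⟩
      have e1 : τ cntRoot 0 = i := by rw [hfr _ rfl, g3, g2, hi] <;> decide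
      have e2 : τ arrW = σ arrW := by rw [hfr _ rfl, g3, g2] <;> decide
      have e3 : τ 0 1 = q := by rw [hfr _ rfl, g3, g2, hq] <;> decide
      by_cases h : v < σ arrW (i * q + k)
      · rw [sem_ite_of_pos _ _ (by simpa [e1, e2, e3, hτ, h1] using h)]
        refine ⟨σ arrW (i * q + k), ?_, by omega, ?_⟩
        · simp [e1, e2, e3, hτ, h1]
        · intro j h4 h5
          by_cases hj : j = k
          · rw [hj]
          · have := h3 j h4 (by push_cast at h5; omega)
            omega
      · rw [sem_ite_of_not_pos _ _ (by simpa [e1, e2, e3, hτ, h1] using h)]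
        refine ⟨v, by simpa using h1, h2, ?_⟩
        intro j h4 h5
        by_cases hj : j = k
        · rw [hj]; omega
        · exact h3 j h4 (by push_cast at h5; omega))
  have f4 : ∀ c, (loop cntCol numCols (ite (.get arrW (var cntRoot * numCols + var cntCol) -
      .get arrY (var cntRoot)) (put arrY (var cntRoot)
        (.get arrW (var cntRoot * numCols + var cntCol))) nop)).writes c = false →
        sem _ σ₃ c = σ₃ c := fun c h => sem_frame _ h σ₃
  set σ₄ := (loop cntCol numCols (ite (.get arrW (var cntRoot * numCols + var cntCol) -
      .get arrY (var cntRoot)) (put arrY (var cntRoot)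
        (.get arrW (var cntRoot * numCols + var cntCol))) nop)).sem σ₃ with hσ₄
  obtain ⟨v, hv, hv0, hvw⟩ := key
  have hM' := hM.init (v := v) (fun j h0 h1 => by
    rw [paddedWeight]
    split_ifs with hjq
    exacts [hvw j h0 hjq, hv0])
  right
  refine ⟨by simp, ?_, ?_⟩
  · simpa [hv, f4, writes, g3, g2] using hM'
  · refine Tree.init (e := -1) (k := i + 1) ?_ ?_ ?_ hi0 hip ?_
    · simpa [hv, f4, writes, g3, g2] using hM'
    · intro r h0 h1 hr
      simp [f4, writes, hrt3, hr, hrt r h0 h1]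
    · simp [f4, writes, hrt3]
    · intro j h0 h1
      simpa [f4, writes, g3] using hct j h0 h1

theorem matchRow_spec (hp : σ 0 0 = p) (hq : σ 0 1 = q) {i : ℤ} (hi : σ cntRoot 0 = i)
    (hi0 : 0 ≤ i) (hip : i < p)
    (hM : Matched (p + q) i i (-1) (paddedWeight q (σ arrW)) (σ arrY) (σ arrZ)
      (σ arrMateRow) (σ arrMateCol)) :
    Matched (p + q) (i + 1) (i + 1) (-1) (paddedWeight q (σ arrW)) (matchRow.sem σ arrY)
      (matchRow.sem σ arrZ) (matchRow.sem σ arrMateRow) (matchRow.sem σ arrMateCol) := by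
  have h0 := initTree_spec hp hq hi hi0 hip hM
  have f1 : ∀ c, initTree.writes c = false → initTree.sem σ c = σ c := fun c h => sem_frame _ h σ
  rw [matchRow, sem_seq]
  set σ₁ := initTree.sem σ with hσ₁
  have key := sem_loop (σ := σ₁) (a := cntStage) (b := allCols) (n := p + q)
    (P := ite (1 - var varDone) growTree nop) rfl
    (fun k τ => Searching p q i k (paddedWeight q (σ arrW)) τ)
    (by simp [f1 0 rfl, hp, hq])
    (by simpa [Searching] using h0)
    (by
      intro k hk τ hτ hfr hI
      have e1 : τ cntRoot 0 = i := by rw [hfr _ rfl, f1 _ rfl, hi]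
      have e2 : τ arrW = σ arrW := by rw [hfr _ rfl, f1 _ rfl]
      have e3 : τ 0 1 = q := by rw [hfr _ rfl, f1 _ rfl, hq]
      have e4 : τ 0 0 = p := by rw [hfr _ rfl, f1 _ rfl, hp]
      rcases hI with ⟨hd, hI⟩ | ⟨hd, hI1, hI2⟩
      · rw [sem_ite_of_not_pos _ _ (by simp; omega)]
        left
        exact ⟨by simpa using hd, by simpa using hI⟩
      · rw [sem_ite_of_pos _ _ (by simp [hd])]
        rw [← e2] at hI1 hI2
        have := growTree_spec e4 e3 hk hτ e1 hi0 hip hd hI1 hI2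
        rw [e2] at this
        simpa [Searching] using this)
  rcases key with ⟨-, h⟩ | ⟨-, h1, h2⟩
  · exact h
  · have := h2.le h1 hi0 (by omega)
    push_cast at this
    omega

theorem maxWeightMatching_spec (hp : σ 0 0 = p) (hq : σ 0 1 = q) :
    Matched (p + q) p p (-1) (paddedWeight q (σ arrW)) (maxWeightMatching.sem σ arrY)
      (maxWeightMatching.sem σ arrZ) (maxWeightMatching.sem σ arrMateRow)
      (maxWeightMatching.sem σ arrMateCol) := by
  rw [maxWeightMatching, sem_seq]
  set L := loop cntCol allCols (put arrZ (var cntCol) 0 ;; put arrMateCol (var cntCol) 0) with hL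
  have f1 : ∀ c, L.writes c = false → L.sem σ c = σ c := fun c h => sem_frame _ h σ
  have hz : ∀ j : ℤ, 0 ≤ j → j < p + q → L.sem σ arrZ j = 0 := by
    intro j h0 h1
    rw [hL, sem_loop_map (n := p + q) (by decide) rfl (by simp [hp, hq]) (fun _ => 0),
      if_pos ⟨h0, by push_cast; omega⟩]
    intro k _ τ hτ _ _
    simp [hτ]
  have hmc : ∀ j : ℤ, 0 ≤ j → j < p + q → L.sem σ arrMateCol j = 0 := by
    intro j h0 h1
    rw [hL, sem_loop_map (n := p + q) (by decide) rfl (by simp [hp, hq]) (fun _ => 0),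
      if_pos ⟨h0, by push_cast; omega⟩]
    intro k _ τ hτ _ _
    simp [hτ]
  set σ₁ := L.sem σ with hσ₁
  exact sem_loop (σ := σ₁) (a := cntRoot) (b := numRows) (n := p) (P := matchRow) rfl
    (fun k τ => Matched (p + q) k k (-1) (paddedWeight q (σ arrW)) (τ arrY) (τ arrZ)
      (τ arrMateRow) (τ arrMateCol)) (by simp [f1 0 rfl, hp])
    (by
      refine ⟨fun r h0 h1 => by push_cast at h1; omega, fun j h0 h1 h2 => ?_,
        fun r j h0 h1 => by push_cast at h1; omega, fun j h0 h1 => ?_, fun j h0 h1 _ _ => ?_⟩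
      · exact absurd (by simpa using hmc j h0 h1) h2
      · simp [hz j h0 h1]
      · simp [hz j h0 h1])
    (by
      intro k hk τ hτ hfr hI
      have e2 : τ arrW = σ arrW := by rw [hfr _ rfl, f1 _ rfl]
      rw [← e2] at hI ⊢
      have := matchRow_spec (by rw [hfr _ rfl, f1 _ rfl, hp]) (by rw [hfr _ rfl, f1 _ rfl, hq]) hτ
        (by omega) (by omega) hI
      simpa using this)

end LoopProg

end RAM

/-! ## Enumerating the breakpoints of the agent's utility -/

namespace MatchingInstance

variable {V U : Type*} {I : MatchingInstance V U ℝ} {R : Finset ℝ}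
  {α β γ f₀ c₀ fα : ℝ} {M N : Finset (V × U)}

/-- The reward of the agent's best response under the contract `α`. -/
noncomputable def slope (I : MatchingInstance V U ℝ) (α : ℝ) : ℝ :=
  ∑ e ∈ (I.exists_isFavored α).choose, I.reward e

theorem IsFavored.sum_eq (hM : I.IsFavored α M) : ∑ e ∈ M, I.reward e = I.slope α :=
  le_antisymm (hM.reward_mono (I.exists_isFavored α).choose_spec le_rfl)
    ((I.exists_isFavored α).choose_spec.reward_mono hM le_rfl)

theorem slope_mono (I : MatchingInstance V U ℝ) (h : α ≤ β) : I.slope α ≤ I.slope β :=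
  (I.exists_isFavored α).choose_spec.reward_mono (I.exists_isFavored β).choose_spec h

/-- The maximum utility of the agent under the contract `α`. -/
noncomputable def maxUtility (I : MatchingInstance V U ℝ) (α : ℝ) : ℝ :=
  α * I.slope α - I.setCost (I.exists_isFavored α).choose

theorem IsFavored.setCost_eq_sub (hM : I.IsFavored α M) :
    I.setCost M = α * I.slope α - I.maxUtility α := by
  have := hM.setCost_eq (I.exists_isFavored α).choose_spec hM.sum_eq
  rw [this, maxUtility]
  ring

theorem utility_le_maxUtility (hN : N ⊆ I.edges) (hN' : IsBipartiteMatching N) :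
    α * ∑ e ∈ N, I.reward e - I.setCost N ≤ I.maxUtility α :=
  (I.exists_isFavored α).choose_spec.utility_le N hN hN'

/-- The maximum utility is at least that of the best response under another contract. -/
theorem maxUtility_add_le (I : MatchingInstance V U ℝ) (α β : ℝ) :
    I.maxUtility α + (β - α) * I.slope α ≤ I.maxUtility β := by
  obtain ⟨M, hM⟩ := I.exists_isFavored α
  have := utility_le_maxUtility (α := β) hM.subset hM.matching
  rw [hM.sum_eq, hM.setCost_eq_sub] at this
  linarith

theorem slope_le_of_touch (I : MatchingInstance V U ℝ)
    (h : I.maxUtility β ≤ I.maxUtility α + (β - α) * I.slope α) : I.slope α ≤ I.slope β := by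
  obtain ⟨M, hM⟩ := I.exists_isFavored α
  obtain ⟨N, hN⟩ := I.exists_isFavored β
  rw [← hM.sum_eq, ← hN.sum_eq]
  refine hN.reward_le M hM.subset hM.matching (le_antisymm ?_ ?_)
  · exact hN.utility_le M hM.subset hM.matching
  · rw [hN.setCost_eq_sub, hM.setCost_eq_sub, hN.sum_eq, hM.sum_eq]
    linarith

/-- The state of the enumeration: a line `x ↦ x f₀ - c₀` that is part of the maximum utility, a
contract `β` to the right of its part, and the best contract `α` so far, with a lower
bound `fα` for its reward. -/
structure Enumeration (I : MatchingInstance V U ℝ) (f₀ c₀ β α fα : ℝ) : Prop where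
  line : ∃ M ⊆ I.edges, IsBipartiteMatching M ∧ ∑ e ∈ M, I.reward e = f₀ ∧ I.setCost M = c₀
  nonneg : 0 ≤ β
  le_one : β ≤ 1
  touch : ∃ x, 0 ≤ x ∧ x ≤ β ∧ x * f₀ - c₀ = I.maxUtility x
  best_nonneg : 0 ≤ α
  best_le_one : α ≤ 1
  best : fα ≤ I.slope α
  covers : ∀ γ, 0 ≤ γ → γ ≤ 1 → I.slope γ ≤ f₀ → (1 - γ) * I.slope γ ≤ (1 - α) * fα

open Classical in
/-- A bound for the number of steps that remain. -/
noncomputable def remaining (I : MatchingInstance V U ℝ) (R : Finset ℝ) (f₀ c₀ β : ℝ) : ℕ :=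
  (R.filter (f₀ < ·)).card * (R.card + 2) + (R.filter (· ≤ I.slope β)).card +
    if β * f₀ - c₀ < I.maxUtility β then 1 else 0

/-- Either the enumeration is finished, or at most `n` steps remain. -/
def StepsLeft (I : MatchingInstance V U ℝ) (R : Finset ℝ) (f₀ c₀ β : ℝ) (n : ℕ) : Prop :=
  (β = 1 ∧ I.slope 1 ≤ f₀) ∨ (f₀ < I.slope β ∧ I.remaining R f₀ c₀ β ≤ n)

theorem remaining_le (I : MatchingInstance V U ℝ) (R : Finset ℝ) (f₀ c₀ β : ℝ) :
    I.remaining R f₀ c₀ β ≤ (R.card + 2) ^ 2 := by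
  have h1 := Finset.card_filter_le R (f₀ < ·)
  have h2 := Finset.card_filter_le R (· ≤ I.slope β)
  rw [remaining]
  have h3 := Nat.mul_le_mul_right (R.card + 2) h1
  have h4 : (R.card + 2) ^ 2 = R.card * (R.card + 2) + 2 * R.card + 4 := by ring
  split_ifs <;> omega

theorem Enumeration.maxUtility_ge (h : I.Enumeration f₀ c₀ β α fα) (x : ℝ) :
    x * f₀ - c₀ ≤ I.maxUtility x := by
  obtain ⟨M, h1, h2, rfl, rfl⟩ := h.line
  exact utility_le_maxUtility h1 h2

/-- A line that is below the maximum utility at `β` leaves it before. -/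
theorem Enumeration.lt_slope (h : I.Enumeration f₀ c₀ β α fα)
    (hlt : β * f₀ - c₀ < I.maxUtility β) : f₀ < I.slope β := by
  obtain ⟨x, hx0, hxβ, hx⟩ := h.touch
  have h1 := I.maxUtility_add_le β x
  have h2 : x < β := by
    rcases hxβ.lt_or_eq with h | rfl
    · exact h
    · linarith
  by_contra hcon
  nlinarith

theorem Enumeration.newton (h : I.Enumeration f₀ c₀ β α fα) {n : ℕ}
    (hR : ∀ γ, 0 ≤ γ → I.slope γ ∈ R) (hn : I.StepsLeft R f₀ c₀ β (n + 1))
    (hM : I.IsFavored β M) (hlt : β * f₀ - c₀ < I.maxUtility β) :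
    0 < ∑ e ∈ M, I.reward e - f₀ ∧
      I.Enumeration f₀ c₀ ((I.setCost M - c₀) / (∑ e ∈ M, I.reward e - f₀)) α fα ∧
      I.StepsLeft R f₀ c₀ ((I.setCost M - c₀) / (∑ e ∈ M, I.reward e - f₀)) n := by
  classical
  have hs := h.lt_slope hlt
  obtain ⟨x, hx0, hxβ, hx⟩ := h.touch
  rw [hM.sum_eq, hM.setCost_eq_sub]
  have hd : 0 < I.slope β - f₀ := by linarith
  set β' := (β * I.slope β - I.maxUtility β - c₀) / (I.slope β - f₀) with hβ'
  have e1 : β' * (I.slope β - f₀) = β * I.slope β - I.maxUtility β - c₀ := div_mul_cancel₀ _ hd.ne'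
  have hlt' : β' < β := by
    rw [hβ', div_lt_iff₀ hd]
    linarith
  have hx' : x ≤ β' := by
    rw [hβ', le_div_iff₀ hd]
    have := I.maxUtility_add_le β x
    linarith
  have hmeet : β' * f₀ - c₀ = I.maxUtility β + (β' - β) * I.slope β := by linarith
  have hge := I.maxUtility_add_le β β'
  have hE : I.Enumeration f₀ c₀ β' α fα :=
    { h with
      nonneg := hx0.trans hx'
      le_one := hlt'.le.trans h.le_one
      touch := ⟨x, hx0, hx', hx⟩ }
  refine ⟨hd, hE, Or.inr ?_⟩
  rcases hn with ⟨rfl, hn⟩ | ⟨-, hn⟩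
  · linarith
  have hmono := I.slope_mono hlt'.le
  have hback := I.maxUtility_add_le β' β
  rw [remaining, if_pos hlt] at hn
  rcases hmono.lt_or_eq with hr | hr
  · constructor
    · by_cases h' : β' * f₀ - c₀ < I.maxUtility β'
      · exact hE.lt_slope h'
      · have := I.slope_le_of_touch (α := β) (β := β') (by linarith)
        linarith
    · have : (R.filter (· ≤ I.slope β')).card < (R.filter (· ≤ I.slope β)).card := by
        refine Finset.card_lt_card (Finset.ssubset_iff_of_subset ?_ |>.2 ⟨I.slope β, ?_, ?_⟩)
        · intro s hs
          rw [Finset.mem_filter] at hs ⊢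
          exact ⟨hs.1, hs.2.trans hmono⟩
        · exact Finset.mem_filter.2 ⟨hR β h.nonneg, le_rfl⟩
        · simp [hr]
      rw [remaining]
      split_ifs <;> omega
  · refine ⟨by rw [hr]; exact hs, ?_⟩
    rw [remaining, hr, if_neg (by rw [hr] at hback; nlinarith)]
    omega

open Classical in
theorem Enumeration.breakpoint (h : I.Enumeration f₀ c₀ β α fα) {n : ℕ}
    (hR : ∀ γ, 0 ≤ γ → I.slope γ ∈ R) (hn : I.StepsLeft R f₀ c₀ β (n + 1))
    (hM : I.IsFavored β M) (hlt : ¬ β * f₀ - c₀ < I.maxUtility β) {α' fα' : ℝ}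
    (hα' : (1 - α) * fα < (1 - β) * ∑ e ∈ M, I.reward e ∧ α' = β ∧ fα' = ∑ e ∈ M, I.reward e ∨
      ¬ (1 - α) * fα < (1 - β) * ∑ e ∈ M, I.reward e ∧ α' = α ∧ fα' = fα) :
    I.Enumeration (∑ e ∈ M, I.reward e) (I.setCost M) 1 α' fα' ∧
      I.StepsLeft R (∑ e ∈ M, I.reward e) (I.setCost M) 1 n := by
  have hline := h.maxUtility_ge
  have hcost := hM.setCost_eq_sub
  have hsum := hM.sum_eq
  have hbest : 0 ≤ α' ∧ α' ≤ 1 ∧ fα' ≤ I.slope α' ∧ (1 - α) * fα ≤ (1 - α') * fα' ∧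
      (1 - β) * I.slope β ≤ (1 - α') * fα' := by
    rw [hsum] at hα'
    rcases hα' with ⟨h1, rfl, rfl⟩ | ⟨h1, rfl, rfl⟩
    · exact ⟨h.nonneg, h.le_one, le_rfl, h1.le, le_rfl⟩
    · exact ⟨h.best_nonneg, h.best_le_one, h.best, le_rfl, not_lt.1 h1⟩
  obtain ⟨b1, b2, b3, b4, b5⟩ := hbest
  constructor
  · refine ⟨⟨M, hM.subset, hM.matching, rfl, rfl⟩, zero_le_one, le_rfl,
      ⟨β, h.nonneg, h.le_one, ?_⟩, b1, b2, b3, ?_⟩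
    · rw [hsum, hcost]; ring
    · intro γ h0 h1 hγ
      rw [hsum] at hγ
      by_cases hγ0 : I.slope γ ≤ f₀
      · exact (h.covers γ h0 h1 hγ0).trans b4
      · have hβγ : β ≤ γ := by
          by_contra hcon
          have h3 := I.maxUtility_add_le γ β
          have h4 := hline γ
          nlinarith
        have hpos : 0 ≤ I.slope γ := by
          obtain ⟨N, hN⟩ := I.exists_isFavored γ
          rw [← hN.sum_eq]
          exact Finset.sum_nonneg fun e he => I.reward_nonneg e (hN.subset he)
        refine le_trans ?_ b5
        nlinarith
  · rcases hn with ⟨rfl, hn⟩ | ⟨hlt', hn⟩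
    · left
      exact ⟨rfl, hsum.ge⟩
    · by_cases hfin : I.slope 1 ≤ ∑ e ∈ M, I.reward e
      · exact Or.inl ⟨rfl, hfin⟩
      · refine Or.inr ⟨not_le.1 hfin, ?_⟩
        rw [hsum]
        have h1 : (R.filter (I.slope β < ·)).card < (R.filter (f₀ < ·)).card := by
          refine Finset.card_lt_card (Finset.ssubset_iff_of_subset ?_ |>.2 ⟨I.slope β, ?_, ?_⟩)
          · intro s hs
            rw [Finset.mem_filter] at hs ⊢
            exact ⟨hs.1, hlt'.trans hs.2⟩
          · exact Finset.mem_filter.2 ⟨hR β h.nonneg, hlt'⟩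
          · simp
        have h2 := Finset.card_filter_le R (· ≤ I.slope 1)
        rw [remaining] at hn ⊢
        have h3 := Nat.mul_le_mul_right (R.card + 2) (Nat.succ_le_of_lt h1)
        rw [Nat.succ_mul] at h3
        split_ifs at hn ⊢ <;> omega

theorem Enumeration.isOptimalContract (h : I.Enumeration f₀ c₀ β α fα)
    (hn : I.StepsLeft R f₀ c₀ β 0) (hR : ∀ γ, 0 ≤ γ → I.slope γ ∈ R) (τ : TieBreaking (V × U)) :
    I.IsOptimalContract τ α := by
  classical
  rcases hn with ⟨rfl, hn⟩ | ⟨hlt, hn⟩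
  · refine ⟨⟨h.best_nonneg, h.best_le_one⟩, fun γ hγ => ?_⟩
    obtain ⟨M, hM⟩ := I.exists_isFavored γ
    obtain ⟨N, hN⟩ := I.exists_isFavored α
    rw [hM.principalUtility_eq, hN.principalUtility_eq, hM.sum_eq, hN.sum_eq]
    refine (h.covers γ hγ.1 hγ.2 ((I.slope_mono hγ.2).trans hn)).trans ?_
    exact mul_le_mul_of_nonneg_left h.best (sub_nonneg.2 h.best_le_one)
  · rw [remaining] at hn
    have : 0 < (R.filter (f₀ < ·)).card :=
      Finset.card_pos.2 ⟨_, Finset.mem_filter.2 ⟨hR β h.nonneg, hlt⟩⟩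
    have := Nat.mul_pos this (show 0 < R.card + 2 by omega)
    omega

/-- The enumeration starts with the empty matching. -/
theorem enumeration_init (I : MatchingInstance V U ℝ) : I.Enumeration 0 0 1 0 0 := by
  have hpos : ∀ γ, 0 ≤ I.slope γ := fun γ => by
    obtain ⟨N, hN⟩ := I.exists_isFavored γ
    rw [← hN.sum_eq]
    exact Finset.sum_nonneg fun e he => I.reward_nonneg e (hN.subset he)
  refine ⟨⟨∅, by simp, isBipartiteMatching_empty, by simp, by simp [setCost]⟩, zero_le_one, le_rfl,
    ⟨0, le_rfl, zero_le_one, ?_⟩, le_rfl, zero_le_one, hpos 0, fun γ _ _ h => ?_⟩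
  · have h1 := utility_le_maxUtility (I := I) (α := 0) (Finset.empty_subset _)
      isBipartiteMatching_empty
    obtain ⟨N, hN⟩ := I.exists_isFavored 0
    have h2 := hN.setCost_eq_sub
    have h3 : 0 ≤ I.setCost N := Finset.sum_nonneg fun e he => I.cost_nonneg e (hN.subset he)
    simp [setCost] at h1
    linarith
  · rw [le_antisymm h (hpos γ)]
    simp

theorem stepsLeft_init (I : MatchingInstance V U ℝ) (R : Finset ℝ) :
    I.StepsLeft R 0 0 1 ((R.card + 2) ^ 2) := by
  by_cases h : I.slope 1 ≤ 0
  · exact Or.inl ⟨rfl, h⟩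
  · exact Or.inr ⟨not_le.1 h, I.remaining_le R 0 0 1⟩

theorem StepsLeft.mono {n m : ℕ} {β : ℝ} (h : I.StepsLeft R f₀ c₀ β n) (hnm : n ≤ m) :
    I.StepsLeft R f₀ c₀ β m :=
  h.imp_right fun h => ⟨h.1, h.2.trans hnm⟩

end MatchingInstance

/-! ## The certificate of optimality -/

namespace Hungarian

open RAM.LoopProg

variable {p q : ℕ} {w y z mr mc : ℤ → ℤ}

/-- The index of a pair in the row by row order. -/
def pairIndex (e : Fin p × Fin q) : ℤ := (e.1 : ℤ) * q + e.2

/-- The pairs of positive weight that are matched. -/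
def selected (p q : ℕ) (w mr : ℤ → ℤ) : Finset (Fin p × Fin q) :=
  Finset.univ.filter fun e => mr e.1 = e.2 ∧ 0 < w (pairIndex e)

theorem sum_selected (hm : ∀ r : ℤ, 0 ≤ r → r < p → 0 ≤ mr r) (g : ℤ → ℤ) :
    ∑ e ∈ selected p q w mr, g (pairIndex e) = ∑ r ∈ Finset.range p,
      if mr r < q ∧ 0 < w (r * q + mr r) then g (r * q + mr r) else 0 := by
  rw [selected, Finset.sum_filter, Fintype.sum_prod_type, Finset.sum_range]
  refine Finset.sum_congr rfl fun v _ => ?_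
  have hv := hm v (by positivity) (by exact_mod_cast v.2)
  by_cases h : mr v < q
  · have hu : (((mr v).toNat : ℕ) : ℤ) = mr v := Int.toNat_of_nonneg hv
    rw [Finset.sum_eq_single ⟨(mr v).toNat, by omega⟩]
    · simp only [pairIndex, hu, true_and, h]
    · intro u _ hne
      rw [if_neg]
      rintro ⟨h1, -⟩
      exact hne (Fin.ext (by simp [h1]))
    · simp
  · rw [if_neg (by tauto)]
    refine Finset.sum_eq_zero fun u _ => if_neg ?_
    rintro ⟨h1, -⟩
    have := u.2
    simp only at h1
    omega

theorem isBipartiteMatching_selected {m i k e : ℤ} {wt : ℤ → ℤ → ℤ}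
    (h : Matched m i k e wt y z mr mc) (hi : (p : ℤ) ≤ i) :
    IsBipartiteMatching (selected p q w mr) := by
  intro a ha b hb hab
  simp only [selected, Finset.mem_filter, Finset.mem_univ, true_and] at ha hb
  have h1 := (h.row a.1 (by positivity) (by have := a.1.2; omega)).2.2.1
  have h2 := (h.row b.1 (by positivity) (by have := b.1.2; omega)).2.2.1
  rcases hab with hab | hab
  · refine Prod.ext hab (Fin.ext ?_)
    have := ha.1.symm.trans ((congrArg (fun x : Fin p => mr x) hab).trans hb.1)
    exact_mod_cast this
  · refine Prod.ext (Fin.ext ?_) hab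
    rw [ha.1] at h1
    rw [hb.1] at h2
    rw [hab] at h1
    omega

/-- The matched pairs of positive weight form a matching of maximum weight. -/
theorem sum_le_sum_selected (hq : 0 < q) (hw : ∀ k : ℤ, 0 ≤ k → k < p * q → 0 ≤ w k)
    (h : Matched (p + q) p p (-1) (paddedWeight q w) y z mr mc) {N : Finset (Fin p × Fin q)}
    (hN : IsBipartiteMatching N) :
    ∑ e ∈ N, w (pairIndex e) ≤ ∑ e ∈ selected p q w mr, w (pairIndex e) := by
  classical
  have hidx : ∀ r j : ℤ, 0 ≤ r → r < p → 0 ≤ j → j < q → 0 ≤ r * q + j ∧ r * q + j < p * q := by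
    intro r j h1 h2 h3 h4
    constructor
    · positivity
    · nlinarith
  have hwt : ∀ r j : ℤ, 0 ≤ r → r < p → 0 ≤ j → 0 ≤ paddedWeight q w r j := by
    intro r j h1 h2 h3
    rw [paddedWeight]
    split_ifs with h4
    · obtain ⟨h5, h6⟩ := hidx r j h1 h2 h3 h4
      exact hw _ h5 h6
    · exact le_rfl
  have hy : ∀ r : ℤ, 0 ≤ r → r < p → 0 ≤ y r := by
    intro r h1 h2
    obtain ⟨j, j1, j2, j3⟩ := h.exists_free (by positivity) (by omega)
    have h3 := h.feasible r j h1 h2 j1 j2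
    rw [h.price_free j j1 j2 j3 (by omega)] at h3
    have := hwt r j h1 h2 j1
    omega
  have h1 : ∑ e ∈ N, w (pairIndex e) ≤ ∑ e ∈ N, (y e.1 + z e.2) := by
    refine Finset.sum_le_sum fun e _ => ?_
    have h1 := e.1.2
    have h2 := e.2.2
    have := h.feasible e.1 e.2 (by positivity) (by omega) (by positivity) (by omega)
    rwa [paddedWeight, if_pos (by omega)] at this
  have h2 : ∑ e ∈ N, y e.1 ≤ ∑ r ∈ Finset.range p, y r := by
    rw [← Finset.sum_image (s := N) (g := fun e => (e.1 : ℕ)) (f := fun r : ℕ => y r)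
      (fun a ha b hb hab => hN a ha b hb (Or.inl (Fin.ext hab)))]
    refine Finset.sum_le_sum_of_subset_of_nonneg ?_ ?_
    · intro r hr
      obtain ⟨e, -, rfl⟩ := Finset.mem_image.1 hr
      exact Finset.mem_range.2 e.1.2
    · intro r hr _
      rw [Finset.mem_range] at hr
      exact hy r (by positivity) (by omega)
  have h3 : ∑ e ∈ N, z e.2 ≤ ∑ r ∈ Finset.range p, z (mr r) := by
    have hinj : Set.InjOn (fun r : ℕ => mr r) (Finset.range p : Set ℕ) := by
      intro a ha b hb hab
      simp only [Finset.coe_range, Set.mem_Iio] at ha hb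
      have h1 := (h.row a (by positivity) (by omega)).2.2.1
      have h2 := (h.row b (by positivity) (by omega)).2.2.1
      simp only at hab
      rw [hab] at h1
      omega
    rw [← Finset.sum_image (s := N) (g := fun e => (e.2 : ℤ)) (f := z)
      (fun a ha b hb hab => hN a ha b hb (Or.inr (Fin.ext (by simpa using hab)))),
      ← Finset.sum_image (s := Finset.range p) (g := fun r : ℕ => mr r) (f := z) hinj]
    have hrange : ∀ j ∈ N.image fun e => (e.2 : ℤ), 0 ≤ j ∧ j < p + q := by
      intro j hj
      obtain ⟨e, -, rfl⟩ := Finset.mem_image.1 hj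
      have := e.2.2
      omega
    rw [← Finset.sum_filter_ne_zero]
    refine Finset.sum_le_sum_of_subset_of_nonneg ?_ ?_
    · intro j hj
      rw [Finset.mem_filter] at hj
      obtain ⟨j0, j1⟩ := hrange j hj.1
      have hmc : mc j ≠ 0 := fun h0 => hj.2 (h.price_free j j0 j1 h0 (by omega))
      obtain ⟨c1, c2, c3⟩ := h.col j j0 j1 hmc
      refine Finset.mem_image.2 ⟨(mc j - 1).toNat, Finset.mem_range.2 (by omega), ?_⟩
      rw [Int.toNat_of_nonneg (by omega), c3]
    · intro j hj _
      obtain ⟨r, hr, rfl⟩ := Finset.mem_image.1 hj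
      rw [Finset.mem_range] at hr
      obtain ⟨g1, g2, -⟩ := h.row r (by positivity) (by omega)
      exact h.price_nonneg _ g1 g2
  have h4 : ∑ r ∈ Finset.range p, (y r + z (mr r)) =
      ∑ e ∈ selected p q w mr, w (pairIndex e) := by
    rw [sum_selected fun r h1 h2 => (h.row r h1 h2).1]
    refine Finset.sum_congr rfl fun r hr => ?_
    rw [Finset.mem_range] at hr
    obtain ⟨g1, g2, -, g3⟩ := h.row r (by positivity) (by omega)
    rw [g3]
    have := hwt r (mr r) (by positivity) (by omega) g1
    rw [paddedWeight] at this ⊢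
    split_ifs at this ⊢ with c1 c2 c2 <;> first | rfl | omega
  rw [Finset.sum_add_distrib] at h1 h4
  omega

end Hungarian

/-! ## Integer data -/

namespace MatchingInstance

open Hungarian RAM.LoopProg

variable {p q : ℕ} {I : MatchingInstance (Fin p) (Fin q) ℚ} {D K : ℤ} {F C : ℤ → ℤ}

theorem sum_pairIndex (F : ℤ → ℤ) :
    ∑ e : Fin p × Fin q, F (pairIndex e) = ∑ k ∈ Finset.range (p * q), F k := by
  rw [Finset.sum_range]
  refine Fintype.sum_equiv finProdFinEquiv _ _ fun e => ?_
  simp only [finProdFinEquiv_apply_val, pairIndex]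
  congr 1
  push_cast
  ring

theorem pairIndex_nonneg (e : Fin p × Fin q) : 0 ≤ pairIndex e := by
  rw [pairIndex]; positivity

theorem pairIndex_lt (e : Fin p × Fin q) : pairIndex e < p * q := by
  have h := (finProdFinEquiv e).2
  simp only [finProdFinEquiv_apply_val] at h
  rw [pairIndex]
  zify at h
  linarith

/-- The rewards and costs multiplied by the common denominator `D`, with a bound `K` for the
reward of any set. -/
structure Scaled (I : MatchingInstance (Fin p) (Fin q) ℚ) (D K : ℤ) (F C : ℤ → ℤ) : Prop where
  pos : 0 < D
  reward : ∀ e ∈ I.edges, (F (pairIndex e) : ℝ) = D * I.toReal.reward e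
  cost : ∀ e ∈ I.edges, (C (pairIndex e) : ℝ) = D * I.toReal.cost e
  reward_off : ∀ e ∉ I.edges, F (pairIndex e) = 0
  cost_off : ∀ e ∉ I.edges, C (pairIndex e) = 0
  bound : K = 1 + ∑ k ∈ Finset.range (p * q), F k

variable {N : Finset (Fin p × Fin q)}

namespace Scaled

theorem reward_nonneg (h : I.Scaled D K F C) (e : Fin p × Fin q) : 0 ≤ F (pairIndex e) := by
  by_cases he : e ∈ I.edges
  · have h1 := h.reward e he
    have h2 := I.toReal.reward_nonneg e he
    have h3 : (0 : ℝ) < D := by exact_mod_cast h.pos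
    have : (0 : ℝ) ≤ F (pairIndex e) := by rw [h1]; positivity
    exact_mod_cast this
  · exact (h.reward_off e he).ge

theorem sum_reward_nonneg (h : I.Scaled D K F C) (N : Finset (Fin p × Fin q)) : 0 ≤ ∑ e ∈ N, F (pairIndex e) :=
  Finset.sum_nonneg fun e _ => h.reward_nonneg e

theorem sum_reward_lt (h : I.Scaled D K F C) (N : Finset (Fin p × Fin q)) : ∑ e ∈ N, F (pairIndex e) < K := by
  have h1 : ∑ e ∈ N, F (pairIndex e) ≤ ∑ e, F (pairIndex e) :=
    Finset.sum_le_sum_of_subset_of_nonneg (Finset.subset_univ _) fun e _ _ => h.reward_nonneg e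
  rw [sum_pairIndex] at h1
  rw [h.bound]
  omega

theorem sum_reward (h : I.Scaled D K F C) (hN : N ⊆ I.edges) :
    ((∑ e ∈ N, F (pairIndex e) : ℤ) : ℝ) = D * ∑ e ∈ N, I.toReal.reward e := by
  rw [Finset.mul_sum]
  push_cast
  exact Finset.sum_congr rfl fun e he => h.reward e (hN he)

theorem sum_cost (h : I.Scaled D K F C) (hN : N ⊆ I.edges) :
    ((∑ e ∈ N, C (pairIndex e) : ℤ) : ℝ) = D * I.toReal.setCost N := by
  rw [setCost, Finset.mul_sum]
  push_cast
  exact Finset.sum_congr rfl fun e he => h.cost e (hN he)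

/-- The agent's best response is given by a matching of maximum weight, for weights that combine
the utility and, with lower priority, the reward. -/
theorem isFavored_selected (h : I.Scaled D K F C) {n d : ℤ}
    {w y z mr mc : ℤ → ℤ} (hd : 0 < d) (hq : 0 < q)
    (hw : ∀ k : ℤ, 0 ≤ k → k < p * q → w k = max 0 (K * (n * F k - d * C k) + F k))
    (hM : Matched (p + q) p p (-1) (paddedWeight q w) y z mr mc) :
    I.toReal.IsFavored (n / d : ℝ) (selected p q w mr) := by
  set M := selected p q w mr with hMdef
  have hw' : ∀ e : Fin p × Fin q, w (pairIndex e) =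
      max 0 (K * (n * F (pairIndex e) - d * C (pairIndex e)) + F (pairIndex e)) :=
    fun e => hw _ (pairIndex_nonneg e) (pairIndex_lt e)
  have hsub : M ⊆ I.edges := by
    intro e he
    by_contra hcon
    simp only [hMdef, selected, Finset.mem_filter] at he
    have := hw' e
    rw [h.reward_off e hcon, h.cost_off e hcon] at this
    simp at this
    omega
  have hmatch : IsBipartiteMatching M := isBipartiteMatching_selected hM le_rfl
  have hval : ∀ N : Finset (Fin p × Fin q),
      ∑ e ∈ N, (K * (n * F (pairIndex e) - d * C (pairIndex e)) + F (pairIndex e)) =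
      K * (n * ∑ e ∈ N, F (pairIndex e) - d * ∑ e ∈ N, C (pairIndex e)) +
        ∑ e ∈ N, F (pairIndex e) := by
    intro N
    simp only [Finset.sum_add_distrib, Finset.mul_sum, ← Finset.sum_sub_distrib]
  have hle : ∀ N : Finset (Fin p × Fin q), IsBipartiteMatching N →
      K * (n * ∑ e ∈ N, F (pairIndex e) - d * ∑ e ∈ N, C (pairIndex e)) +
        ∑ e ∈ N, F (pairIndex e) ≤
      K * (n * ∑ e ∈ M, F (pairIndex e) - d * ∑ e ∈ M, C (pairIndex e)) +
        ∑ e ∈ M, F (pairIndex e) := by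
    intro N hN
    rw [← hval, ← hval]
    calc _ ≤ ∑ e ∈ N, w (pairIndex e) :=
          Finset.sum_le_sum fun e _ => by rw [hw' e]; exact le_max_right _ _
      _ ≤ ∑ e ∈ M, w (pairIndex e) := by
          refine sum_le_sum_selected hq (fun k h0 h1 => ?_) hM hN
          rw [hw k h0 h1]; exact le_max_left _ _
      _ = _ := Finset.sum_congr rfl fun e he => by
          simp only [hMdef, selected, Finset.mem_filter] at he
          have := hw' e
          rcases max_choice 0 (K * (n * F (pairIndex e) - d * C (pairIndex e)) + F (pairIndex e))
            with h1 | h1 <;> omega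
  have hlex : ∀ N : Finset (Fin p × Fin q), IsBipartiteMatching N →
      n * ∑ e ∈ N, F (pairIndex e) - d * ∑ e ∈ N, C (pairIndex e) <
        n * ∑ e ∈ M, F (pairIndex e) - d * ∑ e ∈ M, C (pairIndex e) ∨
      n * ∑ e ∈ N, F (pairIndex e) - d * ∑ e ∈ N, C (pairIndex e) =
        n * ∑ e ∈ M, F (pairIndex e) - d * ∑ e ∈ M, C (pairIndex e) ∧
      ∑ e ∈ N, F (pairIndex e) ≤ ∑ e ∈ M, F (pairIndex e) := by
    intro N hN
    have h1 := hle N hN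
    have h2 := h.sum_reward_nonneg N
    have h3 := h.sum_reward_lt M
    set a := n * ∑ e ∈ N, F (pairIndex e) - d * ∑ e ∈ N, C (pairIndex e)
    set b := n * ∑ e ∈ M, F (pairIndex e) - d * ∑ e ∈ M, C (pairIndex e)
    rcases lt_trichotomy a b with hab | hab | hab
    · exact Or.inl hab
    · refine Or.inr ⟨hab, ?_⟩
      rw [hab] at h1
      omega
    · have h4 := h.sum_reward_nonneg M
      have h5 : K * (b + 1) ≤ K * a := mul_le_mul_of_nonneg_left (by omega) (by omega)
      rw [mul_add_one] at h5
      omega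
  have hDpos : (0 : ℝ) < D := by exact_mod_cast h.pos
  have hdpos : (0 : ℝ) < d := by exact_mod_cast hd
  have hreal : ∀ N ⊆ I.edges, ((n * ∑ e ∈ N, F (pairIndex e) - d * ∑ e ∈ N, C (pairIndex e) : ℤ) : ℝ)
      = d * D * (n / d * ∑ e ∈ N, I.toReal.reward e - I.toReal.setCost N) := by
    intro N hN
    rw [Int.cast_sub, Int.cast_mul, Int.cast_mul, h.sum_reward hN, h.sum_cost hN]
    field_simp
  refine ⟨hsub, hmatch, fun N h1 h2 => ?_, fun N h1 h2 h3 => ?_⟩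
  · have h4 : (n * ∑ e ∈ N, F (pairIndex e) - d * ∑ e ∈ N, C (pairIndex e) : ℤ) ≤
        n * ∑ e ∈ M, F (pairIndex e) - d * ∑ e ∈ M, C (pairIndex e) := by
      rcases hlex N h2 with h | h <;> omega
    have h5 : ((n * ∑ e ∈ N, F (pairIndex e) - d * ∑ e ∈ N, C (pairIndex e) : ℤ) : ℝ) ≤
      (n * ∑ e ∈ M, F (pairIndex e) - d * ∑ e ∈ M, C (pairIndex e) : ℤ) := Int.cast_le.2 h4
    rw [hreal N h1, hreal M hsub] at h5
    exact le_of_mul_le_mul_left h5 (by positivity)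
  · have h4 : (n * ∑ e ∈ N, F (pairIndex e) - d * ∑ e ∈ N, C (pairIndex e) : ℤ) =
        n * ∑ e ∈ M, F (pairIndex e) - d * ∑ e ∈ M, C (pairIndex e) := by
      have : ((n * ∑ e ∈ N, F (pairIndex e) - d * ∑ e ∈ N, C (pairIndex e) : ℤ) : ℝ) =
        (n * ∑ e ∈ M, F (pairIndex e) - d * ∑ e ∈ M, C (pairIndex e) : ℤ) := by
        rw [hreal N h1, hreal M hsub, h3]
      exact_mod_cast this
    have h5 : ∑ e ∈ N, F (pairIndex e) ≤ ∑ e ∈ M, F (pairIndex e) := by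
      rcases hlex N h2 with h | h <;> omega
    have h6 : ((∑ e ∈ N, F (pairIndex e) : ℤ) : ℝ) ≤ (∑ e ∈ M, F (pairIndex e) : ℤ) :=
      Int.cast_le.2 h5
    rw [h.sum_reward h1, h.sum_reward hsub] at h6
    exact le_of_mul_le_mul_left h6 hDpos

end Scaled

/-! ## The encoding -/

/-- The memory has the instance in array `0`. -/
structure Stored (I : MatchingInstance (Fin p) (Fin q) ℚ) (w : ℤ → ℤ) : Prop where
  rows : w 0 = p
  cols : w 1 = q
  on : ∀ e ∈ I.edges, w (2 + 5 * pairIndex e) = 1 ∧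
    w (3 + 5 * pairIndex e) = (I.reward e).num ∧ w (4 + 5 * pairIndex e) = (I.reward e).den ∧
    w (5 + 5 * pairIndex e) = (I.cost e).num ∧ w (6 + 5 * pairIndex e) = (I.cost e).den
  off : ∀ e ∉ I.edges, w (2 + 5 * pairIndex e) = 0 ∧
    w (3 + 5 * pairIndex e) = 0 ∧ w (4 + 5 * pairIndex e) = 0 ∧
    w (5 + 5 * pairIndex e) = 0 ∧ w (6 + 5 * pairIndex e) = 0

end MatchingInstance

theorem List.getD_flatMap_of_length_eq {α β : Type*} {m : ℕ} {g : α → List β}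
    (hg : ∀ a, (g a).length = m) (l : List α) (d : β) {i c : ℕ} (hi : i < l.length) (hc : c < m) :
    (l.flatMap g).getD (i * m + c) d = (g l[i]).getD c d := by
  induction l generalizing i with
  | nil => simp at hi
  | cons a l ih =>
    rw [List.flatMap_cons]
    cases i with
    | zero =>
      rw [List.getD_append _ _ _ _ (by rw [hg]; omega)]
      simp
    | succ i =>
      rw [List.getD_append_right _ _ _ _ (by rw [hg]; nlinarith), hg]
      rw [show (i + 1) * m + c - m = i * m + c by rw [Nat.succ_mul]; omega]
      simpa using ih (by simpa using hi)

namespace MatchingInstance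

open Hungarian

variable {p q : ℕ} (I : MatchingInstance (Fin p) (Fin q) ℚ)

theorem length_encode : I.encode.length = p * (q * 5) + 2 := by
  simp [encode, List.length_flatMap, apply_ite]

theorem getD_encode (e : Fin p × Fin q) {c : ℕ} (hc : c < 5) :
    I.encode.getD (2 + c + 5 * (e.1 * q + e.2)) 0 =
      (if e ∈ I.edges then [1, (I.reward e).num, ((I.reward e).den : ℤ),
        (I.cost e).num, ((I.cost e).den : ℤ)] else [0, 0, 0, 0, 0]).getD c 0 := by
  obtain ⟨v, u⟩ := e
  have hv := v.2
  have hu := u.2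
  have hidx : 2 + c + 5 * (v * q + u : ℕ) = (v * (q * 5) + (u * 5 + c)) + 1 + 1 := by ring
  rw [encode, hidx, List.getD_cons_succ, List.getD_cons_succ,
    List.getD_flatMap_of_length_eq (m := q * 5) (by simp [List.length_flatMap, apply_ite]) _ _
      (by simp) (by omega), List.getD_flatMap_of_length_eq (m := 5) (by simp [apply_ite]) _ _
      (by simp) hc]
  simp

theorem stored_initial : I.Stored (RAM.initial I.encode 0) := by
  have hcell : ∀ (e : Fin p × Fin q) (c : ℕ), c < 5 →
      RAM.initial I.encode 0 ((2 + c : ℕ) + 5 * pairIndex e) =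
      (if e ∈ I.edges then [1, (I.reward e).num, ((I.reward e).den : ℤ),
        (I.cost e).num, ((I.cost e).den : ℤ)] else [0, 0, 0, 0, 0]).getD c 0 := by
    intro e c hc
    rw [← getD_encode I e hc, RAM.initial, if_pos ⟨rfl, by have := pairIndex_nonneg e; omega⟩]
    rfl
  refine ⟨rfl, rfl, fun e he => ?_, fun e he => ?_⟩
  all_goals
    have h0 := hcell e 0 (by norm_num)
    have h1 := hcell e 1 (by norm_num)
    have h2 := hcell e 2 (by norm_num)
    have h3 := hcell e 3 (by norm_num)
    have h4 := hcell e 4 (by norm_num)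
    simp only [he, if_true, if_false, Nat.reduceAdd, Nat.cast_ofNat] at h0 h1 h2 h3 h4
    exact ⟨h0, h1, h2, h3, h4⟩

theorem length_le_inputLength (w : List ℤ) : w.length ≤ RAM.inputLength w := by
  induction w with
  | nil => simp
  | cons z w ih =>
    have := RAM.bitLength_pos z
    simp only [RAM.inputLength, List.map_cons, List.sum_cons, List.length_cons] at ih ⊢
    omega

end MatchingInstance

/-! ## The algorithm -/

namespace RAM

notation "arrOut" => (1 : ℕ)
notation "varDenom" => (2 : ℕ)
notation "arrF" => (3 : ℕ)
notation "arrC" => (4 : ℕ)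
notation "varBound" => (5 : ℕ)
notation "varLineF" => (6 : ℕ)
notation "varLineC" => (7 : ℕ)
notation "varNum" => (8 : ℕ)
notation "varDen" => (9 : ℕ)
notation "varBest" => (10 : ℕ)
notation "varSumF" => (28 : ℕ)
notation "varSumC" => (29 : ℕ)
notation "cntRound" => (34 : ℕ)
notation "cntPair" => (35 : ℕ)

namespace LoopProg

open RAM.Expr Hungarian MatchingInstance

/-- The number of pairs of vertices. -/
abbrev numPairs : Expr := numRows * numCols

/-- The entry of the input with offset `c` for the current pair. -/
abbrev entry (c : ℤ) : Expr := .get 0 (.const c + .const 5 * var cntPair)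

/-- Compute a common denominator of all rewards and costs. -/
def commonDenom : LoopProg :=
  set varDenom 1 ;;
  loop cntPair numPairs
    (set varDenom ((entry 4 + 1 - entry 2) * (entry 6 + 1 - entry 2) * var varDenom))

/-- Multiply rewards and costs by the common denominator. -/
def scale : LoopProg :=
  set varBound 1 ;;
  loop cntPair numPairs
    (put arrF (var cntPair) (entry 3 * (var varDenom / entry 4)) ;;
      put arrC (var cntPair) (entry 5 * (var varDenom / entry 6)) ;;
      set varBound (var varBound + .get arrF (var cntPair)))

/-- The weights that correspond to the contract `varNum / varDen`. -/
def setWeights : LoopProg :=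
  loop cntPair numPairs
    (put arrW (var cntPair) (var varBound * (var varNum * .get arrF (var cntPair) -
        var varDen * .get arrC (var cntPair)) + .get arrF (var cntPair)) ;;
      ite (.get arrW (var cntPair)) nop (put arrW (var cntPair) 0))

/-- Reward and cost of the matched pairs of positive weight. -/
def collect : LoopProg :=
  set varSumF 0 ;; set varSumC 0 ;;
  loop cntRow numRows (ite (numCols - .get arrMateRow (var cntRow))
    (ite (.get arrW (var cntRow * numCols + .get arrMateRow (var cntRow)))
      (set varSumF (var varSumF +
          .get arrF (var cntRow * numCols + .get arrMateRow (var cntRow))) ;;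
        set varSumC (var varSumC +
          .get arrC (var cntRow * numCols + .get arrMateRow (var cntRow)))) nop) nop)

/-- Move the contract to the intersection of the current line with the line of the best response. -/
def moveContract : LoopProg :=
  set varNum (var varSumC - var varLineC) ;; set varDen (var varSumF - var varLineF)

/-- Compare the contract with the best one so far, and start with the next line. -/
def nextLine : LoopProg :=
  ite ((var varDen - var varNum) * var varSumF * .get arrOut 1 -
      (.get arrOut 1 - .get arrOut 0) * var varBest * var varDen)
    (put arrOut 0 (var varNum) ;; put arrOut 1 (var varDen) ;; set varBest (var varSumF)) nop ;;
  set varLineF (var varSumF) ;; set varLineC (var varSumC) ;; set varNum 1 ;; set varDen 1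

/-- One step of the enumeration of the breakpoints. -/
def round : LoopProg :=
  setWeights ;; maxWeightMatching ;; collect ;;
  ite ((var varNum * var varSumF - var varDen * var varSumC) -
    (var varNum * var varLineF - var varDen * var varLineC)) moveContract nextLine

/-- Compute an optimal contract. -/
def optimalContract : LoopProg :=
  commonDenom ;; scale ;;
  put arrOut 0 0 ;; put arrOut 1 1 ;; set varLineF 0 ;; set varLineC 0 ;; set varBest 0 ;;
  set varNum 1 ;; set varDen 1 ;;
  loop cntRound ((numPairs * numPairs + .const 4) * (numPairs * numPairs + .const 4)) round

/-- The tiers of the arrays of the algorithm. -/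
def contractTier (a : ℕ) : ℕ :=
  if a = 0 then 0 else if a = arrW ∨ a = arrY ∨ a = arrZ ∨ a = varSlack ∨ a = varTmp then 2 else 1

theorem isTiered_optimalContract : optimalContract.isTiered contractTier = true := by decide

theorem contractTier_le (a : ℕ) : contractTier a ≤ 2 := by
  rw [contractTier]; split_ifs <;> omega

variable {p q : ℕ} {σ : Memory} {I : MatchingInstance (Fin p) (Fin q) ℚ}

theorem exists_pairIndex_eq {k : ℤ} (h0 : 0 ≤ k) (h1 : k < p * q) :
    ∃ e : Fin p × Fin q, pairIndex e = k := by
  obtain ⟨n, rfl⟩ := Int.eq_ofNat_of_zero_le h0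
  refine ⟨finProdFinEquiv.symm ⟨n, by exact_mod_cast h1⟩, ?_⟩
  have := congrArg Fin.val (finProdFinEquiv.apply_symm_apply (⟨n, by exact_mod_cast h1⟩ : Fin (p * q)))
  rw [finProdFinEquiv_apply_val] at this
  rw [pairIndex]
  simp only at this
  zify at this
  linarith

theorem commonDenom_spec (hI : I.Stored (σ 0)) :
    0 < commonDenom.sem σ varDenom 0 ∧ ∀ e ∈ I.edges,
      ((I.reward e).den : ℤ) ∣ commonDenom.sem σ varDenom 0 ∧
      ((I.cost e).den : ℤ) ∣ commonDenom.sem σ varDenom 0 := by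
  rw [commonDenom, sem_seq]
  set σ₁ := (set varDenom 1).sem σ with hσ₁
  have hpos : ∀ k : ℤ, 0 ≤ k → k < p * q → 0 < σ 0 (4 + 5 * k) + 1 - σ 0 (2 + 5 * k) ∧
      0 < σ 0 (6 + 5 * k) + 1 - σ 0 (2 + 5 * k) := by
    intro k h0 h1
    obtain ⟨e, rfl⟩ := exists_pairIndex_eq h0 h1
    by_cases he : e ∈ I.edges
    · obtain ⟨c1, -, c2, -, c3⟩ := hI.on e he
      have := (I.reward e).den_pos
      have := (I.cost e).den_pos
      omega
    · obtain ⟨c1, -, c2, -, c3⟩ := hI.off e he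
      omega
  have key := sem_loop (σ := σ₁) (a := cntPair) (b := numPairs) (n := p * q)
    (P := set varDenom ((entry 4 + 1 - entry 2) * (entry 6 + 1 - entry 2) * var varDenom)) rfl
    (fun k τ => 0 < τ varDenom 0 ∧ ∀ j : ℤ, 0 ≤ j → j < k →
      (σ 0 (4 + 5 * j) + 1 - σ 0 (2 + 5 * j)) * (σ 0 (6 + 5 * j) + 1 - σ 0 (2 + 5 * j)) ∣
        τ varDenom 0) (by simp [hσ₁, hI.rows, hI.cols])
    (by
      refine ⟨by simp [hσ₁], fun j h0 h1 => by push_cast at h1; omega⟩)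
    (by
      intro k hk τ hτ hfr ⟨i1, i2⟩
      have e0 : τ 0 = σ 0 := by rw [hfr 0 rfl]; simp [hσ₁]
      obtain ⟨g1, g2⟩ := hpos k (by positivity) (by exact_mod_cast hk)
      refine ⟨?_, fun j h0 h1 => ?_⟩
      · simp [hτ, e0]
        positivity
      · simp only [sem_put, val_mul, val_add, val_sub, val_get, val_const, val_one, val_zero, hτ,
          e0, Memory.write_of_ne _ (show varDenom ≠ cntPair by decide), Memory.write_same,
          Function.update_self]
        push_cast at h1
        rcases (show j = k ∨ j < k by omega) with rfl | h
        · exact Dvd.intro _ rfl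
        · exact (i2 j h0 h).mul_left _)
  refine ⟨key.1, fun e he => ?_⟩
  have h1 := key.2 (pairIndex e) (pairIndex_nonneg e) (by exact_mod_cast pairIndex_lt e)
  obtain ⟨c1, -, c2, -, c3⟩ := hI.on e he
  rw [c1, c2, c3, add_sub_cancel_right, add_sub_cancel_right] at h1
  exact ⟨(Dvd.intro _ rfl).trans h1, (Dvd.intro_left _ rfl).trans h1⟩

theorem scale_spec (hI : I.Stored (σ 0)) (hD : 0 < σ varDenom 0)
    (hd : ∀ e ∈ I.edges, ((I.reward e).den : ℤ) ∣ σ varDenom 0 ∧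
      ((I.cost e).den : ℤ) ∣ σ varDenom 0) :
    I.Scaled (scale.sem σ varDenom 0) (scale.sem σ varBound 0) (scale.sem σ arrF)
      (scale.sem σ arrC) := by
  have eD : scale.sem σ varDenom = σ varDenom := sem_frame _ rfl σ
  have key : (∀ j : ℤ, 0 ≤ j → j < (p * q : ℕ) →
      scale.sem σ arrF j = σ 0 (3 + 5 * j) * (σ varDenom 0 / σ 0 (4 + 5 * j)) ∧
      scale.sem σ arrC j = σ 0 (5 + 5 * j) * (σ varDenom 0 / σ 0 (6 + 5 * j))) ∧
      scale.sem σ varBound 0 = 1 + ∑ k ∈ Finset.range (p * q), scale.sem σ arrF k := by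
    rw [scale, sem_seq]
    set σ₁ := (set varBound 1).sem σ with hσ₁
    refine sem_loop (σ := σ₁) (a := cntPair) (b := numPairs) (n := p * q)
      (P := put arrF (var cntPair) (entry 3 * (var varDenom / entry 4)) ;;
        put arrC (var cntPair) (entry 5 * (var varDenom / entry 6)) ;;
        set varBound (var varBound + .get arrF (var cntPair))) rfl
      (fun k τ => (∀ j : ℤ, 0 ≤ j → j < k →
        τ arrF j = σ 0 (3 + 5 * j) * (σ varDenom 0 / σ 0 (4 + 5 * j)) ∧
        τ arrC j = σ 0 (5 + 5 * j) * (σ varDenom 0 / σ 0 (6 + 5 * j))) ∧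
        τ varBound 0 = 1 + ∑ k ∈ Finset.range k, τ arrF k) (by simp [hσ₁, hI.rows, hI.cols])
      ⟨fun j h0 h1 => by push_cast at h1; omega, by simp [hσ₁]⟩ ?_
    intro k hk τ hτ hfr ⟨i1, i2⟩
    have e0 : τ 0 = σ 0 := by rw [hfr 0 rfl]; simp [hσ₁]
    have e1 : τ varDenom = σ varDenom := by rw [hfr varDenom rfl]; simp [hσ₁]
    refine ⟨fun j h0 h1 => ?_, ?_⟩
    · push_cast at h1
      rcases (show j = k ∨ j < k by omega) with rfl | h
      · simp [hτ, e0, e1]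
      · have := i1 j h0 h
        simp [hτ, e0, e1, Function.update_of_ne h.ne, this]
    · rw [Finset.sum_range_succ]
      have hs : ∀ x : ℤ, ∑ i ∈ Finset.range k, Function.update (τ arrF) (k : ℤ) x i =
          ∑ i ∈ Finset.range k, τ arrF i := fun x => Finset.sum_congr rfl fun i hi => by
        rw [Function.update_of_ne]
        have := Finset.mem_range.1 hi
        omega
      simp [hτ, e0, e1, i2, hs]
      ring
  obtain ⟨k1, k2⟩ := key
  have hlt : ∀ e : Fin p × Fin q, pairIndex e < (p * q : ℕ) := fun e => by
    exact_mod_cast pairIndex_lt e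
  have hcast : ∀ x : ℚ, ((x.den : ℤ) ∣ σ varDenom 0) →
      ((x.num * (σ varDenom 0 / x.den) : ℤ) : ℝ) = σ varDenom 0 * (x : ℝ) := by
    intro x ⟨d, hx⟩
    have h1 : (x.den : ℤ) ≠ 0 := by exact_mod_cast x.den_ne_zero
    have h2 : (x.den : ℝ) ≠ 0 := by exact_mod_cast x.den_ne_zero
    rw [hx, Int.mul_ediv_cancel_left _ h1, Rat.cast_def]
    push_cast
    field_simp
  rw [eD]
  refine ⟨hD, fun e he => ?_, fun e he => ?_, fun e he => ?_, fun e he => ?_, k2⟩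
  · obtain ⟨-, c1, c2, -, -⟩ := hI.on e he
    rw [(k1 _ (pairIndex_nonneg e) (hlt e)).1, c1, c2, hcast _ (hd e he).1]
    rfl
  · obtain ⟨-, -, -, c1, c2⟩ := hI.on e he
    rw [(k1 _ (pairIndex_nonneg e) (hlt e)).2, c1, c2, hcast _ (hd e he).2]
    rfl
  · rw [(k1 _ (pairIndex_nonneg e) (hlt e)).1, (hI.off e he).2.1, zero_mul]
  · rw [(k1 _ (pairIndex_nonneg e) (hlt e)).2, (hI.off e he).2.2.2.1, zero_mul]

theorem setWeights_spec (hp : σ 0 0 = p) (hq : σ 0 1 = q) {k : ℤ} (h0 : 0 ≤ k) (h1 : k < p * q) :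
    setWeights.sem σ arrW k = max 0 (σ varBound 0 * (σ varNum 0 * σ arrF k -
      σ varDen 0 * σ arrC k) + σ arrF k) := by
  rw [setWeights, sem_loop_map (n := p * q) (by decide) rfl (by simp [hp, hq]) (fun k =>
    max 0 (σ varBound 0 * (σ varNum 0 * σ arrF k - σ varDen 0 * σ arrC k) + σ arrF k)),
    if_pos ⟨h0, by exact_mod_cast h1⟩]
  intro k _ τ hτ hfr _
  have e1 := hfr varBound rfl
  have e2 := hfr varNum rfl
  have e3 := hfr varDen rfl
  have e4 := hfr arrF rfl
  have e5 := hfr arrC rfl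
  rw [sem_seq, sem_ite]
  simp only [sem_put, val_mul, val_add, val_sub, val_get, val_zero, hτ, e1, e2, e3, e4, e5,
    Memory.write_same, Function.update_self, sem_nop,
    Memory.write_of_ne _ (show cntPair ≠ arrW by decide)]
  split_ifs with h
  · rw [max_eq_right h.le]
  · rw [Function.update_idem, max_eq_left (not_lt.1 h)]

theorem collect_spec (hp : σ 0 0 = p) (hq : σ 0 1 = q)
    (hm : ∀ r : ℤ, 0 ≤ r → r < p → 0 ≤ σ arrMateRow r) :
    collect.sem σ varSumF 0 = ∑ e ∈ selected p q (σ arrW) (σ arrMateRow), σ arrF (pairIndex e) ∧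
    collect.sem σ varSumC 0 =
      ∑ e ∈ selected p q (σ arrW) (σ arrMateRow), σ arrC (pairIndex e) := by
  rw [sum_selected hm, sum_selected hm, collect, sem_seq, sem_seq]
  set σ₁ := (set varSumC 0).sem ((set varSumF 0).sem σ) with hσ₁
  have f1 : ∀ c, c ≠ varSumF → c ≠ varSumC → σ₁ c = σ c := fun c h h' => by
    rw [hσ₁, sem_put, sem_put, Memory.write_of_ne _ h', Memory.write_of_ne _ h]
  refine sem_loop (σ := σ₁) (a := cntRow) (b := numRows) (n := p) rfl
    (fun k τ => τ varSumF 0 = ∑ r ∈ Finset.range k,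
        (if σ arrMateRow r < q ∧ 0 < σ arrW (r * q + σ arrMateRow r) then
          σ arrF (r * q + σ arrMateRow r) else 0) ∧
      τ varSumC 0 = ∑ r ∈ Finset.range k,
        (if σ arrMateRow r < q ∧ 0 < σ arrW (r * q + σ arrMateRow r) then
          σ arrC (r * q + σ arrMateRow r) else 0)) (by simp [f1, hp]) (by simp [hσ₁]) ?_
  intro k hk τ hτ hfr ⟨i1, i2⟩
  have e0 : τ 0 = σ 0 := by rw [hfr 0 rfl, f1 0 (by decide) (by decide)]
  have e1 : τ arrMateRow = σ arrMateRow := by rw [hfr _ rfl, f1 _ (by decide) (by decide)]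
  have e2 : τ arrW = σ arrW := by rw [hfr _ rfl, f1 _ (by decide) (by decide)]
  have e3 : τ arrF = σ arrF := by rw [hfr _ rfl, f1 _ (by decide) (by decide)]
  have e4 : τ arrC = σ arrC := by rw [hfr _ rfl, f1 _ (by decide) (by decide)]
  rw [Finset.sum_range_succ, Finset.sum_range_succ, ← i1, ← i2,
    Memory.write_of_ne _ (by decide), Memory.write_of_ne _ (by decide)]
  simp only [sem_ite_apply, val_sub, val_get, val_zero, val_one, val_add, val_mul, hτ, e0, e1, e2,
    hq, sem_seq, sem_put, sem_nop, sub_pos]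
  by_cases h1 : σ arrMateRow k < q <;> by_cases h2 : 0 < σ arrW (k * q + σ arrMateRow k) <;>
    simp [h1, h2, e0, e1, e3, e4, hq, hτ]

end LoopProg

end RAM

namespace RAM

namespace LoopProg

open RAM.Expr Hungarian MatchingInstance

variable {p q : ℕ} {σ : Memory} {I : MatchingInstance (Fin p) (Fin q) ℚ} {R : Finset ℝ} {n : ℕ}

/-- The memory holds a state of the enumeration of breakpoints with at most `n` steps left. -/
structure Running (I : MatchingInstance (Fin p) (Fin q) ℚ) (R : Finset ℝ) (n : ℕ)
    (σ : Memory) : Prop where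
  stored : I.Stored (σ 0)
  scaled : I.Scaled (σ varDenom 0) (σ varBound 0) (σ arrF) (σ arrC)
  den_pos : 0 < σ varDen 0
  out_pos : 0 < σ arrOut 1
  enum : I.toReal.Enumeration (σ varLineF 0 / σ varDenom 0) (σ varLineC 0 / σ varDenom 0)
    (σ varNum 0 / σ varDen 0) (σ arrOut 0 / σ arrOut 1) (σ varBest 0 / σ varDenom 0)
  steps : I.toReal.StepsLeft R (σ varLineF 0 / σ varDenom 0) (σ varLineC 0 / σ varDenom 0)
    (σ varNum 0 / σ varDen 0) n

theorem Running.congr {τ : Memory} (h : Running I R n σ)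
    (hτ : ∀ c ≤ varBest, τ c = σ c) : Running I R n τ := by
  obtain ⟨h1, h2, h3, h4, h5, h6⟩ := h
  refine ⟨?_, ?_, ?_, ?_, ?_, ?_⟩ <;>
    simpa only [hτ 0 (by norm_num), hτ 1 (by norm_num), hτ 2 (by norm_num), hτ 3 (by norm_num),
      hτ 4 (by norm_num), hτ 5 (by norm_num), hτ 6 (by norm_num), hτ 7 (by norm_num),
      hτ 8 (by norm_num), hτ 9 (by norm_num), hτ 10 (by norm_num)]

/-- The memory holds the reward and the cost of the best response. -/
structure Responded (I : MatchingInstance (Fin p) (Fin q) ℚ) (M : Finset (Fin p × Fin q))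
    (σ : Memory) : Prop where
  favored : I.toReal.IsFavored (σ varNum 0 / σ varDen 0) M
  reward : ∑ e ∈ M, I.toReal.reward e = σ varSumF 0 / σ varDenom 0
  cost : I.toReal.setCost M = σ varSumC 0 / σ varDenom 0

theorem Running.respond (h : Running I R n σ) (hq : 0 < q) : ∃ M,
    Running I R n (collect.sem (maxWeightMatching.sem (setWeights.sem σ))) ∧
    Responded I M (collect.sem (maxWeightMatching.sem (setWeights.sem σ))) := by
  set σ₁ := setWeights.sem σ with hσ₁
  set σ₂ := maxWeightMatching.sem σ₁ with hσ₂
  set σ₃ := collect.sem σ₂ with hσ₃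
  have f1 : ∀ c, setWeights.writes c = false → σ₁ c = σ c := fun c h => sem_frame _ h σ
  have f2 : ∀ c, maxWeightMatching.writes c = false → σ₂ c = σ₁ c := fun c h => sem_frame _ h σ₁
  have f3 : ∀ c, collect.writes c = false → σ₃ c = σ₂ c := fun c h => sem_frame _ h σ₂
  have hfr : ∀ c ≤ varBest, σ₂ c = σ c ∧ σ₃ c = σ c := by
    intro c hc
    have : σ₂ c = σ c := by interval_cases c <;> exact (f2 _ rfl).trans (f1 _ rfl)
    refine ⟨this, ?_⟩
    rw [← this]
    interval_cases c <;> exact f3 _ rfl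
  have hrun : Running I R n σ₃ := h.congr fun c hc => (hfr c hc).2
  have hp0 : σ 0 0 = p := h.stored.rows
  have hq0 : σ 0 1 = q := h.stored.cols
  have hw : σ₂ arrW = σ₁ arrW := f2 _ rfl
  have hmatched : Matched (p + q) p p (-1) (paddedWeight q (σ₁ arrW)) (σ₂ arrY) (σ₂ arrZ)
      (σ₂ arrMateRow) (σ₂ arrMateCol) :=
    maxWeightMatching_spec (by rw [f1 0 rfl, hp0]) (by rw [f1 0 rfl, hq0])
  have hfav := h.scaled.isFavored_selected h.den_pos (n := σ varNum 0) (by exact_mod_cast hq)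
    (fun k h0 h1 => setWeights_spec hp0 hq0 h0 h1) hmatched
  obtain ⟨c1, c2⟩ := collect_spec (σ := σ₂) (p := p) (q := q) (by rw [(hfr 0 (by norm_num)).1, hp0])
    (by rw [(hfr 0 (by norm_num)).1, hq0])
    (fun r h0 h1 => (hmatched.row r h0 h1).1)
  rw [hw, (hfr arrF (by norm_num)).1] at c1
  rw [hw, (hfr arrC (by norm_num)).1] at c2
  have hD : (σ varDenom 0 : ℝ) ≠ 0 := by
    have := h.scaled.pos
    exact_mod_cast this.ne'
  refine ⟨selected p q (σ₁ arrW) (σ₂ arrMateRow), hrun, ⟨?_, ?_, ?_⟩⟩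
  · rw [(hfr varNum (by norm_num)).2, (hfr varDen (by norm_num)).2]
    exact hfav
  · rw [(hfr varDenom (by norm_num)).2, hσ₃, c1, h.scaled.sum_reward hfav.subset,
      mul_div_cancel_left₀ _ hD]
  · rw [(hfr varDenom (by norm_num)).2, hσ₃, c2, h.scaled.sum_cost hfav.subset,
      mul_div_cancel_left₀ _ hD]

variable {M : Finset (Fin p × Fin q)}

theorem Responded.below_iff (hM : Responded I M σ) (h : Running I R n σ) :
    (0 < (σ varNum 0 * σ varSumF 0 - σ varDen 0 * σ varSumC 0) -
      (σ varNum 0 * σ varLineF 0 - σ varDen 0 * σ varLineC 0)) ↔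
    (σ varNum 0 / σ varDen 0 : ℝ) * (σ varLineF 0 / σ varDenom 0) - σ varLineC 0 / σ varDenom 0 <
      I.toReal.maxUtility (σ varNum 0 / σ varDen 0) := by
  have h1 := hM.favored.setCost_eq_sub
  rw [← hM.favored.sum_eq, hM.reward, hM.cost] at h1
  rw [show I.toReal.maxUtility (σ varNum 0 / σ varDen 0 : ℝ) =
    (σ varNum 0 / σ varDen 0 : ℝ) * (σ varSumF 0 / σ varDenom 0) - σ varSumC 0 / σ varDenom 0 by
      linarith]
  have hD : (0 : ℝ) < σ varDenom 0 := by exact_mod_cast h.scaled.pos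
  have hd : (0 : ℝ) < σ varDen 0 := by exact_mod_cast h.den_pos
  rw [← @Int.cast_lt ℝ, ← sub_pos (b := (_ * _ - _ : ℝ)), ← mul_pos_iff_of_pos_left (mul_pos hD hd)]
  push_cast
  have : ∀ a b : ℝ, a = b → (0 < a ↔ 0 < b) := fun a b h => by rw [h]
  apply this
  field_simp

theorem moveContract_spec (h : Running I R (n + 1) σ) (hM : Responded I M σ)
    (hR : ∀ γ, 0 ≤ γ → I.toReal.slope γ ∈ R)
    (hlt : (σ varNum 0 / σ varDen 0 : ℝ) * (σ varLineF 0 / σ varDenom 0) -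
      σ varLineC 0 / σ varDenom 0 < I.toReal.maxUtility (σ varNum 0 / σ varDen 0)) :
    Running I R n (moveContract.sem σ) := by
  obtain ⟨h1, h2, h3⟩ := h.enum.newton hR h.steps hM.favored hlt
  have hD : (0 : ℝ) < σ varDenom 0 := by exact_mod_cast h.scaled.pos
  rw [hM.reward, hM.cost, ← sub_div, ← sub_div, div_div_div_cancel_right₀ hD.ne'] at h2 h3
  rw [hM.reward, ← sub_div, div_pos_iff_of_pos_right hD] at h1
  refine ⟨h.stored, h.scaled, ?_, h.out_pos, ?_, ?_⟩
  · simp only [moveContract, sem_seq, sem_put, val_sub, val_get, val_zero]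
    simp
    exact_mod_cast sub_pos.1 h1
  · simpa [moveContract] using h2
  · simpa [moveContract] using h3

theorem nextLine_spec (h : Running I R (n + 1) σ) (hM : Responded I M σ)
    (hR : ∀ γ, 0 ≤ γ → I.toReal.slope γ ∈ R)
    (hlt : ¬ (σ varNum 0 / σ varDen 0 : ℝ) * (σ varLineF 0 / σ varDenom 0) -
      σ varLineC 0 / σ varDenom 0 < I.toReal.maxUtility (σ varNum 0 / σ varDen 0)) :
    Running I R n (nextLine.sem σ) := by
  have hD : (0 : ℝ) < σ varDenom 0 := by exact_mod_cast h.scaled.pos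
  have hd : (0 : ℝ) < σ varDen 0 := by exact_mod_cast h.den_pos
  have ho : (0 : ℝ) < σ arrOut 1 := by exact_mod_cast h.out_pos
  have hiff : (1 - σ arrOut 0 / σ arrOut 1 : ℝ) * (σ varBest 0 / σ varDenom 0) <
      (1 - σ varNum 0 / σ varDen 0) * (σ varSumF 0 / σ varDenom 0) ↔
      0 < (σ varDen 0 - σ varNum 0) * σ varSumF 0 * σ arrOut 1 -
        (σ arrOut 1 - σ arrOut 0) * σ varBest 0 * σ varDen 0 := by
    rw [← @Int.cast_lt ℝ, ← sub_pos,
      ← mul_pos_iff_of_pos_left (mul_pos (mul_pos hD hd) ho)]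
    push_cast
    have : ∀ a b : ℝ, a = b → (0 < a ↔ 0 < b) := fun a b h => by rw [h]
    apply this
    field_simp
  have key := fun α' fα' => h.enum.breakpoint (α' := α') (fα' := fα') hR h.steps hM.favored hlt
  rw [hM.reward, hM.cost, hiff] at key
  by_cases hc : 0 < (σ varDen 0 - σ varNum 0) * σ varSumF 0 * σ arrOut 1 -
        (σ arrOut 1 - σ arrOut 0) * σ varBest 0 * σ varDen 0
  · obtain ⟨k1, k2⟩ := key _ _ (Or.inl ⟨hc, rfl, rfl⟩)
    rw [nextLine, sem_seq, sem_ite_of_pos _ _ (by simpa using hc)]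
    refine ⟨h.stored, h.scaled, ?_, ?_, ?_, ?_⟩
    · simp
    · simpa using h.den_pos
    · simpa using k1
    · simpa using k2
  · obtain ⟨k1, k2⟩ := key _ _ (Or.inr ⟨hc, rfl, rfl⟩)
    rw [nextLine, sem_seq, sem_ite_of_not_pos _ _ (by simpa using hc)]
    refine ⟨h.stored, h.scaled, ?_, ?_, ?_, ?_⟩
    · simp
    · simpa using h.out_pos
    · simpa using k1
    · simpa using k2

theorem round_spec (h : Running I R (n + 1) σ) (hq : 0 < q)
    (hR : ∀ γ, 0 ≤ γ → I.toReal.slope γ ∈ R) : Running I R n (round.sem σ) := by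
  obtain ⟨M, h1, h2⟩ := h.respond hq
  rw [round, sem_seq, sem_seq, sem_seq]
  have hiff := h2.below_iff h1
  set τ := collect.sem (maxWeightMatching.sem (setWeights.sem σ))
  by_cases hc : 0 < (τ varNum 0 * τ varSumF 0 - τ varDen 0 * τ varSumC 0) -
      (τ varNum 0 * τ varLineF 0 - τ varDen 0 * τ varLineC 0)
  · rw [sem_ite_of_pos _ _ (by simpa using hc)]
    exact moveContract_spec h1 h2 hR (hiff.1 hc)
  · rw [sem_ite_of_not_pos _ _ (by simpa using hc)]
    exact nextLine_spec h1 h2 hR (fun h => hc (hiff.2 h))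

theorem optimalContract_spec (hI : I.Stored (σ 0)) (hq : 0 < q)
    (hR : ∀ γ, 0 ≤ γ → I.toReal.slope γ ∈ R)
    (hcard : R.card + 2 ≤ p * q * (p * q) + 4) :
    0 < optimalContract.sem σ arrOut 1 ∧ ∀ τ, I.toReal.IsOptimalContract τ
      (optimalContract.sem σ arrOut 0 / optimalContract.sem σ arrOut 1 : ℝ) := by
  set T := (p * q * (p * q) + 4) * (p * q * (p * q) + 4) with hT
  suffices h : Running I R (T - T) (optimalContract.sem σ) by
    refine ⟨h.out_pos, fun τ => h.enum.isOptimalContract ?_ hR τ⟩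
    simpa using h.steps
  have e1 : commonDenom.sem σ 0 = σ 0 := sem_frame _ rfl σ
  obtain ⟨d1, d2⟩ := commonDenom_spec hI
  set σ₁ := commonDenom.sem σ with hσ₁
  have hs := scale_spec (σ := σ₁) (by rw [e1]; exact hI) d1 d2
  have e2 : scale.sem σ₁ 0 = σ 0 := by rw [sem_frame _ rfl σ₁, e1]
  set σ₂ := scale.sem σ₁ with hσ₂
  simp only [optimalContract, sem_seq, ← hσ₁, ← hσ₂]
  refine sem_loop rfl (fun k τ => Running I R (T - k) τ) ?_ ?_ ?_
  · simp [e2, hI.rows, hI.cols, hT]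
  · refine ⟨by simpa [e2] using hI, hs, by simp, by simp, ?_, ?_⟩
    · simpa using I.toReal.enumeration_init
    · have := (I.toReal.stepsLeft_init R).mono
        (show (R.card + 2) ^ 2 ≤ T by rw [sq]; exact Nat.mul_le_mul hcard hcard)
      simpa using this
  · intro k hk τ _ _ hrun
    rw [show T - k = T - (k + 1) + 1 by omega] at hrun
    refine (round_spec hrun hq hR).congr fun c hc => Memory.write_of_ne _ ?_ _ _
    intro h
    rw [h] at hc
    omega

theorem boundsLE_optimalContract {L : ℕ} (hp : σ 0 0 = p) (hq : σ 0 1 = q)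
    (h0 : 0 < p * q) (hL : p * q ≤ L) : optimalContract.BoundsLE σ ((L * L + 4) * (L * L + 4)) := by
  have hp0 := Nat.pos_of_mul_pos_left h0
  have hq0 := Nat.pos_of_mul_pos_right h0
  have h1 : p ≤ p * q := by nlinarith
  have h2 : q ≤ p * q := by nlinarith
  have h3 : p * q * (p * q) ≤ L * L := Nat.mul_le_mul hL hL
  have h4 : (p * q * (p * q) + 4) * (p * q * (p * q) + 4) ≤ (L * L + 4) * (L * L + 4) :=
    Nat.mul_le_mul (by omega) (by omega)
  have h5 : 2 * L ≤ (L * L + 4) * (L * L + 4) := by nlinarith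
  have b1 : (p : ℤ) ≤ ((L * L + 4) * (L * L + 4) : ℕ) := by omega
  have b2 : (q : ℤ) ≤ ((L * L + 4) * (L * L + 4) : ℕ) := by omega
  have b3 : (p + q : ℤ) ≤ ((L * L + 4) * (L * L + 4) : ℕ) := by omega
  have b4 : (p * q : ℤ) ≤ ((L * L + 4) * (L * L + 4) : ℕ) := by
    have : p * q ≤ (L * L + 4) * (L * L + 4) := by omega
    exact_mod_cast this
  have b5 : ((p * q * (p * q) + 4) * (p * q * (p * q) + 4) : ℤ) ≤
    ((L * L + 4) * (L * L + 4) : ℕ) := by exact_mod_cast h4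
  generalize (L * L + 4) * (L * L + 4) = X at *
  simp only [optimalContract, round, moveContract, nextLine, collect, setWeights, scale,
    commonDenom, maxWeightMatching, matchRow, initTree, growTree, augment, shiftPrices, minSlack,
    compareSlack, BoundsLE, val_mul, val_add, val_get, val_zero, val_one, val_const, hp, hq]
  tauto

end LoopProg

end RAM

namespace MatchingInstance

variable {p q : ℕ} (I : MatchingInstance (Fin p) (Fin q) ℚ)

theorem OneSidedCosts.toReal {I : MatchingInstance (Fin p) (Fin q) ℚ} (h : I.OneSidedCosts) :
    I.toReal.OneSidedCosts := by
  obtain ⟨c, hc⟩ := h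
  refine ⟨fun u => (c u : ℝ), fun e he => ?_⟩
  change ((I.cost e : ℚ) : ℝ) = _
  rw [hc e he]

theorem isOptimalContract_of_edges_eq_empty {V U : Type*} {I : MatchingInstance V U ℝ}
    (h : I.edges = ∅) (τ : TieBreaking (V × U)) : I.IsOptimalContract τ 0 := by
  have h0 : ∀ α, I.principalUtility τ α = 0 := by
    intro α
    obtain ⟨M, hM⟩ := I.exists_isFavored α
    have hM0 : M = ∅ := Finset.subset_empty.1 (h ▸ hM.subset)
    rw [hM.principalUtility_eq, hM0, Finset.sum_empty, mul_zero]
  exact ⟨⟨le_rfl, zero_le_one⟩, fun β _ => by rw [h0, h0]⟩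

theorem pairs_lt_inputLength : p * q < RAM.inputLength I.encode := by
  have h1 := length_le_inputLength I.encode
  rw [length_encode] at h1
  have : p * (q * 5) = 5 * (p * q) := by ring
  omega

open RAM LoopProg in
/-- The program runs the main algorithm if there are pairs of vertices at all. -/
theorem exists_program : ∃ (P : Prog) (b : Polynomial ℕ),
    ∀ (p q : ℕ) (I : MatchingInstance (Fin p) (Fin q) ℚ), I.OneSidedCosts →
      ∃ α : ℚ, OutputsWithin P I.encode α (b.eval (inputLength I.encode)) ∧
        ∀ τ : TieBreaking (Fin p × Fin q), I.toReal.IsOptimalContract τ (α : ℝ) := by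
  obtain ⟨b, hb⟩ := exists_polynomial_time optimalContract isTiered_optimalContract contractTier_le
    ((Polynomial.X * Polynomial.X + 4) * (Polynomial.X * Polynomial.X + 4))
  refine ⟨.ifPos numPairs optimalContract.compile (.put 1 (.const 1) (.const 1)),
    Polynomial.C (numPairs.size ^ 2) * Polynomial.X + b + 6, fun p q I hI => ?_⟩
  have hL := I.pairs_lt_inputLength
  have hst : I.Stored (initial I.encode 0) := I.stored_initial
  have htime : numPairs.time (initial I.encode) ≤ numPairs.size ^ 2 * inputLength I.encode :=
    Expr.time_le (by omega) (bitLength_initial_le _ (by omega)) _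
  have hval : numPairs.val (initial I.encode) = (p * q : ℕ) := by simp [hst.rows, hst.cols]
  simp only [Polynomial.eval_add, Polynomial.eval_mul, Polynomial.eval_C, Polynomial.eval_X,
    Polynomial.eval_ofNat]
  by_cases h0 : 0 < p * q
  · obtain ⟨t, ht, htb⟩ := hb I.encode (by omega) (by
      simpa using boundsLE_optimalContract hst.rows hst.cols h0 hL.le)
    obtain ⟨R, hcard, hR⟩ := hI.toReal.exists_rewards
    have hq : 0 < q := Nat.pos_of_ne_zero fun h => by simp [h] at h0
    have hp : 0 < p := Nat.pos_of_ne_zero fun h => by simp [h] at h0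
    obtain ⟨h1, h2⟩ := optimalContract_spec (σ := initial I.encode) (R := R) hst hq
      (fun γ hγ => by
        obtain ⟨M, hM⟩ := I.toReal.exists_isFavored γ
        rw [← hM.sum_eq]
        exact hR γ hγ M hM) (by
        rw [Fintype.card_fin] at hcard
        have : q ≤ p * q := Nat.le_mul_of_pos_left _ hp
        have := Nat.mul_le_mul this this
        rw [sq] at hcard
        omega)
    refine ⟨(optimalContract.sem (initial I.encode) 1 0 : ℚ) / optimalContract.sem (initial I.encode) 1 1,
      ⟨_, _, .ifPos_true (by rw [hval]; exact_mod_cast h0) ht, by omega, h1, rfl⟩, fun τ => ?_⟩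
    have := h2 τ
    push_cast
    exact this
  · refine ⟨0, ⟨_, _, .ifPos_false (by rw [hval]; exact_mod_cast h0) (.put _ _ _ _), ?_, ?_, ?_⟩,
      fun τ => ?_⟩
    · have h1 : (Expr.const 1).time (initial I.encode) = 2 := rfl
      rw [h1]
      omega
    · simp
    · simp [initial]
    · rw [Rat.cast_zero]
      refine isOptimalContract_of_edges_eq_empty (Finset.eq_empty_of_forall_notMem fun e _ => h0 ?_) τ
      exact Nat.mul_pos (Fin.pos e.1) (Fin.pos e.2)

end MatchingInstance

theorem mainTheorem4 :
    (∃ C : ℕ, ∀ (V U : Type*) [Fintype V] [Fintype U] (I : MatchingInstance V U ℝ),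
      0 < Fintype.card V + Fintype.card U → I.OneSidedCosts →
        ∀ τ : TieBreaking (V × U),
          (I.criticalValues τ).Finite ∧
            (I.criticalValues τ).ncard ≤ C * (Fintype.card V + Fintype.card U) ^ 2) ∧
    (∃ (P : RAM.Prog) (b : Polynomial ℕ),
      ∀ (p q : ℕ) (I : MatchingInstance (Fin p) (Fin q) ℚ), I.OneSidedCosts →
        ∃ α : ℚ, RAM.OutputsWithin P I.encode α (b.eval (RAM.inputLength I.encode)) ∧
          ∀ τ : TieBreaking (Fin p × Fin q), I.toReal.IsOptimalContract τ (α : ℝ)) := by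
  refine ⟨⟨3, fun V U _ _ I hn hI τ => ?_⟩, MatchingInstance.exists_program⟩
  obtain ⟨h1, h2⟩ := hI.criticalValues_finite τ
  refine ⟨h1, h2.trans ?_⟩
  have h3 : Fintype.card U ^ 2 ≤ (Fintype.card V + Fintype.card U) ^ 2 :=
    Nat.pow_le_pow_left (Nat.le_add_left _ _) 2
  have h4 : 0 < (Fintype.card V + Fintype.card U) ^ 2 := by positivity
  omega
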